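/- **Setting.** *Object.* Let $\mathcal O\subset\mathbb R^3$ be a nonempty compact triangulated object: $\partial\mathcal O=\bigcup_{i=1}^N\Delta_i$ with $\Delta_i$ nondegenerate closed triangles, any two distinct ones meeting in $\emptyset$, a vertex or an edge, no relative interior of a triangle meeting an edge, each $\Delta_i$ having an outward unit normal $\mathbf n_i$ (for $\mathbf x\in\mathrm{relint}\,\Delta_i$ and small $t>0$: $\mathbf x+t\mathbf n_i\notin\mathcal O$, $\mathbf x-t\mathbf n_i\in\mathcal O$). Let $\Phi=\bigcup_i\mathrm{relint}\,\Delta_i$, let $\mathbf n(\mathbf x)$ be the normal at $\mathbf x\in\Phi$, $\mu$ the surface measure (two-dimensional Lebesgue measure on each face, carried by $\Phi$), $\mathrm{area}(\partial\mathcal O)=\mu(\partial\mathcal O)$, and $L^2=L^2(\mu)$. Let the albedo $\rho:\partial\mathcal O\to(0,1]$ be $\mu$-measurable, $\rho_\star=\sup_{\partial\mathcal O}\rho$. Put $\nu(\mathbf x,\mathbf u)=1$ if $(\mathbf x+\mathbb R_+\mathbf u)\cap\mathcal O=\{\mathbf x\}$ and $0$ otherwise; $V(\mathbf x,\mathbf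 x')=1$ if $[\mathbf x,\mathbf x']\cap\mathcal O=\{\mathbf x,\mathbf x'\}$ and $0$ otherwise. With $\sigma$ the surface measure of the unit sphere $\mathbb S^2$, set $$\tilde\nu(\mathbf x)=\frac1\pi\int_{\langle\mathbf u,\mathbf n(\mathbf x)\rangle\ge0}\langle\mathbf n(\mathbf x),\mathbf u\rangle\,\nu(\mathbf x,\mathbf u)\,d\sigma(\mathbf u)\quad(\mathbf x\in\Phi),\qquad \nu_\star=\inf_{\Phi}\tilde\nu.$$ For $\mathbf u\in\mathbb S^2$ let $\bar{\mathcal D}[\mathbf u](\mathbf x)=\rho(\mathbf x)\max(\langle\mathbf n(\mathbf x),\mathbf u\rangle,0)\,\nu(\mathbf x,\mathbf u)$ on $\Phi$ and $0$ elsewhere on $\partial\mathcal O$; for $f:\mathbb S^2\to\mathbb R$ let $\mathcal D[f]=\int\bar{\mathcal D}[\mathbf u]f(\mathbf u)\,d\sigma(\mathbf u)$. Let $\mathcal T[g](\mathbf x)=\int\kappa(\mathbf x,\mathbf x')g(\mathbf x')\,d\mu(\mathbf x')$ for $\mathbf x\in\Phi$, and $0$ on $\partial\mathcal O\setminus\Phi$,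 where $$\kappa(\mathbf x,\mathbf x')=\frac{\rho(\mathbf x)}{\pi}\,\frac{\langle\mathbf n(\mathbf x'),\mathbf x-\mathbf x'\rangle\langle\mathbf n(\mathbf x),\mathbf x'-\mathbf x\rangle}{\|\mathbf x-\mathbf x'\|^4}\,V(\mathbf x,\mathbf x').$$ *Shadowing edges.* Let $S[\mathbf u]=\{\mathbf x\in\partial\mathcal O:\bar{\mathcal D}[\mathbf u](\mathbf x)=0\}$, let $\chi[\mathbf u]$ be the set of the points $\mathbf x+t^\star\mathbf u$, $t^\star=\inf\{t>0:\mathbf x+t\mathbf u\in\partial\mathcal O\}<\infty$, where $\mathbf x$ runs over the points of $\Phi$ in the boundary of $S[\mathbf u]$ relative to $\partial\mathcal O$, and $\chi_\star=\sup_{\mathbf u\in\mathbb S^2}\mathrm{length}(\chi[\mathbf u])$ (one-dimensional Hausdorff measure). *Sensor.* A perspective camera with centre $\mathbf 0$, axis $\mathbf e_3$, focal length $f_c>0$, lens diameter $d_c>0$, gain $\gamma_c>0$ and $m$ non-overlapping square pixels $I_i$ of side $s_c>0$ in the image plane $\{x_3=-f_c\}$. Let $\beta_c=\frac{\gamma_c}4\frac{d_c^2}{f_c^2}$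 and let $\ell=\min_{\mathbf x\in\mathcal O}\langle\mathbf e_3,\mathbf x\rangle$. Let $\mathfrak p(\mathbf x)=-f_c\mathbf x/\langle\mathbf e_3,\mathbf x\rangle$ be the projection restricted to the visible part $\{\mathbf x\in\partial\mathcal O:[\mathbf x,\mathbf 0]\cap\mathcal O=\{\mathbf x\}\}$, on which it is injective if $\ell>0$, and let $\mathcal P[g]\in\mathbb R^m$ have the entries $$\mathcal P_i[g]=\beta_c\int_{I_i\cap\mathrm{im}\,\mathfrak p}g(\mathfrak p^{-1}(\mathbf z))\,\langle\mathbf z/\|\mathbf z\|,\mathbf e_3\rangle^4\,d\mathbf z .$$ *Cones.* Let $\bar{\mathbf y}[\mathbf u]=\mathcal P(\mathcal I-\mathcal T)^{-1}\bar{\mathcal D}[\mathbf u]$ and $\mathbf y[f]=\mathcal P(\mathcal I-\mathcal T)^{-1}\mathcal D[f]$. For $\alpha>0$ let $\mathcal F_\alpha$ be the set of the functions $f_d+\alpha/\sigma(\mathbb S^2)$ with $f_d\ge0$ Riemann integrable on $\mathbb S^2$ (that is, $f_d\sin\varphi$ is Riemann integrable on the rectangle $[0,2\pi]\times[0,\pi]$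 of the spherical coordinates, $\varphi$ the polar angle) and $\int f_d\,d\sigma\le1$; let $C_\alpha=\mathbb R_+\,\mathbf y[\mathcal F_\alpha]$ and $\mathbf y_a=\frac1{\sigma(\mathbb S^2)}\int\bar{\mathbf y}[\mathbf u]\,d\sigma(\mathbf u)$. For $C,\hat C\subseteq\mathbb R^m$ let $\delta(C,\hat C)=\max\{\sup_{\mathbf y\in C,\|\mathbf y\|=1}d(\mathbf y,\hat C),\ \sup_{\mathbf y\in\hat C,\|\mathbf y\|=1}d(\mathbf y,C)\}$ (a supremum over the empty set being $0$). **Theorem.** Assume $\ell>0$ and $\rho_\star(1-\nu_\star)<1$. Then: 1. The model is well posed: every $\bar{\mathcal D}[\mathbf u]$, and $\mathcal D[f]$ for every nonnegative Riemann integrable $f$, is in $L^2$; $\mathcal T$ is a bounded operator on $L^2$ with $\|\mathcal T\|<1$, so that $\mathcal I-\mathcal T$ is invertible; and $\mathcal P$ is well defined on $L^2$. All the defining integrals converge (that of $\mathcal T[g](\mathbf x)$ for almost every $\mathbf x$). 2. For all $\mathbf u,\mathbf u'\in\mathbb S^2$ with $\|\mathbf u-\mathbf u'\|_2\le\sqrt2$,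 $$\|\bar{\mathbf y}[\mathbf u]-\bar{\mathbf y}[\mathbf u']\|_2\le 2^{1/4}\frac{\beta_c\rho_\star f_cs_c}{\ell(1-\rho_\star(1-\nu_\star))}\Bigl(2\,\mathrm{area}(\partial\mathcal O)\|\mathbf u-\mathbf u'\|_2^2+32\sqrt2\,\mathrm{diam}(\mathcal O)\,\chi_\star\|\mathbf u-\mathbf u'\|_2\Bigr)^{1/2}.$$ 3. There is a constant $K>0$, depending only on the object and the sensor, such that for all $\alpha,\varepsilon>0$ there are $n=\lceil K/(\alpha\varepsilon)^4\rceil$ directions $\mathbf u_1,\dots,\mathbf u_n\in\mathbb S^2$ with $$\delta\bigl(C_\alpha,\ \mathrm{cone}\{\bar{\mathbf y}[\mathbf u_1]+\alpha\mathbf y_a,\dots,\bar{\mathbf y}[\mathbf u_n]+\alpha\mathbf y_a,\ \mathbf y_a\}\bigr)\le\varepsilon .$$ -/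

import Mathlib

open MeasureTheory Set Filter Topology
open scoped InnerProductSpace

noncomputable section

namespace Lambertian

/-- Three-dimensional Euclidean space. -/
abbrev E3 : Type := EuclideanSpace ℝ (Fin 3)

/-- Two-dimensional Euclidean space (coordinates in the image plane). -/
abbrev E2 : Type := EuclideanSpace ℝ (Fin 2)

/-- The unit sphere of directions. -/
abbrev S2 : Type := Metric.sphere (0 : E3) 1

/-- The spherical (surface) measure on the unit sphere; its total mass is `4 * π`. -/
def sphereMeasure : Measure S2 := (volume : Measure E3).toSphere

/-- The third coordinate vector: the optical axis of the camera. -/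
def e3 : E3 := EuclideanSpace.single 2 1

/-! ### Triangulated Lambertian objects -/

/-- The closed triangle spanned by the vertices of `Δ`. -/
def closedTriangle (Δ : Affine.Triangle ℝ E3) : Set E3 := convexHull ℝ (range Δ.points)

/-- The relative interior of the triangle `Δ`. -/
def openTriangle (Δ : Affine.Triangle ℝ E3) : Set E3 := intrinsicInterior ℝ (closedTriangle Δ)

/-- The set `{v}` for each vertex `v` of one of the given triangles. -/
def vertexSets {N : ℕ} (face : Fin N → Affine.Triangle ℝ E3) : Set (Set E3) :=
  {s | ∃ i k, s = {(face i).points k}}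

/-- The edges (closed segments) of the given triangles. -/
def edgeSets {N : ℕ} (face : Fin N → Affine.Triangle ℝ E3) : Set (Set E3) :=
  {s | ∃ i k₁ k₂, k₁ ≠ k₂ ∧ s = segment ℝ ((face i).points k₁) ((face i).points k₂)}

/-- A triangulated object: a nonempty compact solid in space, whose boundary is a finite union of
nondegenerate triangles any two of which meet in nothing, in a vertex, or in an edge; no
relative interior of a triangle meets an edge; and each triangle has an outward unit normal
(leaving the triangle along the normal one leaves the body, and in the opposite direction one
enters it, so that the normal is unique). -/
structure TriangulatedObject where
  body : Set E3
  isCompact_body : IsCompact body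
  nonempty_body : body.Nonempty
  N : ℕ
  face : Fin N → Affine.Triangle ℝ E3
  frontier_body : frontier body = ⋃ i, closedTriangle (face i)
  inter_faces : ∀ i j, i ≠ j →
    closedTriangle (face i) ∩ closedTriangle (face j) ∈
      ({∅} : Set (Set E3)) ∪ vertexSets face ∪ edgeSets face
  disjoint_edges : ∀ i, ∀ e ∈ edgeSets face, Disjoint (openTriangle (face i)) e
  normal : Fin N → E3
  norm_normal : ∀ i, ‖normal i‖ = 1
  normal_orthogonal : ∀ i k₁ k₂, ⟪normal i, (face i).points k₁ - (face i).points k₂⟫_ℝ = 0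
  normal_outward : ∀ i, ∀ x ∈ openTriangle (face i),
    ∀ᶠ t in 𝓝[>] (0 : ℝ), x + t • normal i ∉ body ∧ x - t • normal i ∈ body

namespace TriangulatedObject

variable (O : TriangulatedObject)

/-- `Φ`: the union of the relative interiors of the faces. -/
def Φ : Set E3 := ⋃ i, openTriangle (O.face i)

open Classical in
/-- The outward normal `n(x)` at a point of `Φ` (the relative interiors of different faces are
disjoint, so at most one summand is nonzero; off `Φ` the value is `0` and is never used). -/
def normalAt (x : E3) : E3 := ∑ i, if x ∈ openTriangle (O.face i) then O.normal i else 0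

/-- The measure of integration on the boundary: on each face, two-dimensional Lebesgue measure,
transported from the plane of directions of the face by the isometry `w ↦ v₀ + w`. -/
def surfaceMeasure : Measure E3 :=
  ∑ i, (Measure.map
    (fun w : vectorSpan ℝ (range (O.face i).points) => (O.face i).points 0 + (w : E3))
    volume).restrict (openTriangle (O.face i))

/-- The surface area of the boundary. -/
def area : ℝ := O.surfaceMeasure.real univ

open Classical in
/-- Point-direction visibility indicator: the ray from `x` in direction `u` meets the body only
in `x`. -/
def dirVisible (x u : E3) : ℝ :=
  if {y | ∃ t : ℝ, 0 ≤ t ∧ y = x + t • u} ∩ O.body = {x} then 1 else 0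

open Classical in
/-- Point-point visibility indicator: the segment from `x` to `x'` meets the body only in its
endpoints. -/
def ptVisible (x x' : E3) : ℝ :=
  if segment ℝ x x' ∩ O.body = {x, x'} then 1 else 0

/-- The pointwise visibility: the cosine-weighted fraction of the directions visible from `x`. -/
def visibility (x : E3) : ℝ :=
  (1 / Real.pi) * ∫ u in {u : S2 | 0 ≤ ⟪(u : E3), O.normalAt x⟫_ℝ},
    ⟪O.normalAt x, (u : E3)⟫_ℝ * O.dirVisible x u ∂sphereMeasure

/-- The minimum visibility `ν⋆` (normals, hence visibilities, live on `Φ`). -/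
def minVisibility : ℝ := sInf (O.visibility '' O.Φ)

/-- The depth `ℓ`: the least third coordinate of a point of the object. -/
def depth : ℝ := sInf ((fun x => ⟪e3, x⟫_ℝ) '' O.body)

/-- The parameters `t > 0` at which the ray from `x` in direction `u` hits the boundary. -/
def hitTimes (x u : E3) : Set ℝ := {t | 0 < t ∧ x + t • u ∈ frontier O.body}

/-- The shadow retraction of `x` along `u` (used only where `hitTimes` is nonempty): the first
point that could cast a shadow on `x`. -/
def shadowRetraction (x u : E3) : E3 := x + sInf (O.hitTimes x u) • u

end TriangulatedObject

/-- A triangulated object with a measurable albedo taking values in `(0, 1]`. Measurability for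
the completed `σ`-algebra of the boundary is a.e.-measurability for the surface measure. -/
structure LambertianObject extends TriangulatedObject where
  albedo : E3 → ℝ
  albedo_pos : ∀ x ∈ frontier body, 0 < albedo x
  albedo_le_one : ∀ x ∈ frontier body, albedo x ≤ 1
  aemeasurable_albedo : AEMeasurable albedo toTriangulatedObject.surfaceMeasure

namespace LambertianObject

variable (O : LambertianObject)

/-- The maximum albedo `ρ⋆`. -/
def maxAlbedo : ℝ := sSup (O.albedo '' frontier O.body)

open Classical in
/-- Direct reflectance at `x` under point illumination from direction `u`. -/
def directPoint (u : E3) (x : E3) : ℝ :=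
  if x ∈ O.Φ then O.albedo x * max ⟪O.normalAt x, u⟫_ℝ 0 * O.dirVisible x u else 0

/-- Direct reflectance at `x` under the distant illumination `f`. -/
def direct (f : S2 → ℝ) (x : E3) : ℝ := ∫ u : S2, O.directPoint u x * f u ∂sphereMeasure

/-- The interreflection kernel. -/
def kernel (x x' : E3) : ℝ :=
  O.albedo x / Real.pi *
    (⟪O.normalAt x', x - x'⟫_ℝ * ⟪O.normalAt x, x' - x⟫_ℝ / ‖x - x'‖ ^ 4) * O.ptVisible x x'

open Classical in
/-- The interreflection map, on functions. -/
def interreflect (g : E3 → ℝ) (x : E3) : ℝ :=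
  if x ∈ O.Φ then ∫ x', O.kernel x x' * g x' ∂O.surfaceMeasure else 0

/-- The space `L²` of the boundary. -/
abbrev L2 : Type := Lp ℝ 2 O.surfaceMeasure

open Classical in
/-- The class in `L²` of a square-integrable function (`0` for other functions). -/
def toL2 (g : E3 → ℝ) : O.L2 := if h : MemLp g 2 O.surfaceMeasure then h.toLp g else 0

open Classical in
/-- The interreflection operator `T` on `L²`: the (unique) bounded operator which acts by the
integral formula `interreflect`. -/
def T : O.L2 →L[ℝ] O.L2 :=
  if h : ∃ A : O.L2 →L[ℝ] O.L2, ∀ g : O.L2, A g =ᵐ[O.surfaceMeasure] O.interreflect g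
  then h.choose else 0

/-! ### Shadows -/

/-- The shadowed region `S[u]`: the points of the boundary with no direct reflectance. -/
def shadow (u : E3) : Set E3 := {x ∈ frontier O.body | O.directPoint u x = 0}

/-- The boundary of the shadowed region, relative to the boundary surface of the object. -/
def shadowBoundary (u : E3) : Set E3 :=
  Subtype.val '' frontier ((Subtype.val : frontier O.body → E3) ⁻¹' O.shadow u)

/-- `χ[u]`: the set of points that cast the shadow boundaries, i.e. the shadow retractions of the
points of `Φ` in the boundary of the shadowed region. -/
def shadowingEdges (u : E3) : Set E3 :=
  {z | ∃ x ∈ O.shadowBoundary u ∩ O.Φ, (O.hitTimes x u).Nonempty ∧ z = O.shadowRetraction x u}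

/-- The maximum length `χ⋆` of the shadowing edges; length is one-dimensional Hausdorff
measure, which gives a segment its Euclidean length. -/
def maxShadowingLength : ℝ := (⨆ u : S2, Measure.hausdorffMeasure 1 (O.shadowingEdges u)).toReal

end LambertianObject

/-! ### The sensor -/

/-- A closed square of side `s` in the plane, in any position. -/
def IsSquare (s : ℝ) (Q : Set E2) : Prop :=
  ∃ f : E2 ≃ᵢ E2, Q = f '' {z | ∀ k, z k ∈ Icc 0 s}

/-- A perspective camera with thin lens, with `m` non-overlapping square pixels. The centre of
projection is the origin, the optical axis is the third axis. -/
structure Camera (m : ℕ) where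
  focal : ℝ
  lens : ℝ
  gain : ℝ
  side : ℝ
  focal_pos : 0 < focal
  lens_pos : 0 < lens
  gain_pos : 0 < gain
  side_pos : 0 < side
  pixel : Fin m → Set E2
  isSquare_pixel : ∀ i, IsSquare side (pixel i)
  nonoverlapping : ∀ i j, i ≠ j → Disjoint (interior (pixel i)) (interior (pixel j))

namespace Camera

variable {m : ℕ} (c : Camera m)

/-- The sensor constant `β_c = (γ_c / 4) (d_c / f_c) ^ 2`. -/
def β : ℝ := c.gain / 4 * (c.lens / c.focal) ^ 2

/-- The first two coordinates of the perspective projection `- f_c x / ⟨x, e₃⟩`. -/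
def proj (x : E3) : E2 :=
  !₂[-c.focal * x 0 / ⟪x, e3⟫_ℝ, -c.focal * x 1 / ⟪x, e3⟫_ℝ]

/-- The point of the image plane `{x | x₃ = - f_c}` in space with image coordinates `z`. -/
def imagePoint (z : E2) : E3 := !₂[z 0, z 1, -c.focal]

/-- The part of the boundary that is visible from the camera. -/
def visiblePart (O : TriangulatedObject) : Set E3 :=
  {x ∈ frontier O.body | segment ℝ x 0 ∩ O.body = {x}}

/-- The image coordinates in pixel `i` at which some point of the object is seen. -/
def seen (O : TriangulatedObject) (i : Fin m) : Set E2 := c.pixel i ∩ c.proj '' visiblePart O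

/-- Irradiance on the sensor at `z`, without the factor `β`: the inverse projection maps `z` to
the visible point of the object that is imaged at `z`. -/
def irradiance (O : TriangulatedObject) (g : E3 → ℝ) (z : E2) : ℝ :=
  g (Function.invFunOn c.proj (visiblePart O) z) *
    ⟪(‖c.imagePoint z‖⁻¹ : ℝ) • c.imagePoint z, e3⟫_ℝ ^ 4

/-- The projection and sampling map `P`. -/
def P (O : TriangulatedObject) (g : E3 → ℝ) : EuclideanSpace ℝ (Fin m) :=
  WithLp.toLp 2 fun i => c.β * ∫ z in c.seen O i, c.irradiance O g z

end Camera

/-! ### Images -/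

section Images

variable {m : ℕ} (O : LambertianObject) (c : Camera m)

/-- The image `ȳ[u] = P (I - T)⁻¹ D̄[u]` under point illumination from direction `u`. -/
def pointImage (u : S2) : EuclideanSpace ℝ (Fin m) :=
  c.P O.toTriangulatedObject (Ring.inverse (1 - O.T) (O.toL2 (O.directPoint u)) : O.L2)

/-- The image `y[f] = P (I - T)⁻¹ D[f]` under the distant illumination `f`. -/
def image (f : S2 → ℝ) : EuclideanSpace ℝ (Fin m) :=
  c.P O.toTriangulatedObject (Ring.inverse (1 - O.T) (O.toL2 (O.direct f)) : O.L2)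

end Images

/-! ### Illuminations and cones -/

/-- Spherical coordinates, for the azimuth `θ` and the polar angle `φ`. -/
def sphericalCoord (θ φ : ℝ) : S2 :=
  ⟨!₂[Real.cos θ * Real.sin φ, Real.sin θ * Real.sin φ, Real.cos φ], by
    have h1 := Real.sin_sq_add_cos_sq θ
    have h2 := Real.sin_sq_add_cos_sq φ
    rw [mem_sphere_zero_iff_norm, EuclideanSpace.norm_eq, Real.sqrt_eq_one]
    simp [Fin.sum_univ_three]
    linear_combination (Real.sin φ) ^ 2 * h1 + h2⟩

/-- The rectangle `[0, 2π] × [0, π]` of the spherical coordinates. -/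
def angleBox : BoxIntegral.Box (Fin 2) where
  lower := ![0, 0]
  upper := ![2 * Real.pi, Real.pi]
  lower_lt_upper := by
    intro i
    have := Real.pi_pos
    fin_cases i <;> simp [this]

/-- The class `F` of nonnegative, Riemann integrable functions on the sphere (Riemann integrable
in spherical coordinates, with the Jacobian `sin φ`). -/
def illuminations : Set (S2 → ℝ) :=
  {f | (∀ u, 0 ≤ f u) ∧
    BoxIntegral.Integrable angleBox BoxIntegral.IntegrationParams.Riemann
      (fun w => f (sphericalCoord (w 0) (w 1)) * Real.sin (w 1))
      BoxIntegral.BoxAdditiveMap.volume}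

/-- The class `F_α` of illuminations with ambient level `α`. -/
def ambientIlluminations (α : ℝ) : Set (S2 → ℝ) :=
  {f | ∃ fd ∈ illuminations, ∫ u, fd u ∂sphereMeasure ≤ 1 ∧
    f = fun u => fd u + α * (1 / sphereMeasure.real univ)}

section Cones

variable {m : ℕ} (O : LambertianObject) (c : Camera m)

/-- The cone `C_α` of the images under the illuminations in `F_α`. -/
def ambientCone (α : ℝ) : Set (EuclideanSpace ℝ (Fin m)) :=
  {y | ∃ r : ℝ, 0 ≤ r ∧ ∃ f ∈ ambientIlluminations α, y = r • image O c f}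

/-- The ambient image `y_a`. -/
def ambientImage : EuclideanSpace ℝ (Fin m) :=
  (1 / sphereMeasure.real univ) • ∫ u, pointImage O c u ∂sphereMeasure

/-- The cone generated by `ȳ[u_i] + α y_a`, `i = 1, …, n`, and `y_a`. -/
def sampledCone (α : ℝ) {n : ℕ} (u : Fin n → S2) : Set (EuclideanSpace ℝ (Fin m)) :=
  (PointedCone.hull ℝ
    (range (fun i => pointImage O c (u i) + α • ambientImage O c) ∪ {ambientImage O c}) :
      PointedCone ℝ (EuclideanSpace ℝ (Fin m)))

/-- The discrepancy of two cones: the Hausdorff distance of their parts in the unit ball. -/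
def coneDiscrepancy (C C' : Set (EuclideanSpace ℝ (Fin m))) : ℝ :=
  max (⨆ y : {y // y ∈ C ∧ ‖y‖ = 1}, Metric.infDist (y : EuclideanSpace ℝ (Fin m)) C')
    (⨆ y : {y // y ∈ C' ∧ ‖y‖ = 1}, Metric.infDist (y : EuclideanSpace ℝ (Fin m)) C)

end Cones

/-! ### The operators are well defined -/

/-- The imaging model makes sense: the direct illumination functions are square integrable, the
interreflection operator is a bounded operator on `L²` given by a convergent integral, it has
norm less than one and `I - T` is invertible, and the pixel values are convergent integrals
which depend only on the class of the irradiance in `L²`. -/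
structure WellPosed {m : ℕ} (O : LambertianObject) (c : Camera m) : Prop where
  memLp_directPoint : ∀ u : S2, MemLp (O.directPoint u) 2 O.surfaceMeasure
  integrable_direct : ∀ f ∈ illuminations, ∀ x,
    Integrable (fun u : S2 => O.directPoint u x * f u) sphereMeasure
  memLp_direct : ∀ f ∈ illuminations, MemLp (O.direct f) 2 O.surfaceMeasure
  integrable_kernel : ∀ g : O.L2, ∀ᵐ x ∂O.surfaceMeasure, x ∈ O.Φ →
    Integrable (fun x' => O.kernel x x' * g x') O.surfaceMeasure
  T_eq : ∀ g : O.L2, O.T g =ᵐ[O.surfaceMeasure] O.interreflect g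
  norm_T_lt_one : ‖O.T‖ < 1
  isUnit : IsUnit (1 - O.T)
  integrableOn_irradiance : ∀ g : E3 → ℝ, MemLp g 2 O.surfaceMeasure → ∀ i,
    IntegrableOn (c.irradiance O.toTriangulatedObject g) (c.seen O.toTriangulatedObject i)
  P_congr : ∀ g g' : E3 → ℝ, g =ᵐ[O.surfaceMeasure] g' →
    c.P O.toTriangulatedObject g = c.P O.toTriangulatedObject g'

end Lambertian

end

/-!
The theorem rests on three facts about the light that a polyhedral surface receives.

*Interreflection is a contraction.* From a point `x` of a face, every direction of the upper
hemisphere leads either to the free sky or to a first point of the surface, which almost always lies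
in the interior of a face. Central projection of the faces to the sphere (`lintegral_hemisphere`)
turns the form factors into cosine integrals over the directions, so that the total form factor at
`x` is at most `π (1 - ν⋆)` (`lintegral_formFactor_le`). As the form factor is symmetric, the Schur
test (`lintegral_sq_lintegral_mul_le`) gives `‖T‖ ≤ ρ⋆ (1 - ν⋆) < 1`. The same central projection,
now from the camera, compares the integral over a pixel with an integral over the surface
(`lintegral_faceImage_le`) and bounds the sensor on `L²` (`norm_P_le`). Riemann integrable
illuminations are Lebesgue integrable (`integrable_of_mem_illuminations`), because a Riemann
integrable function is the limit almost everywhere of step functions. This is `wellPosed`.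

*Direct light is Hölder continuous in its direction.* As the light moves along the chord from `u` to
`u'`, the cosine of incidence changes by at most `‖u - u'‖`, except on the part of the surface over
which a shadow boundary sweeps. Near each of its points the body is a cone (`body_locally_conic`);
hence the boundary of the shadow for the light from `v` is cast by edges, and a point which turns
dark or bright at the direction `v` is on this boundary (`mem_closure_lit`, `exists_mem_edge`). The
swept region of a face is the image of pairs `(s, τ)`, a point on an edge and a time, under a map
whose Jacobian is at most `diam(O) ‖u - u'‖` divided by the cosine (`volume_shadow_le`). For each
time, the edge points involved for the different faces are different points of the shadowing edges
`χ`, so their total length is at most `χ⋆` (`sum_volume_section_le`). The weight `cos²` of the mean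
square error outweighs the Jacobian, and grazing light is dim anyway. This gives
`eLpNorm_directPoint_sub_le`, and by the first part
`norm_pointImage_sub_le_of_norm_sub_le`.

*Images superpose.* The image of the illumination `f` is the integral of `f(u) ȳ[u]`
(`image_eq_integral`). So a discretization at `n` directions, at distance of the order `1 / √n` from
all others (`exists_covering`), changes the image of a unit of light by the order `n ^ (-1 / 4)`, by
the Hölder continuity of exponent `1 / 2`. Images are nonnegative, hence the ambient part of a unit
vector of the cone is not longer than `1`, and the vector carries at most `1 / (α ‖y_a‖)` units of
light (`infDist_sampledCone_le`). Conversely, point sources are limits of continuous illuminations,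
and the sampled cone is contained in the closure of the cone of images (`infDist_ambientCone_le`).
If `y_a = 0`, all images vanish.
-/

open MeasureTheory Set Filter Topology
open scoped InnerProductSpace ENNReal

noncomputable section

namespace Lambertian

/-- A connected set which meets a set and its complement meets its frontier. -/
lemma inter_frontier_nonempty_of_isPreconnected {X : Type*} [TopologicalSpace X] {s t : Set X}
    (hs : IsPreconnected s) (h1 : (s ∩ t).Nonempty) (h2 : (s ∩ tᶜ).Nonempty) :
    (s ∩ frontier t).Nonempty := by
  by_contra hcon
  rw [not_nonempty_iff_eq_empty] at hcon
  have hcov : s ⊆ interior t ∪ (closure t)ᶜ := by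
    intro x hx
    by_cases hi : x ∈ interior t
    · exact Or.inl hi
    · refine Or.inr fun hc => ?_
      have : x ∈ s ∩ frontier t := ⟨hx, hc, hi⟩
      rw [hcon] at this
      exact this
  obtain ⟨a, has, hat⟩ := h1
  obtain ⟨b, hbs, hbt⟩ := h2
  have ha : a ∈ interior t := (hcov has).resolve_right fun h => h (subset_closure hat)
  have hb : b ∈ (closure t)ᶜ := (hcov hbs).resolve_left fun h => hbt (interior_subset h)
  obtain ⟨c, _, hc1, hc2⟩ := hs _ _ isOpen_interior isClosed_closure.isOpen_compl hcov
    ⟨a, has, ha⟩ ⟨b, hbs, hb⟩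
  exact hc2 (subset_closure (interior_subset hc1))

/-! ### Triangles in barycentric coordinates -/

/-- Barycentric coordinates of a triangle in space extend to affine functions on the space that
do not change along the normal of the triangle. -/
lemma exists_barycentric (Δ : Affine.Triangle ℝ E3) {n : E3} (hn : ‖n‖ = 1)
    (ho : ∀ k₁ k₂, ⟪n, Δ.points k₁ - Δ.points k₂⟫_ℝ = 0) :
    ∃ b : Fin 3 → E3 →ᵃ[ℝ] ℝ, (∀ x, b 0 x + b 1 x + b 2 x = 1) ∧
      (∀ x, ⟪n, x - Δ.points 0⟫_ℝ = 0 →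
        x = b 0 x • Δ.points 0 + b 1 x • Δ.points 1 + b 2 x • Δ.points 2) ∧
      (∀ j k, b k (Δ.points j) = if j = k then 1 else 0) := by
  set p := Δ.points with hp
  have hli : LinearIndependent ℝ ![p 1 - p 0, p 2 - p 0] := by
    have h := (affineIndependent_iff_linearIndependent_vsub ℝ p 0).1 Δ.independent
    have h2 := h.comp (fun i : Fin 2 => (⟨i.succ, Fin.succ_ne_zero i⟩ : {x : Fin 3 // x ≠ 0}))
      (fun a b hab => Fin.succ_injective _ (by simpa using hab))
    have e : ![p 1 - p 0, p 2 - p 0] = (fun i : {x : Fin 3 // x ≠ 0} => p i -ᵥ p 0) ∘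
        (fun i : Fin 2 => (⟨i.succ, Fin.succ_ne_zero i⟩ : {x : Fin 3 // x ≠ 0})) := by
      funext i
      fin_cases i <;> simp
    rw [e]
    exact h2
  have hpair : ∀ a b : ℝ, a • (p 1 - p 0) + b • (p 2 - p 0) = 0 → a = 0 ∧ b = 0 :=
    LinearIndependent.pair_iff.1 hli
  have hin : ∀ a b c : ℝ, ⟪n, a • (p 1 - p 0) + b • (p 2 - p 0) + c • n⟫_ℝ = c := by
    intro a b c
    simp only [inner_add_right, inner_smul_right, ho, real_inner_self_eq_norm_sq, hn]
    ring
  have h3 : LinearIndependent ℝ ![p 1 - p 0, p 2 - p 0, n] := by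
    rw [Fintype.linearIndependent_iff]
    intro g hg
    simp only [Fin.sum_univ_three, Matrix.cons_val_zero, Matrix.cons_val_one,
      Matrix.cons_val] at hg
    have hc : g 2 = 0 := by
      have := hin (g 0) (g 1) (g 2)
      rw [hg] at this
      simpa using this.symm
    rw [hc, zero_smul, add_zero] at hg
    obtain ⟨ha, hb⟩ := hpair _ _ hg
    intro i
    fin_cases i
    · exact ha
    · exact hb
    · exact hc
  let B := basisOfLinearIndependentOfCardEqFinrank h3 (by simp)
  have hB : ∀ i, B i = ![p 1 - p 0, p 2 - p 0, n] i := by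
    intro i; simp [B]
  have hB0 : B 0 = p 1 - p 0 := hB 0
  have hB1 : B 1 = p 2 - p 0 := hB 1
  have hB2 : B 2 = n := hB 2
  let c : Fin 3 → E3 →ᵃ[ℝ] ℝ := fun i =>
    (B.coord i).toAffineMap.comp (AffineMap.id ℝ E3 - AffineMap.const ℝ E3 (p 0))
  have hc : ∀ i x, c i x = B.coord i (x - p 0) := fun i x => by simp [c]
  refine ⟨![AffineMap.const ℝ E3 1 - c 0 - c 1, c 0, c 1], ?_, ?_, ?_⟩
  · intro x
    simp
    ring
  · intro x hx
    have hs := B.sum_repr (x - p 0)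
    rw [Fin.sum_univ_three, hB0, hB1, hB2] at hs
    have h2 : B.repr (x - p 0) 2 = 0 := by
      have := hin (B.repr (x - p 0) 0) (B.repr (x - p 0) 1) (B.repr (x - p 0) 2)
      rw [hs, hx] at this
      exact this.symm
    rw [h2, zero_smul, add_zero] at hs
    simp only [Matrix.cons_val_zero, Matrix.cons_val_one, Matrix.cons_val, hc,
      Module.Basis.coord_apply, Pi.sub_apply,
      AffineMap.coe_sub, AffineMap.coe_const, Function.const_apply]
    have : x = p 0 + (x - p 0) := by abel
    conv_lhs => rw [this, ← hs]
    module
  · have e0 : ∀ i, c i (p 0) = 0 := fun i => by simp [hc]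
    have e1 : ∀ i, c i (p 1) = if i = 0 then 1 else 0 := fun i => by
      rw [hc, ← hB0]; simp [Finsupp.single_apply, eq_comm]
    have e2 : ∀ i, c i (p 2) = if i = 1 then 1 else 0 := fun i => by
      rw [hc, ← hB1]; simp [Finsupp.single_apply, eq_comm]
    intro j k
    fin_cases j <;> fin_cases k <;> simp [e0, e1, e2]

namespace TriangulatedObject

variable (O : TriangulatedObject)

/-- The signed height of `x` above the plane of the face `i`. -/
def height (i : Fin O.N) (x : E3) : ℝ := ⟪O.normal i, x - (O.face i).points 0⟫_ℝ

/-- The barycentric coordinates of the face `i`, as affine functions on the whole space. -/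
def bary (i : Fin O.N) : Fin 3 → E3 →ᵃ[ℝ] ℝ :=
  (exists_barycentric (O.face i) (O.norm_normal i) (O.normal_orthogonal i)).choose

lemma bary_sum (i : Fin O.N) (x : E3) : O.bary i 0 x + O.bary i 1 x + O.bary i 2 x = 1 :=
  (exists_barycentric (O.face i) (O.norm_normal i) (O.normal_orthogonal i)).choose_spec.1 x

lemma bary_eq (i : Fin O.N) {x : E3} (hx : O.height i x = 0) :
    x = O.bary i 0 x • (O.face i).points 0 + O.bary i 1 x • (O.face i).points 1 +
      O.bary i 2 x • (O.face i).points 2 :=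
  (exists_barycentric (O.face i) (O.norm_normal i) (O.normal_orthogonal i)).choose_spec.2.1 x hx

lemma bary_points (i : Fin O.N) (j k : Fin 3) :
    O.bary i k ((O.face i).points j) = if j = k then 1 else 0 :=
  (exists_barycentric (O.face i) (O.norm_normal i) (O.normal_orthogonal i)).choose_spec.2.2 j k

lemma height_add_smul (i : Fin O.N) (x v : E3) (t : ℝ) :
    O.height i (x + t • v) = O.height i x + t * ⟪O.normal i, v⟫_ℝ := by
  simp only [height, inner_sub_right, inner_add_right, inner_smul_right]; ring

lemma height_sub (i : Fin O.N) (x y : E3) :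
    O.height i x - O.height i y = ⟪O.normal i, x - y⟫_ℝ := by
  simp only [height, inner_sub_right]; ring

lemma height_lineMap (i : Fin O.N) (x y : E3) (t : ℝ) :
    O.height i (AffineMap.lineMap x y t) = (1 - t) * O.height i x + t * O.height i y := by
  simp only [height, AffineMap.lineMap_apply_module, inner_sub_right, inner_add_right,
    inner_smul_right]; ring

lemma bary_lineMap (i : Fin O.N) (k : Fin 3) (x y : E3) (t : ℝ) :
    O.bary i k (AffineMap.lineMap x y t) = (1 - t) * O.bary i k x + t * O.bary i k y := by
  rw [AffineMap.apply_lineMap, AffineMap.lineMap_apply_module]; simp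

lemma continuous_height (i : Fin O.N) : Continuous (O.height i) := by
  unfold height; fun_prop

lemma continuous_bary (i : Fin O.N) (k : Fin 3) : Continuous (O.bary i k) :=
  (O.bary i k).continuous_of_finiteDimensional

lemma height_points (i : Fin O.N) (k : Fin 3) : O.height i ((O.face i).points k) = 0 :=
  O.normal_orthogonal i k 0

lemma mem_closedTriangle_iff (i : Fin O.N) (x : E3) :
    x ∈ closedTriangle (O.face i) ↔ O.height i x = 0 ∧ ∀ k, 0 ≤ O.bary i k x := by
  constructor
  · intro hx
    have hc : Convex ℝ {y : E3 | O.height i y = 0 ∧ ∀ k, 0 ≤ O.bary i k y} := by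
      rw [convex_iff_segment_subset]
      rintro y ⟨hy, hy'⟩ z ⟨hz, hz'⟩
      rw [segment_eq_image_lineMap]
      rintro _ ⟨t, ⟨ht0, ht1⟩, rfl⟩
      refine ⟨by rw [height_lineMap, hy, hz]; ring, fun k => ?_⟩
      rw [bary_lineMap]
      have := hy' k
      have := hz' k
      have : 0 ≤ 1 - t := by linarith
      positivity
    refine convexHull_min ?_ hc hx
    rintro _ ⟨j, rfl⟩
    refine ⟨O.height_points i j, fun k => ?_⟩
    rw [bary_points]; split_ifs <;> norm_num
  · rintro ⟨h, hb⟩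
    rw [O.bary_eq i h]
    have hm : ∀ k, (O.face i).points k ∈ closedTriangle (O.face i) :=
      fun k => subset_convexHull ℝ _ (mem_range_self k)
    have hcv : Convex ℝ (closedTriangle (O.face i)) := convex_convexHull ℝ _
    have := hcv.sum_mem (t := Finset.univ) (w := fun k => O.bary i k x)
      (z := (O.face i).points) (fun k _ => hb k)
      (by rw [Fin.sum_univ_three]; exact O.bary_sum i x) (fun k _ => hm k)
    rwa [Fin.sum_univ_three] at this

lemma affineSpan_closedTriangle (i : Fin O.N) (x : E3) :
    x ∈ affineSpan ℝ (closedTriangle (O.face i)) ↔ O.height i x = 0 := by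
  rw [closedTriangle, affineSpan_convexHull]
  constructor
  · intro hx
    have : (affineSpan ℝ (range (O.face i).points)) ≤
        AffineSubspace.mk' ((O.face i).points 0) (LinearMap.ker (innerₛₗ ℝ (O.normal i))) := by
      rw [affineSpan_le]
      rintro _ ⟨k, rfl⟩
      simp [AffineSubspace.mem_mk', O.normal_orthogonal i]
    have h := this hx
    simpa [AffineSubspace.mem_mk', height] using h
  · intro hx
    rw [O.bary_eq i hx]
    have hm : ∀ k, (O.face i).points k ∈ affineSpan ℝ (range (O.face i).points) :=
      fun k => subset_affineSpan ℝ _ (mem_range_self k)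
    have e : O.bary i 0 x • (O.face i).points 0 + O.bary i 1 x • (O.face i).points 1 +
      O.bary i 2 x • (O.face i).points 2 =
      O.bary i 2 x • ((O.face i).points 2 -ᵥ (O.face i).points 0) +ᵥ
      (O.bary i 1 x • ((O.face i).points 1 -ᵥ (O.face i).points 0) +ᵥ (O.face i).points 0) := by
      have := O.bary_sum i x
      have h0 : O.bary i 0 x = 1 - O.bary i 1 x - O.bary i 2 x := by linarith
      rw [h0]
      simp only [vsub_eq_sub, vadd_eq_add]
      module
    rw [e]
    refine AffineSubspace.smul_vsub_vadd_mem _ _ (hm 2) (hm 0) ?_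
    exact AffineSubspace.smul_vsub_vadd_mem _ _ (hm 1) (hm 0) (hm 0)

/-- The relative interior of a face consists of the points with positive barycentric
coordinates. -/
lemma mem_openTriangle_iff (i : Fin O.N) (x : E3) :
    x ∈ openTriangle (O.face i) ↔ O.height i x = 0 ∧ ∀ k, 0 < O.bary i k x := by
  rw [openTriangle, mem_intrinsicInterior]
  constructor
  · rintro ⟨y, hy, rfl⟩
    have hh : O.height i y = 0 := (O.affineSpan_closedTriangle i y).1 y.2
    refine ⟨hh, fun k => ?_⟩
    by_contra hk
    -- Moving away from the vertex `k` inside the plane stays in the triangle for a short while.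
    have hs : ∀ t : ℝ, AffineMap.lineMap (y : E3) ((O.face i).points k) t ∈
        affineSpan ℝ (closedTriangle (O.face i)) := by
      intro t
      rw [affineSpan_closedTriangle, height_lineMap, hh, height_points]; ring
    have hcont : Continuous (fun t : ℝ => (⟨AffineMap.lineMap (y : E3) ((O.face i).points k) t,
        hs t⟩ : affineSpan ℝ (closedTriangle (O.face i)))) := by
      refine Continuous.subtype_mk ?_ _
      exact AffineMap.lineMap_continuous
    have hev : ∀ᶠ t in 𝓝 (0 : ℝ), AffineMap.lineMap (y : E3) ((O.face i).points k) t ∈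
        closedTriangle (O.face i) := by
      have h0 := hcont.tendsto 0
      have : (⟨AffineMap.lineMap (y : E3) ((O.face i).points k) (0 : ℝ), hs 0⟩ :
        affineSpan ℝ (closedTriangle (O.face i))) = y := Subtype.ext (by simp)
      rw [this] at h0
      exact h0 (mem_interior_iff_mem_nhds.1 hy)
    obtain ⟨t, ht, ht0⟩ := (hev.filter_mono nhdsWithin_le_nhds |>.and
      (self_mem_nhdsWithin (s := Iio (0 : ℝ)))).exists
    have h1 := ((O.mem_closedTriangle_iff i _).1 ht).2 k
    rw [bary_lineMap, bary_points, if_pos rfl] at h1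
    have : (t : ℝ) < 0 := ht0
    nlinarith [not_lt.1 hk]
  · rintro ⟨h, hb⟩
    refine ⟨⟨x, (O.affineSpan_closedTriangle i x).2 h⟩, ?_, rfl⟩
    rw [mem_interior_iff_mem_nhds]
    have : ∀ᶠ y : affineSpan ℝ (closedTriangle (O.face i)) in
        𝓝 ⟨x, (O.affineSpan_closedTriangle i x).2 h⟩, ∀ k, 0 < O.bary i k y := by
      rw [eventually_all]
      intro k
      exact ((O.continuous_bary i k).comp continuous_subtype_val).continuousAt.eventually
        (lt_mem_nhds (hb k))
    filter_upwards [this] with y hy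
    exact (O.mem_closedTriangle_iff i _).2
      ⟨(O.affineSpan_closedTriangle i y).1 y.2, fun k => (hy k).le⟩

lemma openTriangle_subset (i : Fin O.N) :
    openTriangle (O.face i) ⊆ closedTriangle (O.face i) :=
  intrinsicInterior_subset (𝕜 := ℝ)

lemma isCompact_closedTriangle (i : Fin O.N) : IsCompact (closedTriangle (O.face i)) :=
  (finite_range _).isCompact_convexHull ℝ

lemma measurableSet_openTriangle (i : Fin O.N) : MeasurableSet (openTriangle (O.face i)) := by
  have : openTriangle (O.face i) = O.height i ⁻¹' {0} ∩ ⋂ k, O.bary i k ⁻¹' Ioi 0 := by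
    ext x; simp [mem_openTriangle_iff]
  rw [this]
  exact ((O.continuous_height i).measurable (measurableSet_singleton _)).inter
    (MeasurableSet.iInter fun k => (O.continuous_bary i k).measurable measurableSet_Ioi)

lemma measurableSet_Φ : MeasurableSet O.Φ :=
  MeasurableSet.iUnion fun i => O.measurableSet_openTriangle i

/-- The edge of the face `i` opposite to its vertex `k`. -/
def edge (i : Fin O.N) (k : Fin 3) : Set E3 :=
  segment ℝ ((O.face i).points (k + 1)) ((O.face i).points (k + 2))

lemma mem_edge_of_bary_eq_zero {i : Fin O.N} {x : E3} (hx : x ∈ closedTriangle (O.face i))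
    {k : Fin 3} (hk : O.bary i k x = 0) : x ∈ O.edge i k := by
  obtain ⟨h, hb⟩ := (O.mem_closedTriangle_iff i x).1 hx
  have hs := O.bary_sum i x
  have he := O.bary_eq i h
  have h0 := hb 0
  have h1 := hb 1
  have h2 := hb 2
  fin_cases k
  · refine ⟨O.bary i 1 x, O.bary i 2 x, h1, h2, ?_, ?_⟩
    · simp only [Fin.zero_eta] at hk; linarith
    · conv_rhs => rw [he]
      simp only [Fin.zero_eta] at hk
      rw [hk]; simp
  · refine ⟨O.bary i 2 x, O.bary i 0 x, h2, h0, ?_, ?_⟩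
    · simp only [Fin.mk_one] at hk; linarith
    · conv_rhs => rw [he]
      simp only [Fin.mk_one] at hk
      rw [hk, show ((⟨1, by norm_num⟩ : Fin 3) + 1) = 2 from rfl,
        show ((⟨1, by norm_num⟩ : Fin 3) + 2) = 0 from rfl]; module
  · refine ⟨O.bary i 0 x, O.bary i 1 x, h0, h1, ?_, ?_⟩
    · simp only [Fin.reduceFinMk] at hk; linarith
    · conv_rhs => rw [he]
      simp only [Fin.reduceFinMk] at hk
      rw [hk, show ((⟨2, by norm_num⟩ : Fin 3) + 1) = 0 from rfl,
        show ((⟨2, by norm_num⟩ : Fin 3) + 2) = 1 from rfl]; module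

lemma mem_edge_of_notMem_openTriangle {i : Fin O.N} {x : E3}
    (hx : x ∈ closedTriangle (O.face i)) (hx' : x ∉ openTriangle (O.face i)) :
    ∃ k, x ∈ O.edge i k := by
  obtain ⟨h, hb⟩ := (O.mem_closedTriangle_iff i x).1 hx
  rw [mem_openTriangle_iff] at hx'
  have : ∃ k, ¬ 0 < O.bary i k x := by
    by_contra hcon
    exact hx' ⟨h, by simpa using hcon⟩
  obtain ⟨k, hk⟩ := this
  exact ⟨k, O.mem_edge_of_bary_eq_zero hx (le_antisymm (not_lt.1 hk) (hb k))⟩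

lemma notMem_closedTriangle_of_mem_openTriangle {i j : Fin O.N} (hij : i ≠ j) {x : E3}
    (hx : x ∈ openTriangle (O.face i)) : x ∉ closedTriangle (O.face j) := by
  intro hj
  have hmem : x ∈ closedTriangle (O.face i) ∩ closedTriangle (O.face j) :=
    ⟨O.openTriangle_subset i hx, hj⟩
  rcases O.inter_faces i j hij with (h | ⟨a, k, h⟩) | h
  · rw [h] at hmem; exact hmem
  · rw [h] at hmem
    have he : x ∈ segment ℝ ((O.face a).points k) ((O.face a).points (k + 1)) := by
      rw [mem_singleton_iff.1 hmem]; exact left_mem_segment _ _ _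
    exact disjoint_left.1 (O.disjoint_edges i _ ⟨a, k, k + 1, by simp, rfl⟩) hx he
  · exact disjoint_left.1 (O.disjoint_edges i _ h) hx hmem

lemma eq_of_mem_openTriangle {i j : Fin O.N} {x : E3} (hi : x ∈ openTriangle (O.face i))
    (hj : x ∈ openTriangle (O.face j)) : i = j := by
  by_contra h
  exact O.notMem_closedTriangle_of_mem_openTriangle h hi (O.openTriangle_subset j hj)

lemma normalAt_eq {i : Fin O.N} {x : E3} (hx : x ∈ openTriangle (O.face i)) :
    O.normalAt x = O.normal i := by
  unfold normalAt
  rw [Finset.sum_eq_single i, if_pos hx]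
  · intro j _ hj
    exact if_neg fun h => hj (O.eq_of_mem_openTriangle h hx)
  · simp

lemma closedTriangle_subset_frontier (i : Fin O.N) :
    closedTriangle (O.face i) ⊆ frontier O.body := by
  rw [O.frontier_body]; exact subset_iUnion (fun i => closedTriangle (O.face i)) i

lemma frontier_subset_body : frontier O.body ⊆ O.body :=
  O.isCompact_body.isClosed.frontier_subset

lemma openTriangle_subset_frontier (i : Fin O.N) :
    openTriangle (O.face i) ⊆ frontier O.body :=
  (O.openTriangle_subset i).trans (O.closedTriangle_subset_frontier i)

lemma Φ_subset_frontier : O.Φ ⊆ frontier O.body :=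
  iUnion_subset O.openTriangle_subset_frontier

lemma mem_Φ {x : E3} : x ∈ O.Φ ↔ ∃ i, x ∈ openTriangle (O.face i) := mem_iUnion

lemma mem_edge_of_mem_frontier {x : E3} (hx : x ∈ frontier O.body) (hx' : x ∉ O.Φ) :
    ∃ i k, x ∈ O.edge i k := by
  rw [O.frontier_body, mem_iUnion] at hx
  obtain ⟨i, hi⟩ := hx
  exact ⟨i, O.mem_edge_of_notMem_openTriangle hi fun h => hx' (O.mem_Φ.2 ⟨i, h⟩)⟩

/-! ### The object near a point of its boundary -/

/-- Near a point of an open face, the boundary is the plane of the face, the body lies below the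
plane, and nothing of it above. -/
lemma exists_ball_face {i : Fin O.N} {x : E3} (hx : x ∈ openTriangle (O.face i)) :
    ∃ r > 0, ∀ y ∈ Metric.ball x r,
      (O.height i y = 0 → y ∈ openTriangle (O.face i)) ∧
      (y ∈ frontier O.body → O.height i y = 0) ∧
      (0 < O.height i y → y ∉ O.body) ∧ (O.height i y < 0 → y ∈ O.body) := by
  obtain ⟨hx0, hxb⟩ := (O.mem_openTriangle_iff i x).1 hx
  -- Near `x` the barycentric coordinates stay positive, and all other faces stay away.
  have ev1 : ∀ᶠ y in 𝓝 x, ∀ k, 0 < O.bary i k y := by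
    rw [eventually_all]
    exact fun k => (O.continuous_bary i k).continuousAt.eventually (lt_mem_nhds (hxb k))
  have ev2 : ∀ᶠ y in 𝓝 x, ∀ j, j ≠ i → y ∉ closedTriangle (O.face j) := by
    rw [eventually_all]
    intro j
    by_cases h : j = i
    · simp [h]
    · filter_upwards [(O.isCompact_closedTriangle j).isClosed.isOpen_compl.mem_nhds
        (O.notMem_closedTriangle_of_mem_openTriangle (Ne.symm h) hx)] with y hy _
      exact hy
  obtain ⟨r, hr, hball⟩ := Metric.eventually_nhds_iff_ball.1 (ev1.and ev2)
  have hfr : ∀ y ∈ Metric.ball x r, y ∈ frontier O.body → O.height i y = 0 := by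
    intro y hy hyf
    rw [O.frontier_body, mem_iUnion] at hyf
    obtain ⟨j, hj⟩ := hyf
    by_cases h : j = i
    · subst h
      exact ((O.mem_closedTriangle_iff j y).1 hj).1
    · exact absurd hj ((hball y hy).2 j h)
  -- The frontier avoids both open half balls, so each of them is inside or outside of the body as
  -- a whole; the outward normal tells which.
  have hcv : ∀ s : Set E3, Convex ℝ s → s ⊆ Metric.ball x r → (∀ y ∈ s, O.height i y ≠ 0) →
      ∀ y ∈ s, ∀ z ∈ s, y ∈ O.body → z ∈ O.body := by
    intro s hs hsb hs0 y hy z hz hyb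
    by_contra hzb
    have hpre := hs.isPreconnected
    obtain ⟨w, hws, hwf⟩ := inter_frontier_nonempty_of_isPreconnected hpre ⟨y, hy, hyb⟩ ⟨z, hz, hzb⟩
    exact hs0 w hws (hfr w (hsb hws) hwf)
  have hclin : IsLinearMap ℝ (fun y => ⟪O.normal i, y⟫_ℝ) :=
    ⟨fun a b => inner_add_right _ _ _, fun a b => inner_smul_right _ _ _⟩
  have hup : Convex ℝ (Metric.ball x r ∩ {y | 0 < O.height i y}) := by
    refine (convex_ball x r).inter ?_
    have := convex_halfSpace_gt hclin (⟪O.normal i, (O.face i).points 0⟫_ℝ)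
    convert this using 1
    ext y; simp [height, inner_sub_right]
  have hdn : Convex ℝ (Metric.ball x r ∩ {y | O.height i y < 0}) := by
    refine (convex_ball x r).inter ?_
    have := convex_halfSpace_lt hclin (⟪O.normal i, (O.face i).points 0⟫_ℝ)
    convert this using 1
    ext y; simp [height, inner_sub_right]
  have evt : ∀ᶠ t in 𝓝[>] (0 : ℝ), x + t • O.normal i ∈ Metric.ball x r ∧
      x - t • O.normal i ∈ Metric.ball x r := by
    have h1 : ∀ᶠ t in 𝓝[>] (0 : ℝ), t < r :=
      nhdsWithin_le_nhds (Iio_mem_nhds hr)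
    filter_upwards [h1, self_mem_nhdsWithin] with t ht ht0
    have ht0' : 0 < t := ht0
    simp [dist_eq_norm, norm_smul, O.norm_normal, abs_of_pos ht0', ht]
  obtain ⟨t, ⟨⟨htu, htd⟩, hbu, hbd⟩, ht0⟩ :=
    ((evt.and (O.normal_outward i x hx)).and self_mem_nhdsWithin).exists
  have ht0' : 0 < t := ht0
  have hnn : ⟪O.normal i, O.normal i⟫_ℝ = 1 := by
    rw [real_inner_self_eq_norm_sq, O.norm_normal]; norm_num
  have hhu : 0 < O.height i (x + t • O.normal i) := by
    rw [height_add_smul, hx0, hnn]; linarith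
  have hhd : O.height i (x - t • O.normal i) < 0 := by
    rw [sub_eq_add_neg, ← neg_smul, height_add_smul, hx0, hnn]; linarith
  refine ⟨r, hr, fun y hy => ⟨fun h => (O.mem_openTriangle_iff i y).2 ⟨h, (hball y hy).1⟩,
    hfr y hy, fun h hyb => hbu ?_, fun h => ?_⟩⟩
  · exact hcv _ hup inter_subset_left (fun z hz => (ne_of_gt hz.2)) y ⟨hy, h⟩ _ ⟨htu, hhu⟩ hyb
  · exact hcv _ hdn inter_subset_left (fun z hz => (ne_of_lt hz.2)) _ ⟨htd, hhd⟩ y ⟨hy, h⟩ hbd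

/-- Around each of its points, a closed face is a cone with apex at this point. -/
lemma closedTriangle_locally_conic (i : Fin O.N) (z : E3) :
    ∀ᶠ y in 𝓝 z, ∀ l : ℝ, 0 < l → l ≤ 1 →
      (AffineMap.lineMap z y l ∈ closedTriangle (O.face i) →
        y ∈ closedTriangle (O.face i)) := by
  by_cases hz : z ∈ closedTriangle (O.face i)
  · obtain ⟨hz0, hzb⟩ := (O.mem_closedTriangle_iff i z).1 hz
    -- The coordinates that are positive at `z` stay so; the others are homogeneous in `y - z`.
    have ev1 : ∀ᶠ y in 𝓝 z, ∀ k, 0 < O.bary i k z → 0 < O.bary i k y := by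
      rw [eventually_all]
      intro k
      by_cases hk : 0 < O.bary i k z
      · filter_upwards [(O.continuous_bary i k).continuousAt.eventually (lt_mem_nhds hk)] with
          y hy _
        exact hy
      · simp [hk]
    filter_upwards [ev1] with y hy l hl0 hl1 hm
    obtain ⟨h0, hb⟩ := (O.mem_closedTriangle_iff i _).1 hm
    rw [height_lineMap, hz0, mul_zero, zero_add] at h0
    refine (O.mem_closedTriangle_iff i y).2 ⟨(mul_eq_zero.1 h0).resolve_left hl0.ne', fun k => ?_⟩
    by_cases hk : 0 < O.bary i k z
    · exact (hy k hk).le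
    · have hk0 : O.bary i k z = 0 := le_antisymm (not_lt.1 hk) (hzb k)
      have := hb k
      rw [bary_lineMap, hk0, mul_zero, zero_add] at this
      exact nonneg_of_mul_nonneg_right this hl0
  · have : ∀ᶠ w in 𝓝 z, w ∉ closedTriangle (O.face i) :=
      (O.isCompact_closedTriangle i).isClosed.isOpen_compl.mem_nhds hz
    obtain ⟨r, hr, hb⟩ := Metric.eventually_nhds_iff_ball.1 this
    filter_upwards [Metric.ball_mem_nhds z hr] with y hy l hl0 hl1 hm
    refine absurd hm (hb _ ?_)
    rw [Metric.mem_ball, dist_lineMap_left, Real.norm_eq_abs, abs_of_pos hl0]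
    rw [Metric.mem_ball, dist_comm] at hy
    nlinarith [dist_nonneg (x := z) (y := y)]

/-- Around each of its points, the body is a cone with apex at this point. -/
lemma body_locally_conic {z : E3} (hz : z ∈ O.body) :
    ∃ r > 0, ∀ y ∈ Metric.ball z r, y ∈ O.body → ∀ l : ℝ, 0 ≤ l →
      AffineMap.lineMap z y l ∈ Metric.ball z r → AffineMap.lineMap z y l ∈ O.body := by
  have ev : ∀ᶠ y in 𝓝 z, ∀ i, (z ∉ closedTriangle (O.face i) → y ∉ closedTriangle (O.face i)) ∧
      ∀ l : ℝ, 0 < l → l ≤ 1 → (AffineMap.lineMap z y l ∈ closedTriangle (O.face i) →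
        y ∈ closedTriangle (O.face i)) := by
    rw [eventually_all]
    intro i
    refine Filter.Eventually.and ?_ (O.closedTriangle_locally_conic i z)
    by_cases hzi : z ∈ closedTriangle (O.face i)
    · simp [hzi]
    · filter_upwards [(O.isCompact_closedTriangle i).isClosed.isOpen_compl.mem_nhds hzi] with y hy _
      exact hy
  obtain ⟨r, hr, hb⟩ := Metric.eventually_nhds_iff_ball.1 ev
  -- Membership in the body is constant along the half-open segment from `z` to a point `w` of the
  -- ball: at a boundary point of the segment, the whole segment lies in a face.
  have key : ∀ w ∈ Metric.ball z r, ∀ s ∈ Ioc (0 : ℝ) 1, ∀ s' ∈ Ioc (0 : ℝ) 1,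
      AffineMap.lineMap z w s ∈ O.body → AffineMap.lineMap z w s' ∈ O.body := by
    intro w hw s hs s' hs' hsb
    by_contra hsb'
    have hpre : IsPreconnected ((AffineMap.lineMap z w : ℝ → E3) '' Ioc 0 1) :=
      isPreconnected_Ioc.image _ AffineMap.lineMap_continuous.continuousOn
    obtain ⟨q, ⟨m, ⟨hm0, hm1⟩, rfl⟩, hf⟩ := inter_frontier_nonempty_of_isPreconnected
      hpre (t := O.body) ⟨_, ⟨s, hs, rfl⟩, hsb⟩ ⟨_, ⟨s', hs', rfl⟩, hsb'⟩
    rw [O.frontier_body, mem_iUnion] at hf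
    obtain ⟨i, hi⟩ := hf
    have hmb : AffineMap.lineMap z w m ∈ Metric.ball z r := by
      rw [Metric.mem_ball, dist_lineMap_left, Real.norm_eq_abs, abs_of_pos hm0]
      rw [Metric.mem_ball, dist_comm] at hw
      nlinarith [dist_nonneg (x := z) (y := w)]
    have hzi : z ∈ closedTriangle (O.face i) := by
      by_contra hzi
      exact (hb _ hmb i).1 hzi hi
    have hwi := (hb w hw i).2 m hm0 hm1 hi
    refine hsb' (O.frontier_subset_body (O.closedTriangle_subset_frontier i ?_))
    refine (convex_convexHull ℝ _).segment_subset hzi hwi ?_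
    rw [segment_eq_image_lineMap]
    exact ⟨s', ⟨hs'.1.le, hs'.2⟩, rfl⟩
  refine ⟨r, hr, fun y hy hyb l hl hlb => ?_⟩
  rcases hl.eq_or_lt with rfl | hl0
  · simpa using hz
  · rcases le_total l 1 with h1 | h1
    · exact key y hy 1 ⟨one_pos, le_rfl⟩ l ⟨hl0, h1⟩ (by simpa using hyb)
    · have h := key _ hlb l⁻¹ ⟨by positivity, inv_le_one_of_one_le₀ h1⟩ 1 ⟨one_pos, le_rfl⟩
      rw [AffineMap.lineMap_apply_one] at h
      refine h ?_
      have : AffineMap.lineMap z (AffineMap.lineMap z y l) l⁻¹ = y := by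
        simp only [AffineMap.lineMap_apply, vsub_eq_sub, vadd_eq_add, add_sub_cancel_right,
          smul_smul, inv_mul_cancel₀ hl0.ne', one_smul, sub_add_cancel]
      rwa [this]

end TriangulatedObject

/-! ### Orthonormal coordinates and the faces -/

/-- Cartesian coordinates of space in an orthonormal basis; the third coordinate comes first. -/
def spaceParam (b : OrthonormalBasis (Fin 3) ℝ E3) (q : ℝ × (ℝ × ℝ)) : E3 :=
  q.1 • b 2 + (q.2.1 • b 0 + q.2.2 • b 1)

lemma continuous_spaceParam (b : OrthonormalBasis (Fin 3) ℝ E3) : Continuous (spaceParam b) := by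
  unfold spaceParam; fun_prop

lemma spaceParam_smul (b : OrthonormalBasis (Fin 3) ℝ E3) (r : ℝ) (q : ℝ × (ℝ × ℝ)) :
    spaceParam b (r • q) = r • spaceParam b q := by
  simp only [spaceParam, Prod.smul_fst, Prod.smul_snd, smul_eq_mul]
  module

lemma inner_spaceParam (b : OrthonormalBasis (Fin 3) ℝ E3) (q : ℝ × (ℝ × ℝ)) :
    ⟪b 2, spaceParam b q⟫_ℝ = q.1 := by
  simp [spaceParam, inner_add_right, inner_smul_right, b.inner_eq_ite]

lemma norm_sq_spaceParam (b : OrthonormalBasis (Fin 3) ℝ E3) (q : ℝ × (ℝ × ℝ)) :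
    ‖spaceParam b q‖ ^ 2 = q.1 ^ 2 + (q.2.1 ^ 2 + q.2.2 ^ 2) := by
  rw [← real_inner_self_eq_norm_sq]
  simp only [spaceParam, inner_add_right, inner_add_left, real_inner_smul_right,
    real_inner_smul_left, b.inner_eq_ite]
  have h01 : ¬ (0 : Fin 3) = 1 := by decide
  have h02 : ¬ (0 : Fin 3) = 2 := by decide
  have h12 : ¬ (1 : Fin 3) = 2 := by decide
  have h10 : ¬ (1 : Fin 3) = 0 := by decide
  have h20 : ¬ (2 : Fin 3) = 0 := by decide
  have h21 : ¬ (2 : Fin 3) = 1 := by decide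
  simp only [h01, h02, h12, h10, h20, h21, if_true, if_false]
  ring

lemma measurePreserving_spaceParam (b : OrthonormalBasis (Fin 3) ℝ E3) :
    MeasurePreserving (spaceParam b) volume volume := by
  have h1 := b.measurePreserving_repr_symm
  have h2 := PiLp.volume_preserving_toLp (Fin 3)
  have h3 := (volume_preserving_piFinSuccAbove (fun _ : Fin 3 => ℝ) 2).symm
  have h4 := (volume_preserving_finTwoArrow ℝ).symm
  have h5 := (MeasurePreserving.id (volume : Measure ℝ)).prod h4
  have h := h1.comp (h2.comp (h3.comp h5))
  suffices e : spaceParam b = b.repr.symm ∘ WithLp.toLp 2 ∘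
      (MeasurableEquiv.piFinSuccAbove (fun _ : Fin 3 => ℝ) 2).symm ∘
        Prod.map id MeasurableEquiv.finTwoArrow.symm by
    rw [e]; exact h
  funext q
  simp only [Function.comp]
  rw [← b.sum_repr_symm, Fin.sum_univ_three]
  have e0 : ((2 : Fin 3).succAbove (0 : Fin 2)) = 0 := rfl
  have e1 : ((2 : Fin 3).succAbove (1 : Fin 2)) = 1 := rfl
  have f0 : ∀ v : Fin 2 → ℝ, (MeasurableEquiv.piFinSuccAbove (fun _ : Fin 3 => ℝ) 2).symm (q.1, v) 0
      = v 0 := fun v => rfl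
  have f1 : ∀ v : Fin 2 → ℝ, (MeasurableEquiv.piFinSuccAbove (fun _ : Fin 3 => ℝ) 2).symm (q.1, v) 1
      = v 1 := fun v => rfl
  have f2 : ∀ v : Fin 2 → ℝ, (MeasurableEquiv.piFinSuccAbove (fun _ : Fin 3 => ℝ) 2).symm (q.1, v) 2
      = q.1 := fun v => rfl
  simp only [Prod.map, id, f0, f1, f2, spaceParam]
  have g0 : (MeasurableEquiv.finTwoArrow.symm q.2 : Fin 2 → ℝ) 0 = q.2.1 := rfl
  have g1 : (MeasurableEquiv.finTwoArrow.symm q.2 : Fin 2 → ℝ) 1 = q.2.2 := rfl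
  rw [g0, g1]
  abel

lemma exists_orthonormalBasis_third {n : E3} (hn : ‖n‖ = 1) :
    ∃ b : OrthonormalBasis (Fin 3) ℝ E3, b 2 = n := by
  have ho : Orthonormal ℝ (({2} : Set (Fin 3)).domRestrict (fun _ : Fin 3 => n)) := by
    rw [orthonormal_iff_ite]
    rintro ⟨i, hi⟩ ⟨j, hj⟩
    rw [mem_singleton_iff] at hi hj
    subst hi; subst hj
    simp [Set.domRestrict, hn]
  obtain ⟨b, hb⟩ := ho.exists_orthonormalBasis_extension_of_card_eq (by simp)
  exact ⟨b, hb 2 rfl⟩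

namespace TriangulatedObject

variable (O : TriangulatedObject)

/-- An orthonormal basis whose third vector is the normal of the face `i`. -/
def frame (i : Fin O.N) : OrthonormalBasis (Fin 3) ℝ E3 :=
  (exists_orthonormalBasis_third (O.norm_normal i)).choose

lemma frame_two (i : Fin O.N) : O.frame i 2 = O.normal i :=
  (exists_orthonormalBasis_third (O.norm_normal i)).choose_spec

/-- Cartesian coordinates in the plane of the face `i`. -/
def facePoint (i : Fin O.N) (w : ℝ × ℝ) : E3 :=
  (O.face i).points 0 + (w.1 • O.frame i 0 + w.2 • O.frame i 1)

lemma continuous_facePoint (i : Fin O.N) : Continuous (O.facePoint i) := by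
  unfold facePoint; fun_prop

lemma facePoint_sub (i : Fin O.N) (w : ℝ × ℝ) :
    O.facePoint i w - (O.face i).points 0 = spaceParam (O.frame i) (0, w) := by
  simp [facePoint, spaceParam]

lemma height_facePoint (i : Fin O.N) (w : ℝ × ℝ) : O.height i (O.facePoint i w) = 0 := by
  rw [height, facePoint_sub, ← frame_two, inner_spaceParam]

/-- The area measure of the plane of a face, in the coordinates given by the orthonormal frame of
the face. -/
lemma map_facePoint (i : Fin O.N) :
    Measure.map (fun w : vectorSpan ℝ (range (O.face i).points) =>
      (O.face i).points 0 + (w : E3)) volume = Measure.map (O.facePoint i) volume := by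
  set b := O.frame i with hb
  let L : E2 →ₗ[ℝ] E3 :=
    { toFun := fun w => w 0 • b 0 + w 1 • b 1
      map_add' := fun x y => by simp only [PiLp.add_apply]; module
      map_smul' := fun r x => by
        simp only [PiLp.smul_apply, smul_eq_mul, RingHom.id_apply]
        module }
  let L' : E2 →ₗᵢ[ℝ] E3 := ⟨L, fun w => by
    have h1 : L w = spaceParam b (0, (w 0, w 1)) := by simp [L, spaceParam]
    rw [← sq_eq_sq₀ (norm_nonneg _) (norm_nonneg _), h1, norm_sq_spaceParam,
      EuclideanSpace.norm_sq_eq, Fin.sum_univ_two]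
    simp⟩
  have hrank : Module.finrank ℝ (vectorSpan ℝ (range (O.face i).points)) = 2 :=
    (O.face i).independent.finrank_vectorSpan (by simp)
  have hperp : vectorSpan ℝ (range (O.face i).points) ≤ (ℝ ∙ O.normal i)ᗮ := by
    rw [vectorSpan_def, Submodule.span_le]
    rintro _ ⟨_, ⟨j, rfl⟩, _, ⟨k, rfl⟩, rfl⟩
    rw [SetLike.mem_coe, Submodule.mem_orthogonal_singleton_iff_inner_right]
    exact O.normal_orthogonal i j k
  have hperp2 : LinearMap.range L'.toLinearMap ≤ (ℝ ∙ O.normal i)ᗮ := by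
    rintro _ ⟨w, rfl⟩
    rw [Submodule.mem_orthogonal_singleton_iff_inner_right, ← O.frame_two i, ← hb]
    simp [L', L, inner_add_right, inner_smul_right, b.inner_eq_ite]
  have hrk : Module.finrank ℝ (ℝ ∙ O.normal i)ᗮ = 2 := by
    have h0 : O.normal i ≠ 0 := by
      intro h; have := O.norm_normal i; rw [h] at this; simp at this
    have : Fact (Module.finrank ℝ E3 = 2 + 1) := ⟨by simp⟩
    exact Submodule.finrank_orthogonal_span_singleton h0
  -- Both planes are the orthogonal complement of the normal.
  have hrange : vectorSpan ℝ (range (O.face i).points) = LinearMap.range L'.toLinearMap := by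
    rw [Submodule.eq_of_le_of_finrank_eq hperp (hrank.trans hrk.symm)]
    symm
    refine Submodule.eq_of_le_of_finrank_eq hperp2 ?_
    rw [hrk, LinearMap.finrank_range_of_inj L'.injective]
    simp
  have key : ∀ V : Submodule ℝ E3, V = LinearMap.range L'.toLinearMap →
      Measure.map (fun w : V => (O.face i).points 0 + (w : E3)) volume =
        Measure.map (fun w : E2 => (O.face i).points 0 + L w) volume := by
    rintro V rfl
    have h := L'.equivRange.measurePreserving
    have hm : Measurable fun w : LinearMap.range L'.toLinearMap =>
        (O.face i).points 0 + (w : E3) := by fun_prop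
    rw [← h.map_eq, Measure.map_map hm h.measurable]
    rfl
  rw [key _ hrange]
  have h2 := PiLp.volume_preserving_toLp (Fin 2)
  have h4 := (volume_preserving_finTwoArrow ℝ).symm
  have h := h2.comp h4
  have hm : Measurable fun w : E2 => (O.face i).points 0 + L w :=
    ((continuous_const).add L'.continuous).measurable
  rw [← h.map_eq, Measure.map_map hm h.measurable]
  rfl

lemma surfaceMeasure_eq : O.surfaceMeasure =
    ∑ i, (Measure.map (O.facePoint i) volume).restrict (openTriangle (O.face i)) := by
  unfold surfaceMeasure
  simp_rw [map_facePoint]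

lemma lintegral_surfaceMeasure {F : E3 → ℝ≥0∞} (hF : Measurable F) :
    ∫⁻ x, F x ∂O.surfaceMeasure = ∑ i, ∫⁻ w,
      (openTriangle (O.face i)).indicator F (O.facePoint i w) := by
  rw [surfaceMeasure_eq, lintegral_finsetSum_measure]
  refine Finset.sum_congr rfl fun i _ => ?_
  rw [← lintegral_indicator (O.measurableSet_openTriangle i),
    lintegral_map (hF.indicator (O.measurableSet_openTriangle i))
      (O.continuous_facePoint i).measurable]

end TriangulatedObject

/-! ### Integration over the sphere -/

/-- An integral over the sphere as an integral over the ball: the radial extension of `F` has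
the factor `∫ r ^ 2 dr = 1 / 3`. -/
lemma lintegral_sphereMeasure {F : E3 → ℝ≥0∞} (hF : Measurable F) :
    ∫⁻ u : S2, F u ∂sphereMeasure =
      3 * ∫⁻ y in Metric.ball (0 : E3) 1, F (‖y‖⁻¹ • y) := by
  set e : S2 × Ioi (0 : ℝ) → E3 := Subtype.val ∘ (homeomorphUnitSphereProd E3).symm with he
  have hemb : MeasurableEmbedding e :=
    (MeasurableEmbedding.subtype_coe (measurableSet_singleton _).compl).comp
      (Homeomorph.measurableEmbedding _)
  have hval : ∀ p, e p = (p.2 : ℝ) • (p.1 : E3) := fun p => by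
    simp [e]
  have hnorm : ∀ p, ‖e p‖ = p.2 := fun p => by
    have h1 : ‖(p.1 : E3)‖ = 1 := norm_eq_of_mem_sphere p.1
    rw [hval, norm_smul, h1, mul_one, Real.norm_eq_abs, abs_of_pos p.2.2]
  have hdir : ∀ p, ‖e p‖⁻¹ • e p = (p.1 : E3) := fun p => by
    rw [hnorm, hval, smul_smul, inv_mul_cancel₀ (ne_of_gt p.2.2), one_smul]
  have hrange : range e = {0}ᶜ := by
    rw [he, range_comp, (homeomorphUnitSphereProd E3).symm.surjective.range_eq]
    simp
    rfl
  have hm : Measurable fun p : S2 × Ioi (0 : ℝ) => F p.1 :=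
    hF.comp (measurable_subtype_coe.comp measurable_fst)
  set H : E3 → ℝ≥0∞ := (Metric.ball (0 : E3) 1).indicator (fun y => F (‖y‖⁻¹ • y)) with hH
  have hdm : Measurable fun y : E3 => ‖y‖⁻¹ • y := by fun_prop
  have hHm : Measurable H := (hF.comp hdm).indicator measurableSet_ball
  have hS : MeasurableSet ((univ : Set S2) ×ˢ Iio (⟨1, mem_Ioi.2 one_pos⟩ : Ioi (0 : ℝ))) :=
    MeasurableSet.univ.prod measurableSet_Iio
  have hdim : Module.finrank ℝ E3 = 3 := by simp
  unfold sphereMeasure Measure.toSphere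
  rw [lintegral_smul_measure, hdim, Measure.fst,
    lintegral_map (f := fun u : S2 => F u) (hF.comp measurable_subtype_coe) measurable_fst,
    ← lintegral_indicator hS]
  have e1 : (fun p : S2 × Ioi (0 : ℝ) =>
      ((univ : Set S2) ×ˢ Iio (⟨1, mem_Ioi.2 one_pos⟩ : Ioi (0 : ℝ))).indicator
        (fun a => F (a.1 : E3)) p) = fun p => H (e p) := by
    funext p
    have hiff : p ∈ ((univ : Set S2) ×ˢ Iio (⟨1, mem_Ioi.2 one_pos⟩ : Ioi (0 : ℝ))) ↔
        e p ∈ Metric.ball (0 : E3) 1 := by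
      rw [mem_ball_zero_iff, hnorm]
      simp [← Subtype.coe_lt_coe]
    by_cases hp : e p ∈ Metric.ball (0 : E3) 1
    · rw [indicator_of_mem (hiff.2 hp), hH, indicator_of_mem hp, hdir]
    · rw [indicator_of_notMem (fun h => hp (hiff.1 h)), hH, indicator_of_notMem hp]
  rw [e1, ← hemb.lintegral_map, hemb.map_comap, hrange]
  have : (volume : Measure E3).restrict {0}ᶜ = volume := by
    refine Measure.restrict_eq_self_of_ae_mem ?_
    simp [ae_iff]
  rw [this, hH, lintegral_indicator measurableSet_ball]
  simp

lemma lintegral_eq_mul_lintegral_comp_smul {E : Type*} [NormedAddCommGroup E] [NormedSpace ℝ E]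
    [FiniteDimensional ℝ E] [MeasurableSpace E] [BorelSpace E] (μ : Measure E)
    [μ.IsAddHaarMeasure] {f : E → ℝ≥0∞} (hf : Measurable f) {r : ℝ} (hr : r ≠ 0) :
    ∫⁻ x, f x ∂μ = ENNReal.ofReal |r ^ Module.finrank ℝ E| * ∫⁻ x, f (r • x) ∂μ := by
  have h := lintegral_map (μ := μ) hf (measurable_const_smul r)
  rw [Measure.map_addHaar_smul μ hr, lintegral_smul_measure] at h
  rw [← h, smul_eq_mul, ← mul_assoc, ← ENNReal.ofReal_mul (abs_nonneg _), ← abs_mul,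
    mul_inv_cancel₀ (pow_ne_zero _ hr)]
  simp

lemma lintegral_Ioo_sq {R : ℝ} (hR : 0 ≤ R) :
    ∫⁻ r in Ioo 0 R, ENNReal.ofReal (r ^ 2) = ENNReal.ofReal (R ^ 3 / 3) := by
  rw [← ofReal_integral_eq_lintegral_ofReal, ← integral_Ioc_eq_integral_Ioo,
    ← intervalIntegral.integral_of_le hR, integral_pow]
  · norm_num
  · exact ((continuous_pow 2).integrableOn_Icc (a := 0) (b := R)).mono_set Ioo_subset_Icc_self
  · exact ae_of_all _ fun r => sq_nonneg r

/-- Central projection of the plane `⟨b 2, x⟩ = h` to a half of the unit sphere: the solid angle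
of a piece of the plane is its area with the density `|h| / ‖x‖ ^ 3`. -/
lemma lintegral_hemisphere (b : OrthonormalBasis (Fin 3) ℝ E3) {F : E3 → ℝ≥0∞}
    (hF : Measurable F) {h : ℝ} (hh : h ≠ 0) :
    ∫⁻ w : ℝ × ℝ, F (‖spaceParam b (h, w)‖⁻¹ • spaceParam b (h, w)) *
        ENNReal.ofReal (|h| / ‖spaceParam b (h, w)‖ ^ 3) =
      ∫⁻ u : S2, {y : E3 | 0 < h * ⟪b 2, y⟫_ℝ}.indicator F u ∂sphereMeasure := by
  have hset : MeasurableSet {y : E3 | 0 < h * ⟪b 2, y⟫_ℝ} := by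
    refine (isOpen_lt continuous_const ?_).measurableSet
    fun_prop
  set G := {y : E3 | 0 < h * ⟪b 2, y⟫_ℝ}.indicator F with hG
  have hGm : Measurable G := hF.indicator hset
  rw [lintegral_sphereMeasure hGm, ← lintegral_indicator measurableSet_ball]
  set H := (Metric.ball (0 : E3) 1).indicator fun y => G (‖y‖⁻¹ • y) with hH
  have hdm : Measurable fun y : E3 => ‖y‖⁻¹ • y := by fun_prop
  have hHm : Measurable H := (hGm.comp hdm).indicator measurableSet_ball
  have hsm := (continuous_spaceParam b).measurable
  rw [← (measurePreserving_spaceParam b).lintegral_comp hHm, Measure.volume_eq_prod ℝ (ℝ × ℝ),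
    lintegral_prod (fun q => H (spaceParam b q)) (hHm.comp hsm).aemeasurable]
  have hK : Measurable fun a : ℝ => ∫⁻ w : ℝ × ℝ, H (spaceParam b (a, w)) :=
    (hHm.comp hsm).lintegral_prod_right'
  rw [lintegral_eq_mul_lintegral_comp_smul volume hK hh]
  have hp0 : ∀ w, 0 < ‖spaceParam b (h, w)‖ := fun w => by
    rw [norm_pos_iff]
    intro h0
    have := inner_spaceParam b (h, w)
    rw [h0, inner_zero_right] at this
    exact hh this.symm
  -- On the ray `r > 0` the plane at height `h r` is the plane at height `h` scaled by `r`.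
  have hHr : ∀ r w, H (spaceParam b (h • r, r • w)) =
      (Ioo 0 (‖spaceParam b (h, w)‖⁻¹)).indicator
        (fun _ => F (‖spaceParam b (h, w)‖⁻¹ • spaceParam b (h, w))) r := by
    intro r w
    have hs : spaceParam b (h • r, r • w) = r • spaceParam b (h, w) := by
      rw [← spaceParam_smul]; simp [mul_comm]
    rw [hs]
    have hin : ⟪b 2, r • spaceParam b (h, w)⟫_ℝ = r * h := by
      rw [inner_smul_right, inner_spaceParam]
    rcases lt_or_ge 0 r with hr | hr
    · have hn : ‖r • spaceParam b (h, w)‖ = r * ‖spaceParam b (h, w)‖ := by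
        rw [norm_smul, Real.norm_eq_abs, abs_of_pos hr]
      have hdir : ‖r • spaceParam b (h, w)‖⁻¹ • (r • spaceParam b (h, w)) =
          ‖spaceParam b (h, w)‖⁻¹ • spaceParam b (h, w) := by
        rw [hn, smul_smul, mul_inv, mul_comm r⁻¹, mul_assoc, inv_mul_cancel₀ hr.ne', mul_one]
      have hGv : G (‖spaceParam b (h, w)‖⁻¹ • spaceParam b (h, w)) =
          F (‖spaceParam b (h, w)‖⁻¹ • spaceParam b (h, w)) := by
        rw [hG]
        refine indicator_of_mem ?_ _
        simp only [mem_ofPred_eq, inner_smul_right, inner_spaceParam]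
        have := hp0 w
        have : 0 < h * h := mul_self_pos.2 hh
        have h2 : h * (‖spaceParam b (h, w)‖⁻¹ * h) = ‖spaceParam b (h, w)‖⁻¹ * (h * h) := by ring
        rw [h2]; positivity
      have hiff : r • spaceParam b (h, w) ∈ Metric.ball (0 : E3) 1 ↔
          r ∈ Ioo 0 (‖spaceParam b (h, w)‖⁻¹) := by
        rw [mem_ball_zero_iff, hn, mem_Ioo, ← one_div, lt_div_iff₀ (hp0 w)]
        simp [hr]
      by_cases hb : r ∈ Ioo 0 (‖spaceParam b (h, w)‖⁻¹)
      · rw [indicator_of_mem hb, hH, indicator_of_mem (hiff.2 hb)]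
        rw [hdir, hGv]
      · rw [indicator_of_notMem hb, hH, indicator_of_notMem (fun hc => hb (hiff.1 hc))]
    · rw [indicator_of_notMem (fun hc => not_lt.2 hr hc.1), hH]
      refine indicator_apply_eq_zero.2 fun _ => ?_
      rw [hG]
      refine indicator_of_notMem ?_ _
      simp only [mem_ofPred_eq, inner_smul_right, inner_spaceParam, not_lt]
      have h3 : h * (‖r • spaceParam b (h, w)‖⁻¹ * (r * h)) =
        r * (‖r • spaceParam b (h, w)‖⁻¹ * (h * h)) := by ring
      rw [h3]
      exact mul_nonpos_of_nonpos_of_nonneg hr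
        (mul_nonneg (by positivity) (mul_self_nonneg h))
  -- Scaling the plane by `r` gives the factor `r ^ 2`, which is integrated over `r < 1 / ‖x‖`.
  have hinner : ∀ᵐ r : ℝ, ∫⁻ w : ℝ × ℝ, H (spaceParam b (h • r, w)) =
      ∫⁻ w : ℝ × ℝ, (Ioo 0 (‖spaceParam b (h, w)‖⁻¹)).indicator
        (fun r => ENNReal.ofReal (r ^ 2) *
          F (‖spaceParam b (h, w)‖⁻¹ • spaceParam b (h, w))) r := by
    have : ∀ᵐ r : ℝ, r ≠ 0 := by simp [ae_iff]
    filter_upwards [this] with r hr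
    have hm : Measurable fun w : ℝ × ℝ => H (spaceParam b (h • r, w)) :=
      hHm.comp (hsm.comp measurable_prodMk_left)
    rw [lintegral_eq_mul_lintegral_comp_smul volume hm hr, ← lintegral_const_mul']
    · refine lintegral_congr fun w => ?_
      rw [hHr]
      have hfr : Module.finrank ℝ (ℝ × ℝ) = 2 := by simp
      rw [hfr, abs_of_nonneg (sq_nonneg r)]
      by_cases hb : r ∈ Ioo 0 (‖spaceParam b (h, w)‖⁻¹)
      · rw [indicator_of_mem hb, indicator_of_mem hb]
      · rw [indicator_of_notMem hb, indicator_of_notMem hb, mul_zero]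
    · exact ENNReal.ofReal_ne_top
  have hpm : Measurable fun w : ℝ × ℝ => spaceParam b (h, w) := hsm.comp measurable_prodMk_left
  rw [lintegral_congr_ae hinner, lintegral_lintegral_swap, ← mul_assoc, ← lintegral_const_mul']
  · refine lintegral_congr fun w => ?_
    rw [lintegral_indicator measurableSet_Ioo, lintegral_mul_const _ (by fun_prop),
      lintegral_Ioo_sq]
    · have hw := hp0 w
      have e3 : (3 : ℝ≥0∞) = ENNReal.ofReal 3 := by simp
      rw [mul_comm (F _), ← mul_assoc, e3, ← ENNReal.ofReal_mul (by norm_num),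
        ← ENNReal.ofReal_mul (by positivity)]
      congr 2
      simp
      field_simp
    · exact inv_nonneg.2 (norm_nonneg _)
  · exact ENNReal.mul_ne_top (by simp) ENNReal.ofReal_ne_top
  · have hS : MeasurableSet {q : ℝ × (ℝ × ℝ) | q.1 ∈ Ioo 0 (‖spaceParam b (h, q.2)‖⁻¹)} := by
      have h1 : Measurable fun q : ℝ × (ℝ × ℝ) => ‖spaceParam b (h, q.2)‖⁻¹ :=
        (hpm.comp measurable_snd).norm.inv
      exact (measurableSet_lt measurable_const measurable_fst).inter
        (measurableSet_lt measurable_fst h1)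
    have h2 : Measurable fun q : ℝ × (ℝ × ℝ) => ENNReal.ofReal (q.1 ^ 2) *
        F (‖spaceParam b (h, q.2)‖⁻¹ • spaceParam b (h, q.2)) :=
      (measurable_fst.pow_const 2).ennreal_ofReal.mul
        ((hF.comp hdm).comp (hpm.comp measurable_snd))
    exact (h2.indicator hS).aemeasurable

/-- The cosine, integrated over a hemisphere, gives `π`: this normalizes the visibility. -/
lemma lintegral_cos_sphereMeasure {n : E3} (hn : ‖n‖ = 1) :
    ∫⁻ u : S2, ENNReal.ofReal ⟪n, (u : E3)⟫_ℝ ∂sphereMeasure = ENNReal.ofReal Real.pi := by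
  obtain ⟨b, rfl⟩ := exists_orthonormalBasis_third hn
  have hF : Measurable fun y : E3 => ENNReal.ofReal ⟪b 2, y⟫_ℝ := by fun_prop
  have h := lintegral_hemisphere b hF one_ne_zero
  have e1 : ∀ u : S2, {y : E3 | 0 < 1 * ⟪b 2, y⟫_ℝ}.indicator
      (fun y : E3 => ENNReal.ofReal ⟪b 2, y⟫_ℝ) u = ENNReal.ofReal ⟪b 2, (u : E3)⟫_ℝ := by
    intro u
    by_cases hu : 0 < ⟪b 2, (u : E3)⟫_ℝ
    · exact indicator_of_mem (by simpa using hu) _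
    · rw [indicator_of_notMem (by simpa using hu)]
      exact (ENNReal.ofReal_of_nonpos (not_lt.1 hu)).symm
  simp_rw [e1] at h
  rw [← h]
  have e2 : ∀ w : ℝ × ℝ, ENNReal.ofReal ⟪b 2, ‖spaceParam b (1, w)‖⁻¹ • spaceParam b (1, w)⟫_ℝ *
      ENNReal.ofReal (|1| / ‖spaceParam b (1, w)‖ ^ 3) =
      ENNReal.ofReal (((1 + (w.1 ^ 2 + w.2 ^ 2)) ^ 2)⁻¹) := by
    intro w
    have hn := norm_sq_spaceParam b (1, w)
    rw [inner_smul_right, inner_spaceParam, ← ENNReal.ofReal_mul (by positivity)]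
    congr 1
    have : (1 + (w.1 ^ 2 + w.2 ^ 2)) ^ 2 = ‖spaceParam b (1, w)‖ ^ 4 := by
      rw [show ‖spaceParam b (1, w)‖ ^ 4 = (‖spaceParam b (1, w)‖ ^ 2) ^ 2 by ring, hn]; ring
    rw [this]
    have hp : ‖spaceParam b (1, w)‖ ≠ 0 := by
      intro h0; rw [h0] at hn; nlinarith [sq_nonneg w.1, sq_nonneg w.2]
    rw [abs_one]
    field_simp
  simp_rw [e2]
  rw [← lintegral_comp_polarCoord_symm]
  have e3 : ∀ p ∈ polarCoord.target, ENNReal.ofReal p.1 •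
      ENNReal.ofReal (((1 + ((polarCoord.symm p).1 ^ 2 + (polarCoord.symm p).2 ^ 2)) ^ 2)⁻¹) =
      ENNReal.ofReal (p.1 * ((1 + p.1 ^ 2) ^ 2)⁻¹) * (fun _ => 1) p.2 := by
    intro p hp
    have hp1 : 0 < p.1 := hp.1
    rw [polarCoord_symm_apply, smul_eq_mul, ← ENNReal.ofReal_mul hp1.le, mul_one]
    congr 4
    have := Real.sin_sq_add_cos_sq p.2
    simp only
    linear_combination p.1 ^ 2 * this
  rw [setLIntegral_congr_fun polarCoord.open_target.measurableSet e3, polarCoord_target,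
    Measure.volume_eq_prod, ← Measure.prod_restrict,
    lintegral_prod_mul (f := fun r : ℝ => ENNReal.ofReal (r * ((1 + r ^ 2) ^ 2)⁻¹))
      (g := fun _ : ℝ => 1) (by fun_prop) (by fun_prop)]
  -- The hemisphere is projected to the plane at height `1`, on which the cosine becomes the
  -- density `(1 + r ^ 2) ^ (-2)`.
  have e4 : ∫⁻ r in Ioi (0 : ℝ), ENNReal.ofReal (r * ((1 + r ^ 2) ^ 2)⁻¹) =
      ENNReal.ofReal (1 / 2) := by
    have hd : ∀ x ∈ Ici (0 : ℝ), HasDerivAt (fun r : ℝ => -(1 / 2) * (1 + r ^ 2)⁻¹)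
        (x * ((1 + x ^ 2) ^ 2)⁻¹) x := by
      intro x _
      have h0 : (1 + x ^ 2) ≠ 0 := by positivity
      have h1 : HasDerivAt (fun r : ℝ => 1 + r ^ 2) (2 * x) x := by
        simpa using (hasDerivAt_pow 2 x).const_add 1
      convert! (h1.inv h0).const_mul (-(1 / 2)) using 1
      field_simp
    have hlim : Tendsto (fun r : ℝ => -(1 / 2) * (1 + r ^ 2)⁻¹) atTop (𝓝 (-(1 / 2) * 0)) := by
      refine Tendsto.const_mul _ (tendsto_inv_atTop_zero.comp ?_)
      exact tendsto_atTop_add_const_left _ _ (tendsto_pow_atTop two_ne_zero)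
    have hpos : ∀ x ∈ Ioi (0 : ℝ), 0 ≤ x * ((1 + x ^ 2) ^ 2)⁻¹ := fun x hx => by
      have : (0 : ℝ) < x := hx
      positivity
    rw [← ofReal_integral_eq_lintegral_ofReal
      (integrableOn_Ioi_deriv_of_nonneg' hd hpos hlim)
      ((ae_restrict_iff' measurableSet_Ioi).2 (ae_of_all _ hpos)),
      integral_Ioi_of_hasDerivAt_of_nonneg' hd hpos hlim]
    norm_num
  rw [e4]
  simp only [lintegral_const, Measure.restrict_apply_univ, Real.volume_Ioo, one_mul]
  rw [← ENNReal.ofReal_mul (by norm_num)]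
  congr 1
  ring

/-- Integration over the sphere in spherical coordinates. It follows from two successive changes
to polar coordinates in space. -/
lemma lintegral_sphericalCoord {F : E3 → ℝ≥0∞} (hF : Measurable F) :
    ∫⁻ u : S2, F u ∂sphereMeasure =
      ∫⁻ p in (Ioo 0 (2 * Real.pi)) ×ˢ (Ioo 0 Real.pi),
        ENNReal.ofReal (Real.sin p.2) * F (sphericalCoord p.1 p.2) := by
  set b := EuclideanSpace.basisFun (Fin 3) ℝ with hb
  rw [lintegral_sphereMeasure hF, ← lintegral_indicator measurableSet_ball]
  set H := (Metric.ball (0 : E3) 1).indicator fun y => F (‖y‖⁻¹ • y) with hH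
  have hdm : Measurable fun y : E3 => ‖y‖⁻¹ • y := by fun_prop
  have hHm : Measurable H := (hF.comp hdm).indicator measurableSet_ball
  have hsm := (continuous_spaceParam b).measurable
  have hHs : Measurable fun q => H (spaceParam b q) := hHm.comp hsm
  have hsc : Measurable fun p : ℝ × ℝ => (sphericalCoord p.1 p.2 : E3) := by
    unfold sphericalCoord
    refine (WithLp.measurable_toLp 2 _).comp ?_
    refine measurable_pi_lambda _ fun i => ?_
    fin_cases i
    · simp; fun_prop
    · simp; fun_prop
    · simp; fun_prop
  have key : ∀ (R φ θ : ℝ), 0 < R →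
      H (spaceParam b (R * Real.cos φ, -((R * Real.sin φ) * Real.cos θ),
        -((R * Real.sin φ) * Real.sin θ))) =
      (Ioo 0 1).indicator (fun _ => F (sphericalCoord (θ + Real.pi) φ)) R := by
    intro R φ θ hR
    have e : spaceParam b (R * Real.cos φ, -((R * Real.sin φ) * Real.cos θ),
        -((R * Real.sin φ) * Real.sin θ)) = R • (sphericalCoord (θ + Real.pi) φ : E3) := by
      ext i
      fin_cases i <;>
        simp [spaceParam, hb, sphericalCoord, Real.cos_add_pi, Real.sin_add_pi] <;> ring
    have h1 : ‖(sphericalCoord (θ + Real.pi) φ : E3)‖ = 1 :=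
      norm_eq_of_mem_sphere (sphericalCoord (θ + Real.pi) φ)
    have hn : ‖R • (sphericalCoord (θ + Real.pi) φ : E3)‖ = R := by
      rw [norm_smul, h1, mul_one, Real.norm_eq_abs, abs_of_pos hR]
    rw [e, hH]
    by_cases hR1 : R < 1
    · rw [indicator_of_mem (by rw [mem_ball_zero_iff, hn]; exact hR1),
        indicator_of_mem (show R ∈ Ioo (0 : ℝ) 1 from ⟨hR, hR1⟩), hn, smul_smul,
        inv_mul_cancel₀ hR.ne', one_smul]
    · rw [indicator_of_notMem (by rw [mem_ball_zero_iff, hn]; exact hR1),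
        indicator_of_notMem (fun h : R ∈ Ioo (0 : ℝ) 1 => hR1 h.2)]
  rw [← (measurePreserving_spaceParam b).lintegral_comp hHm, Measure.volume_eq_prod ℝ (ℝ × ℝ),
    lintegral_prod_symm' _ hHs]
  have hneg : ∫⁻ w : ℝ × ℝ, ∫⁻ a : ℝ, H (spaceParam b (a, w)) =
      ∫⁻ w : ℝ × ℝ, ∫⁻ a : ℝ, H (spaceParam b (a, -w)) :=
    (lintegral_neg_eq_self (fun w : ℝ × ℝ => ∫⁻ a : ℝ, H (spaceParam b (a, w)))).symm
  rw [hneg, ← lintegral_comp_polarCoord_symm, polarCoord_target, Measure.volume_eq_prod ℝ ℝ,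
    ← Measure.prod_restrict]
  have hm1 : Measurable fun q : (ℝ × ℝ) × ℝ => ENNReal.ofReal q.1.1 * H (spaceParam b
      (q.2, -(q.1.1 * Real.cos q.1.2), -(q.1.1 * Real.sin q.1.2))) := by
    refine Measurable.mul (by fun_prop) (hHs.comp (by fun_prop))
  have e1 : ∀ p : ℝ × ℝ, ENNReal.ofReal p.1 • ∫⁻ a : ℝ, H (spaceParam b (a, -(polarCoord.symm p)))
      = ∫⁻ a : ℝ, ENNReal.ofReal p.1 * H (spaceParam b
      (a, -(p.1 * Real.cos p.2), -(p.1 * Real.sin p.2))) := by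
    intro p
    rw [lintegral_const_mul' _ _ ENNReal.ofReal_ne_top, smul_eq_mul, polarCoord_symm_apply]
    rfl
  simp_rw [e1]
  rw [lintegral_prod_symm' _ hm1.lintegral_prod_right']
  -- Polar coordinates in the half plane spanned by the axis, with the distance to the axis.
  have e2 : ∀ θ : ℝ, ∫⁻ r in Ioi (0 : ℝ), ∫⁻ a : ℝ, ENNReal.ofReal r * H (spaceParam b
      (a, -(r * Real.cos θ), -(r * Real.sin θ))) =
      ∫⁻ φ in Ioo 0 Real.pi, ENNReal.ofReal (1 / 3) *
        (ENNReal.ofReal (Real.sin φ) * F (sphericalCoord (θ + Real.pi) φ)) := by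
    intro θ
    have hm2 : Measurable fun q : ℝ × ℝ => ENNReal.ofReal q.2 * H (spaceParam b
      (q.1, -(q.2 * Real.cos θ), -(q.2 * Real.sin θ))) :=
      Measurable.mul (by fun_prop) (hHs.comp (by fun_prop))
    have hm2' : Measurable fun q : ℝ × ℝ => (Ioi (0 : ℝ)).indicator (fun r =>
        ENNReal.ofReal r * H (spaceParam b
      (q.1, -(r * Real.cos θ), -(r * Real.sin θ)))) q.2 := by
      have : (fun q : ℝ × ℝ => (Ioi (0 : ℝ)).indicator (fun r =>
        ENNReal.ofReal r * H (spaceParam b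
        (q.1, -(r * Real.cos θ), -(r * Real.sin θ)))) q.2) =
        (Prod.snd ⁻¹' (Ioi (0 : ℝ))).indicator (fun q : ℝ × ℝ => ENNReal.ofReal q.2 *
          H (spaceParam b (q.1, -(q.2 * Real.cos θ), -(q.2 * Real.sin θ)))) := by
        funext q
        simp [indicator]
      rw [this]
      exact hm2.indicator (measurable_snd measurableSet_Ioi)
    have hm3 : Measurable fun q : ℝ × ℝ =>
        (Ioo 0 Real.pi).indicator (fun φ => (Ioo 0 1).indicator (fun R =>
          ENNReal.ofReal (R ^ 2) * (ENNReal.ofReal (Real.sin φ) *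
            F (sphericalCoord (θ + Real.pi) φ))) q.1) q.2 := by
      have : (fun q : ℝ × ℝ =>
        (Ioo 0 Real.pi).indicator (fun φ => (Ioo 0 1).indicator (fun R =>
          ENNReal.ofReal (R ^ 2) * (ENNReal.ofReal (Real.sin φ) *
            F (sphericalCoord (θ + Real.pi) φ))) q.1) q.2) =
          (Ioo (0 : ℝ) 1 ×ˢ Ioo 0 Real.pi).indicator (fun q : ℝ × ℝ =>
          ENNReal.ofReal (q.1 ^ 2) * (ENNReal.ofReal (Real.sin q.2) *
            F (sphericalCoord (θ + Real.pi) q.2))) := by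
        funext q
        by_cases h1 : q.1 ∈ Ioo (0 : ℝ) 1 <;> by_cases h2 : q.2 ∈ Ioo 0 Real.pi <;>
          simp only [indicator, mem_prod, h1, h2, if_true, if_false, and_self, and_true,
            and_false]
      rw [this]
      refine Measurable.indicator ?_ (measurableSet_Ioo.prod measurableSet_Ioo)
      refine Measurable.mul (by fun_prop) (Measurable.mul (by fun_prop) ?_)
      exact hF.comp (hsc.comp (f := fun q : ℝ × ℝ => (θ + Real.pi, q.2)) (by fun_prop))
    rw [lintegral_lintegral_swap (f := fun r a : ℝ => ENNReal.ofReal r * H (spaceParam b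
      (a, -(r * Real.cos θ), -(r * Real.sin θ)))) (hm2.comp measurable_swap).aemeasurable]
    simp_rw [← lintegral_indicator measurableSet_Ioi]
    rw [← lintegral_prod _ hm2'.aemeasurable, ← Measure.volume_eq_prod,
      ← lintegral_comp_polarCoord_symm]
    have e3 : ∀ p ∈ polarCoord.target, ENNReal.ofReal p.1 •
        (Ioi (0 : ℝ)).indicator (fun r => ENNReal.ofReal r * H (spaceParam b
          ((polarCoord.symm p).1, -(r * Real.cos θ), -(r * Real.sin θ)))) (polarCoord.symm p).2 =
        (Ioo 0 Real.pi).indicator (fun φ => (Ioo 0 1).indicator (fun R =>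
          ENNReal.ofReal (R ^ 2) * (ENNReal.ofReal (Real.sin φ) *
            F (sphericalCoord (θ + Real.pi) φ))) p.1) p.2 := by
      rintro ⟨R, φ⟩ ⟨hR, hφ⟩
      have hR0 : 0 < R := hR
      simp only [polarCoord_symm_apply, smul_eq_mul]
      by_cases hφ0 : φ ∈ Ioo 0 Real.pi
      · have hs := Real.sin_pos_of_mem_Ioo hφ0
        rw [indicator_of_mem (show R * Real.sin φ ∈ Ioi (0 : ℝ) from mul_pos hR0 hs),
          indicator_of_mem hφ0, key R φ θ hR0]
        by_cases hR1 : R ∈ Ioo (0 : ℝ) 1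
        · rw [indicator_of_mem hR1, indicator_of_mem hR1, ← mul_assoc, ← mul_assoc,
            ← ENNReal.ofReal_mul hR0.le, ← ENNReal.ofReal_mul (sq_nonneg R)]
          congr 2; ring
        · rw [indicator_of_notMem hR1, indicator_of_notMem hR1]; simp
      · rw [indicator_of_notMem hφ0, indicator_of_notMem, mul_zero]
        have : φ ≤ 0 := by
          by_contra hc; exact hφ0 ⟨not_le.1 hc, hφ.2⟩
        have hs := Real.sin_nonpos_of_nonpos_of_neg_pi_le this hφ.1.le
        simp only [mem_Ioi, not_lt]
        exact mul_nonpos_of_nonneg_of_nonpos hR0.le hs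
    rw [setLIntegral_congr_fun polarCoord.open_target.measurableSet e3, polarCoord_target,
      Measure.volume_eq_prod, ← Measure.prod_restrict, lintegral_prod_symm' _ hm3]
    have e4 : ∀ φ : ℝ, ∫⁻ R in Ioi (0 : ℝ),
        (Ioo 0 Real.pi).indicator (fun φ => (Ioo 0 1).indicator (fun R =>
          ENNReal.ofReal (R ^ 2) * (ENNReal.ofReal (Real.sin φ) *
            F (sphericalCoord (θ + Real.pi) φ))) R) φ =
        (Ioo 0 Real.pi).indicator (fun φ => ENNReal.ofReal (1 / 3) *
          (ENNReal.ofReal (Real.sin φ) * F (sphericalCoord (θ + Real.pi) φ))) φ := by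
      intro φ
      by_cases hφ : φ ∈ Ioo 0 Real.pi
      · simp only [indicator_of_mem hφ]
        rw [lintegral_indicator measurableSet_Ioo, Measure.restrict_restrict measurableSet_Ioo,
          inter_eq_left.2 Ioo_subset_Ioi_self, lintegral_mul_const _ (by fun_prop),
          lintegral_Ioo_sq zero_le_one]
        norm_num
      · simp [indicator_of_notMem hφ]
    simp_rw [e4]
    rw [lintegral_indicator measurableSet_Ioo, Measure.restrict_restrict measurableSet_Ioo,
      inter_eq_left.2 (Ioo_subset_Ioo_left (by linarith [Real.pi_pos]))]
  have hm4 : Measurable fun q : ℝ × ℝ =>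
      ENNReal.ofReal (Real.sin q.2) * F (sphericalCoord q.1 q.2) :=
    Measurable.mul (by fun_prop) (hF.comp hsc)
  have e5 : ∀ θ : ℝ, ∫⁻ φ in Ioo 0 Real.pi, ENNReal.ofReal (1 / 3) *
        (ENNReal.ofReal (Real.sin φ) * F (sphericalCoord (θ + Real.pi) φ)) =
      ENNReal.ofReal (1 / 3) * ∫⁻ φ in Ioo 0 Real.pi,
        (ENNReal.ofReal (Real.sin φ) * F (sphericalCoord (θ + Real.pi) φ)) := fun θ =>
    lintegral_const_mul' _ _ ENNReal.ofReal_ne_top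
  simp_rw [e2, e5]
  rw [lintegral_const_mul' _ _ ENNReal.ofReal_ne_top, ← mul_assoc]
  have e6 : (3 : ℝ≥0∞) * ENNReal.ofReal (1 / 3) = 1 := by
    rw [show (3 : ℝ≥0∞) = ENNReal.ofReal 3 by simp, ← ENNReal.ofReal_mul (by norm_num)]
    norm_num
  rw [e6, one_mul, ← Measure.prod_restrict, lintegral_prod _ hm4.aemeasurable,
    ← lintegral_indicator measurableSet_Ioo, ← lintegral_indicator measurableSet_Ioo,
    ← lintegral_add_right_eq_self ((Ioo 0 (2 * Real.pi)).indicator _) Real.pi]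
  refine lintegral_congr fun θ => ?_
  have hiff : θ ∈ Ioo (-Real.pi) Real.pi ↔ θ + Real.pi ∈ Ioo 0 (2 * Real.pi) := by
    constructor <;> rintro ⟨h1, h2⟩ <;> constructor <;> linarith
  by_cases h : θ ∈ Ioo (-Real.pi) Real.pi
  · rw [indicator_of_mem h, indicator_of_mem (hiff.1 h)]
  · rw [indicator_of_notMem h, indicator_of_notMem (fun hc => h (hiff.2 hc))]

/-! ### Riemann integrable functions are bounded and measurable -/

section Riemann

open BoxIntegral

variable {ι : Type*} [Fintype ι]

/-- The sums with two different choices of the tags in the same fine partition are close: the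
tags of a Riemann partition are arbitrary points of the closed boxes. -/
lemma exists_partition_sum_le {I : Box ι} {f : (ι → ℝ) → ℝ}
    (h : BoxIntegral.Integrable I IntegrationParams.Riemann f BoxAdditiveMap.volume)
    {ε : ℝ} (hε : 0 < ε) :
    ∃ π : Prepartition I, π.IsPartition ∧ ∀ t t' : Box ι → ι → ℝ,
      (∀ J ∈ π, t J ∈ Box.Icc J) → (∀ J ∈ π, t' J ∈ Box.Icc J) →
        ∑ J ∈ π.boxes, (volume (J : Set (ι → ℝ))).toReal * (f (t J) - f (t' J)) ≤ ε := by
  classical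
  set c := I.distortion
  have hr := h.convergenceR_cond (ε / 2) c
  set r := h.convergenceR (ε / 2) c with hrdef
  have hr0 : ∀ x, r x = r 0 := hr rfl
  -- With half of the radius, each tag may be moved within its closed box.
  let r' : (ι → ℝ) → Ioi (0 : ℝ) := fun _ =>
    ⟨(r 0 : ℝ) / 2, mem_Ioi.2 (half_pos (mem_Ioi.1 (r 0).2))⟩
  obtain ⟨π₀, hπ₀, hpart⟩ :=
    IntegrationParams.Riemann.exists_memBaseSet_isPartition I (le_refl c) r'
  -- Tagged partitions carry tags also for the boxes outside the partition; these remain arbitrary.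
  let mk : (Box ι → ι → ℝ) → TaggedPrepartition I := fun t =>
    { π₀.toPrepartition with
      tag := fun J => if t J ∈ Box.Icc I then t J else π₀.tag J
      tag_mem_Icc := fun J => by
        by_cases hJ : t J ∈ Box.Icc I
        · simp [hJ]
        · simp only [hJ, if_false]; exact π₀.tag_mem_Icc J }
  have hmk : ∀ t : Box ι → ι → ℝ, (∀ J ∈ π₀.toPrepartition, t J ∈ Box.Icc J) →
      (∀ J ∈ π₀.toPrepartition, (mk t).tag J = t J) ∧
      IntegrationParams.Riemann.MemBaseSet I c r (mk t) := by
    intro t ht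
    have htag : ∀ J ∈ π₀.toPrepartition, (mk t).tag J = t J := fun J hJ =>
      if_pos (Box.le_iff_Icc.1 (π₀.toPrepartition.le_of_mem hJ) (ht J hJ))
    refine ⟨htag, ?_, ?_, ?_, ?_⟩
    · intro J hJ x hx
      have hJ' : J ∈ π₀.toPrepartition := hJ
      have h1 := hπ₀.isSubordinate J hJ hx
      have h2 := hπ₀.isSubordinate J hJ (ht J hJ')
      rw [htag J hJ', hr0]
      rw [Metric.mem_closedBall] at h1 h2 ⊢
      have e : ((r' (π₀.tag J) : Ioi (0 : ℝ)) : ℝ) = (r 0 : ℝ) / 2 := rfl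
      rw [e] at h1 h2
      linarith [dist_triangle_right x (t J) (π₀.tag J)]
    · intro _ J hJ
      rw [htag J hJ]; exact ht J hJ
    · intro hb; exact absurd hb (by decide)
    · intro hb; exact absurd hb (by decide)
  refine ⟨π₀.toPrepartition, hpart, fun t t' ht ht' => ?_⟩
  obtain ⟨h1, h2⟩ := hmk t ht
  obtain ⟨h1', h2'⟩ := hmk t' ht'
  have hd := h.dist_integralSum_le_of_memBaseSet (half_pos hε) (half_pos hε) h2 h2' rfl
  rw [add_halves, Real.dist_eq] at hd
  have hs : ∀ t : Box ι → ι → ℝ, (∀ J ∈ π₀.toPrepartition, (mk t).tag J = t J) →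
      integralSum f BoxAdditiveMap.volume (mk t) =
      ∑ J ∈ π₀.toPrepartition.boxes, (volume (J : Set (ι → ℝ))).toReal * f (t J) := by
    intro t ht
    refine Finset.sum_congr rfl fun J hJ => ?_
    rw [ht J hJ, BoxAdditiveMap.volume_apply, Box.volume_apply', smul_eq_mul]
  rw [hs t h1, hs t' h1', ← Finset.sum_sub_distrib] at hd
  refine le_trans (le_of_eq ?_) ((le_abs_self _).trans hd)
  exact Finset.sum_congr rfl fun J _ => by ring

lemma box_volume_pos (J : Box ι) : 0 < (volume (J : Set (ι → ℝ))).toReal := by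
  rw [Box.volume_apply']
  exact Finset.prod_pos fun i _ => sub_pos.2 (J.lower_lt_upper i)

/-- The oscillation of `f` on a single box of the partition is bounded, on moving the tags of this
box only. -/
lemma exists_bound_of_partition {I : Box ι} {f : (ι → ℝ) → ℝ} {π : Prepartition I} {ε : ℝ}
    (h : ∀ t t' : Box ι → ι → ℝ,
      (∀ J ∈ π, t J ∈ Box.Icc J) → (∀ J ∈ π, t' J ∈ Box.Icc J) →
        ∑ J ∈ π.boxes, (volume (J : Set (ι → ℝ))).toReal * (f (t J) - f (t' J)) ≤ ε)
    {J : Box ι} (hJ : J ∈ π) {x y : ι → ℝ} (hx : x ∈ Box.Icc J) (hy : y ∈ Box.Icc J) :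
    f x - f y ≤ ε / (volume (J : Set (ι → ℝ))).toReal := by
  classical
  rw [le_div_iff₀ (box_volume_pos J), mul_comm]
  have := h (Function.update Box.upper J x) (Function.update Box.upper J y)
    (fun J' _ => by
      by_cases e : J' = J
      · subst e; simpa using hx
      · simp [e])
    (fun J' _ => by
      by_cases e : J' = J
      · subst e; simpa using hy
      · simp [e])
  rw [Finset.sum_eq_single J] at this
  · simpa using this
  · intro J' _ hne
    simp [hne]
  · intro hn; exact absurd hJ hn

lemma exists_bound_of_riemannIntegrable {I : Box ι} {f : (ι → ℝ) → ℝ}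
    (h : BoxIntegral.Integrable I IntegrationParams.Riemann f BoxAdditiveMap.volume) :
    ∃ C : ℝ, ∀ x ∈ I, |f x| ≤ C := by
  obtain ⟨π, hπ, hs⟩ := exists_partition_sum_le h one_pos
  refine ⟨∑ J ∈ π.boxes, (1 / (volume (J : Set (ι → ℝ))).toReal + |f J.upper|), fun x hx => ?_⟩
  obtain ⟨J, hJ, hxJ⟩ := hπ x hx
  have hxc : x ∈ Box.Icc J := Box.coe_subset_Icc hxJ
  have h1 := exists_bound_of_partition hs hJ hxc J.upper_mem_Icc
  have h2 := exists_bound_of_partition hs hJ J.upper_mem_Icc hxc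
  have h3 : |f x| ≤ 1 / (volume (J : Set (ι → ℝ))).toReal + |f J.upper| := by
    have : |f x - f J.upper| ≤ 1 / (volume (J : Set (ι → ℝ))).toReal := abs_le.2 ⟨by linarith, h1⟩
    have h4 := abs_sub_abs_le_abs_sub (f x) (f J.upper)
    linarith
  refine h3.trans (Finset.single_le_sum (f := fun J : Box ι =>
    1 / (volume (J : Set (ι → ℝ))).toReal + |f J.upper|) (fun J' _ => ?_) hJ)
  have := box_volume_pos J'
  positivity

/-- A Riemann integrable function is the limit almost everywhere of step functions: the integrals
of its oscillations over fine partitions are summable. -/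
lemma aemeasurable_of_riemannIntegrable {I : Box ι} {f : (ι → ℝ) → ℝ}
    (h : BoxIntegral.Integrable I IntegrationParams.Riemann f BoxAdditiveMap.volume) :
    AEMeasurable f (volume.restrict (I : Set (ι → ℝ))) := by
  classical
  have hε : ∀ n : ℕ, (0 : ℝ) < (1 / 2) ^ n := fun n => by positivity
  choose π hπ hs using fun n : ℕ => exists_partition_sum_le h (hε n)
  -- `o J` bounds the oscillation of `f` over the closed box `J`.
  have hosc : ∀ n, ∃ o : Box ι → ℝ, (∀ J ∈ π n, ∀ x ∈ Box.Icc J, |f x - f J.upper| ≤ o J) ∧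
      (∀ J, 0 ≤ o J) ∧
      ∑ J ∈ (π n).boxes, (volume (J : Set (ι → ℝ))).toReal * o J ≤ 2 * (1 / 2) ^ n := by
    intro n
    set D : Box ι → Set ℝ := fun J => (fun p : (ι → ℝ) × (ι → ℝ) => f p.1 - f p.2) ''
      (Box.Icc J ×ˢ Box.Icc J) with hD
    have hne : ∀ J, (D J).Nonempty := fun J =>
      ⟨_, ⟨(J.upper, J.upper), ⟨J.upper_mem_Icc, J.upper_mem_Icc⟩, rfl⟩⟩
    have hbdd : ∀ J ∈ π n, BddAbove (D J) := by
      rintro J hJ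
      refine ⟨(1 / 2) ^ n / (volume (J : Set (ι → ℝ))).toReal, ?_⟩
      rintro _ ⟨⟨x, y⟩, ⟨hx, hy⟩, rfl⟩
      exact exists_bound_of_partition (hs n) hJ hx hy
    have hI : 0 < ∑ J ∈ (π n).boxes, (volume (J : Set (ι → ℝ))).toReal := by
      obtain ⟨J, hJ, _⟩ := hπ n I.upper I.upper_mem
      exact Finset.sum_pos (fun J _ => box_volume_pos J) ⟨J, hJ⟩
    set δ := (1 / 2 : ℝ) ^ n / ∑ J ∈ (π n).boxes, (volume (J : Set (ι → ℝ))).toReal with hδ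
    have hδ0 : 0 < δ := div_pos (hε n) hI
    have hex : ∀ J : Box ι, ∃ p ∈ Box.Icc J ×ˢ Box.Icc J, sSup (D J) - δ < f p.1 - f p.2 := by
      intro J
      obtain ⟨_, ⟨p, hp, rfl⟩, hlt⟩ := exists_lt_of_lt_csSup (hne J) (sub_lt_self (sSup (D J)) hδ0)
      exact ⟨p, hp, hlt⟩
    choose p hp hlt using hex
    refine ⟨fun J => max (sSup (D J)) 0, fun J hJ x hx => ?_, fun J => le_max_right _ _, ?_⟩
    · have h1 := le_csSup (hbdd J hJ) ⟨(x, J.upper), ⟨hx, J.upper_mem_Icc⟩, rfl⟩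
      have h2 := le_csSup (hbdd J hJ) ⟨(J.upper, x), ⟨J.upper_mem_Icc, hx⟩, rfl⟩
      simp only at h1 h2
      exact (abs_le.2 ⟨by linarith, h1⟩).trans (le_max_left _ _)
    · have h0 : ∀ J ∈ π n, max (sSup (D J)) 0 = sSup (D J) := fun J hJ => by
        refine max_eq_left (le_csSup (hbdd J hJ) ⟨(J.upper, J.upper), ⟨J.upper_mem_Icc,
          J.upper_mem_Icc⟩, by simp⟩)
      have h1 := hs n (fun J => (p J).1) (fun J => (p J).2) (fun J _ => (hp J).1)
        (fun J _ => (hp J).2)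
      have h2 : ∑ J ∈ (π n).boxes, (volume (J : Set (ι → ℝ))).toReal * max (sSup (D J)) 0 ≤
          ∑ J ∈ (π n).boxes, ((volume (J : Set (ι → ℝ))).toReal * (f (p J).1 - f (p J).2) +
            (volume (J : Set (ι → ℝ))).toReal * δ) := by
        refine Finset.sum_le_sum fun J hJ => ?_
        rw [h0 J hJ, ← mul_add]
        exact mul_le_mul_of_nonneg_left (by linarith [hlt J]) ENNReal.toReal_nonneg
      rw [Finset.sum_add_distrib, ← Finset.sum_mul, hδ, mul_div_cancel₀ _ hI.ne'] at h2
      linarith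
  choose o ho ho0 hosum using hosc
  -- The step functions `g n` differ from `f` by at most `H n`, and the integrals of `H n` are
  -- summable, so that `H n` tends to `0` almost everywhere.
  let g : ℕ → (ι → ℝ) → ℝ := fun n x =>
    ∑ J ∈ (π n).boxes, (J : Set (ι → ℝ)).indicator (fun _ => f J.upper) x
  let H : ℕ → (ι → ℝ) → ℝ≥0∞ := fun n x =>
    ∑ J ∈ (π n).boxes, (J : Set (ι → ℝ)).indicator (fun _ => ENNReal.ofReal (o n J)) x
  have hgm : ∀ n, Measurable (g n) := fun n => Finset.measurable_sum _ fun J _ =>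
    measurable_const.indicator J.measurableSet_coe
  have hHm : ∀ n, Measurable (H n) := fun n => Finset.measurable_sum _ fun J _ =>
    measurable_const.indicator J.measurableSet_coe
  have hle : ∀ n, ∀ x ∈ I, ENNReal.ofReal |f x - g n x| ≤ H n x := by
    intro n x hx
    obtain ⟨J, hJ, hxJ⟩ := hπ n x hx
    have huniq : ∀ J' ∈ (π n).boxes, J' ≠ J → x ∉ (J' : Set (ι → ℝ)) := fun J' hJ' hne hx' =>
      hne ((π n).eq_of_mem_of_mem hJ' hJ hx' hxJ)
    have e1 : g n x = f J.upper := by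
      simp only [g]
      rw [Finset.sum_eq_single_of_mem J hJ fun J' hJ' hne =>
        indicator_of_notMem (huniq J' hJ' hne) _]
      exact indicator_of_mem hxJ _
    have e2 : H n x = ENNReal.ofReal (o n J) := by
      simp only [H]
      rw [Finset.sum_eq_single_of_mem J hJ fun J' hJ' hne =>
        indicator_of_notMem (huniq J' hJ' hne) _]
      exact indicator_of_mem hxJ _
    rw [e1, e2]
    exact ENNReal.ofReal_le_ofReal (ho n J hJ x (Box.coe_subset_Icc hxJ))
  have hHint : ∀ n, ∫⁻ x, H n x ≤ ENNReal.ofReal (2 * (1 / 2) ^ n) := by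
    intro n
    have : ∫⁻ x, H n x = ∑ J ∈ (π n).boxes, ENNReal.ofReal (o n J) *
        volume (J : Set (ι → ℝ)) := by
      simp only [H]
      rw [lintegral_finsetSum _ fun J _ => measurable_const.indicator J.measurableSet_coe]
      exact Finset.sum_congr rfl fun J _ => lintegral_indicator_const J.measurableSet_coe _
    rw [this]
    refine le_trans (le_of_eq ?_) (ENNReal.ofReal_le_ofReal (hosum n))
    rw [ENNReal.ofReal_sum_of_nonneg fun J _ => mul_nonneg ENNReal.toReal_nonneg (ho0 n J)]
    refine Finset.sum_congr rfl fun J _ => ?_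
    rw [ENNReal.ofReal_mul ENNReal.toReal_nonneg, ENNReal.ofReal_toReal, mul_comm]
    exact (J.isBounded.measure_lt_top).ne
  have hsum : ∫⁻ x, ∑' n, H n x ≠ ∞ := by
    rw [lintegral_tsum fun n => (hHm n).aemeasurable]
    refine ne_top_of_le_ne_top ?_ (ENNReal.tsum_le_tsum hHint)
    have hsm : Summable fun n : ℕ => 2 * (1 / 2 : ℝ) ^ n := summable_geometric_two.mul_left 2
    rw [← ENNReal.ofReal_tsum_of_nonneg (fun n => by positivity) hsm]
    exact ENNReal.ofReal_ne_top
  have hae : ∀ᵐ x : ι → ℝ, ∑' n, H n x < ∞ :=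
    ae_lt_top (Measurable.tsum hHm) hsum
  refine aemeasurable_of_tendsto_metrizable_ae' (f := g) (fun n => (hgm n).aemeasurable) ?_
  filter_upwards [ae_restrict_of_ae hae, ae_restrict_mem I.measurableSet_coe] with x hx hxI
  have h0 := ENNReal.tendsto_atTop_zero_of_tsum_ne_top hx.ne
  have h1 : Tendsto (fun n => ENNReal.ofReal |f x - g n x|) atTop (𝓝 0) :=
    tendsto_of_tendsto_of_tendsto_of_le_of_le tendsto_const_nhds h0 (fun _ => bot_le)
      fun n => hle n x hxI
  have h2 := (ENNReal.tendsto_toReal ENNReal.zero_ne_top).comp h1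
  rw [tendsto_iff_dist_tendsto_zero]
  refine (h2.congr fun n => ?_)
  simp [Real.dist_eq, abs_sub_comm]

end Riemann

/-! ### Illuminations are integrable over the sphere -/

lemma continuous_sphericalCoord : Continuous fun p : ℝ × ℝ => sphericalCoord p.1 p.2 := by
  unfold sphericalCoord
  refine Continuous.subtype_mk ((PiLp.continuous_toLp 2 _).comp ?_) _
  refine continuous_pi fun i => ?_
  fin_cases i
  · simp; fun_prop
  · simp; fun_prop
  · simp; fun_prop

/-- The azimuth in `(0, 2 π]` and the polar angle in `[0, π]` of a unit vector. -/
def angles (u : E3) : ℝ × ℝ :=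
  (Complex.arg (-(u 0 + u 1 * Complex.I)) + Real.pi, Real.arccos (u 2))

lemma measurable_angles : Measurable angles := by
  unfold angles
  refine Measurable.prodMk (Measurable.add_const ?_ _) ?_
  · refine Complex.measurable_arg.comp ?_
    fun_prop
  · exact Real.continuous_arccos.measurable.comp (by fun_prop)

lemma sphericalCoord_angles (u : S2) : sphericalCoord (angles u).1 (angles u).2 = u := by
  have hu : (u : E3) 0 ^ 2 + (u : E3) 1 ^ 2 + (u : E3) 2 ^ 2 = 1 := by
    have h1 : ‖(u : E3)‖ = 1 := norm_eq_of_mem_sphere u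
    have := EuclideanSpace.norm_sq_eq (u : E3)
    rw [h1, Fin.sum_univ_three] at this
    simp at this
    linarith
  set z : ℂ := (u : E3) 0 + (u : E3) 1 * Complex.I with hz
  have hre : z.re = (u : E3) 0 := by simp [hz]
  have him : z.im = (u : E3) 1 := by simp [hz]
  have hnz : Real.sqrt (1 - (u : E3) 2 ^ 2) = ‖z‖ := by
    rw [Complex.norm_def, Complex.normSq_apply, hre, him]
    congr 1; linarith
  have h2a : -1 ≤ (u : E3) 2 := by nlinarith [sq_nonneg ((u : E3) 0), sq_nonneg ((u : E3) 1)]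
  have h2b : (u : E3) 2 ≤ 1 := by nlinarith [sq_nonneg ((u : E3) 0), sq_nonneg ((u : E3) 1)]
  have hc := Complex.norm_mul_cos_arg (-z)
  have hs := Complex.norm_mul_sin_arg (-z)
  rw [norm_neg] at hc hs
  apply Subtype.ext
  ext i
  fin_cases i
  · simp [sphericalCoord, angles, Real.sin_arccos, hnz, Real.cos_add_pi, ← hz]
    rw [Complex.neg_re, hre] at hc
    linarith
  · simp [sphericalCoord, angles, Real.sin_arccos, hnz, Real.sin_add_pi, ← hz]
    rw [Complex.neg_im, him] at hs
    linarith
  · simp [sphericalCoord, angles, Real.cos_arccos h2a h2b]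

lemma angles_sphericalCoord {p : ℝ × ℝ} (hp : p ∈ Ioo 0 (2 * Real.pi) ×ˢ Ioo 0 Real.pi) :
    angles (sphericalCoord p.1 p.2) = p := by
  obtain ⟨θ, φ⟩ := p
  obtain ⟨hθ, hφ⟩ := hp
  simp only at hθ hφ
  have hs := Real.sin_pos_of_mem_Ioo hφ
  refine Prod.ext ?_ ?_
  · have e : -(((sphericalCoord θ φ : E3) 0 : ℂ) + ((sphericalCoord θ φ : E3) 1 : ℂ) * Complex.I) =
        (Real.sin φ : ℂ) * (Complex.cos ((θ - Real.pi : ℝ)) +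
          Complex.sin ((θ - Real.pi : ℝ)) * Complex.I) := by
      simp [sphericalCoord, Complex.cos_sub_pi, Complex.sin_sub_pi]
      ring
    simp only [angles]
    rw [e, Complex.arg_mul_cos_add_sin_mul_I hs ⟨by linarith [hθ.1], by linarith [hθ.2]⟩]
    ring
  · simp only [angles, sphericalCoord]
    simp
    exact Real.arccos_cos hφ.1.le hφ.2.le

lemma symm_mem_angleBox {p : ℝ × ℝ} (hp : p ∈ Ioo 0 (2 * Real.pi) ×ˢ Ioo 0 Real.pi) :
    (MeasurableEquiv.finTwoArrow.symm p : Fin 2 → ℝ) ∈ angleBox := by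
  rw [BoxIntegral.Box.mem_def, Fin.forall_fin_two]
  exact ⟨⟨hp.1.1, hp.1.2.le⟩, ⟨hp.2.1, hp.2.2.le⟩⟩

lemma aemeasurable_comp_finTwoArrow_symm {I : Set (Fin 2 → ℝ)} {R : Set (ℝ × ℝ)}
    {f : (Fin 2 → ℝ) → ℝ}
    (hf : AEMeasurable f (volume.restrict I))
    (hI : ∀ p ∈ R, (MeasurableEquiv.finTwoArrow.symm p : Fin 2 → ℝ) ∈ I) :
    AEMeasurable (fun p => f (MeasurableEquiv.finTwoArrow.symm p)) (volume.restrict R) := by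
  have h1 : AEMeasurable f (volume.restrict (MeasurableEquiv.finTwoArrow ⁻¹' R)) := by
    refine hf.mono_measure (Measure.restrict_mono ?_ le_rfl)
    intro w hw
    have := hI _ hw
    rwa [MeasurableEquiv.symm_apply_apply] at this
  have h2 := (volume_preserving_finTwoArrow ℝ).symm.restrict_preimage_emb
    (MeasurableEquiv.measurableEmbedding _) (MeasurableEquiv.finTwoArrow ⁻¹' R)
  have h3 : MeasurableEquiv.finTwoArrow.symm ⁻¹'
      (MeasurableEquiv.finTwoArrow (α := ℝ) ⁻¹' R) = R := by
    ext p; simp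
  rw [h3] at h2
  exact h1.comp_quasiMeasurePreserving h2.quasiMeasurePreserving

lemma exists_bound_aemeasurable_of_mem_illuminations {f : S2 → ℝ} (hf : f ∈ illuminations) :
    ∃ C : ℝ, (∀ p ∈ Ioo 0 (2 * Real.pi) ×ˢ Ioo 0 Real.pi,
      |f (sphericalCoord p.1 p.2) * Real.sin p.2| ≤ C) ∧
      AEMeasurable (fun p : ℝ × ℝ => f (sphericalCoord p.1 p.2) * Real.sin p.2)
        (volume.restrict (Ioo 0 (2 * Real.pi) ×ˢ Ioo 0 Real.pi)) := by
  obtain ⟨C, hC⟩ := exists_bound_of_riemannIntegrable hf.2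
  have hmeas := aemeasurable_of_riemannIntegrable hf.2
  refine ⟨C, fun p hp => ?_, aemeasurable_comp_finTwoArrow_symm hmeas fun _ => symm_mem_angleBox⟩
  have h := hC (MeasurableEquiv.finTwoArrow.symm p) (symm_mem_angleBox hp)
  have e0 : (MeasurableEquiv.finTwoArrow.symm p : Fin 2 → ℝ) 0 = p.1 := rfl
  have e1 : (MeasurableEquiv.finTwoArrow.symm p : Fin 2 → ℝ) 1 = p.2 := rfl
  rw [e0, e1] at h
  exact h

/-- Riemann integrability in spherical coordinates, with the Jacobian `sin φ`, makes `f` Lebesgue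
integrable over the sphere; `f` itself may be unbounded at the poles. -/
lemma integrable_of_mem_illuminations {f : S2 → ℝ} (hf : f ∈ illuminations) :
    Integrable f sphereMeasure := by
  obtain ⟨C, hgC, hgm⟩ := exists_bound_aemeasurable_of_mem_illuminations hf
  have hangles : ∀ p ∈ Ioo 0 (2 * Real.pi) ×ˢ Ioo 0 Real.pi,
    angles (sphericalCoord p.1 p.2) = p := fun p hp => angles_sphericalCoord hp
  have hsin : ∀ p ∈ Ioo 0 (2 * Real.pi) ×ˢ Ioo 0 Real.pi, 0 < Real.sin p.2 :=
    fun p hp => Real.sin_pos_of_mem_Ioo hp.2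
  have hint : ∀ F : E3 → ℝ≥0∞, Measurable F → ∫⁻ u : S2, F u ∂sphereMeasure =
      ∫⁻ p in (Ioo 0 (2 * Real.pi)) ×ˢ (Ioo 0 Real.pi),
        ENNReal.ofReal (Real.sin p.2) * F (sphericalCoord p.1 p.2) :=
    fun F hF => lintegral_sphericalCoord hF
  have hRm : MeasurableSet (Ioo 0 (2 * Real.pi) ×ˢ Ioo 0 Real.pi) :=
    measurableSet_Ioo.prod measurableSet_Ioo
  have hRvol : volume (Ioo 0 (2 * Real.pi) ×ˢ Ioo 0 Real.pi) < ∞ := by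
    rw [Measure.volume_eq_prod, Measure.prod_prod, Real.volume_Ioo, Real.volume_Ioo]
    exact ENNReal.mul_lt_top ENNReal.ofReal_lt_top ENNReal.ofReal_lt_top
  generalize (Ioo 0 (2 * Real.pi) ×ˢ Ioo 0 Real.pi) = R at *
  set g : ℝ × ℝ → ℝ := fun p => f (sphericalCoord p.1 p.2) * Real.sin p.2 with hg
  obtain ⟨G, hG, hgG⟩ := hgm
  set F : E3 → ℝ := fun u => G (angles u) / Real.sin (angles u).2 with hF
  have hFm : Measurable F :=
    (hG.comp measurable_angles).div (Real.measurable_sin.comp measurable_angles.snd)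
  obtain ⟨B, hBsub, hBm, hB0⟩ := exists_measurable_superset_of_null (ae_iff.1 hgG)
  have hsphm : Measurable fun p : ℝ × ℝ => (sphericalCoord p.1 p.2 : E3) :=
    (continuous_subtype_val.comp continuous_sphericalCoord).measurable
  -- The Jacobian does not vanish in the open rectangle, so null sets of angles give null sets of
  -- directions.
  have hnull : sphereMeasure {u : S2 | angles u ∈ B ∪ Rᶜ} = 0 := by
    have hm : MeasurableSet {u : E3 | angles u ∈ B ∪ Rᶜ} :=
      measurable_angles (hBm.union hRm.compl)
    have h1 := hint ({u : E3 | angles u ∈ B ∪ Rᶜ}.indicator 1) (measurable_one.indicator hm)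
    have h2 : ∫⁻ u : S2, {u : E3 | angles u ∈ B ∪ Rᶜ}.indicator 1 (u : E3) ∂sphereMeasure =
        sphereMeasure {u : S2 | angles u ∈ B ∪ Rᶜ} := by
      exact lintegral_indicator_one (measurable_subtype_coe hm)
    rw [← h2, h1, lintegral_eq_zero_iff' ?_]
    · have hB' : ∀ᵐ p ∂(volume.restrict R), p ∉ B := by
        rw [ae_iff]; simpa using hB0
      filter_upwards [hB', ae_restrict_mem hRm] with p hp hpR
      have : (sphericalCoord p.1 p.2 : E3) ∉ {u : E3 | angles u ∈ B ∪ Rᶜ} := by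
        change ¬ (angles (sphericalCoord p.1 p.2) ∈ B ∪ Rᶜ)
        rw [hangles p hpR]
        rintro (h | h)
        · exact hp h
        · exact h hpR
      rw [indicator_of_notMem this]
      simp
    · refine (Measurable.mul (by fun_prop) ?_).aemeasurable
      exact (measurable_one.indicator hm).comp hsphm
  have hfF : f =ᵐ[sphereMeasure] fun u => F u := by
    have : ∀ᵐ u : S2 ∂sphereMeasure, ¬ (angles u ∈ B ∪ Rᶜ) := by
      rw [ae_iff]; simpa only [not_not] using hnull
    filter_upwards [this] with u hu
    have hu1 : angles u ∉ B := fun h => hu (Or.inl h)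
    have hu2 : angles u ∈ R := by
      by_contra h; exact hu (Or.inr h)
    have h1 : g (angles u) = G (angles u) := by
      by_contra hne
      exact hu1 (hBsub hne)
    have hs := hsin _ hu2
    simp only [hF]
    rw [← h1, hg]
    simp only
    rw [sphericalCoord_angles, mul_div_cancel_right₀ _ hs.ne']
  refine Integrable.congr ?_ hfF.symm
  refine ⟨(hFm.comp measurable_subtype_coe).aestronglyMeasurable, ?_⟩
  have h1 := hint (fun u => ‖F u‖ₑ) hFm.enorm
  rw [HasFiniteIntegral, h1]
  have hBae : ∀ᵐ p ∂(volume.restrict R), p ∉ B := by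
    rw [ae_iff]; simpa using hB0
  -- The Jacobian of the measure turns the integrand into the bounded function `|f| sin φ`.
  have h2 : ∫⁻ p in R, ENNReal.ofReal (Real.sin p.2) * ‖F (sphericalCoord p.1 p.2)‖ₑ ≤
      ∫⁻ p in R, ENNReal.ofReal C := by
    refine lintegral_mono_ae ?_
    filter_upwards [hBae, ae_restrict_mem hRm] with p hpB hpR
    have hs := hsin p hpR
    have h3 : g p = G p := by
      by_contra hne
      exact hpB (hBsub hne)
    simp only [hF]
    rw [hangles p hpR, ← h3, Real.enorm_eq_ofReal_abs, ← ENNReal.ofReal_mul hs.le,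
      abs_div, abs_of_pos hs, mul_div_cancel₀ _ hs.ne']
    exact ENNReal.ofReal_le_ofReal (hgC p hpR)
  refine h2.trans_lt ?_
  rw [lintegral_const, Measure.restrict_apply_univ]
  exact ENNReal.mul_lt_top ENNReal.ofReal_lt_top hRvol

lemma mem_illuminations_of_continuous {f : S2 → ℝ} (hf : Continuous f) (h0 : ∀ u, 0 ≤ f u) :
    f ∈ illuminations := by
  have hc : Continuous fun w : Fin 2 → ℝ => f (sphericalCoord (w 0) (w 1)) * Real.sin (w 1) := by
    have h1 : Continuous fun w : Fin 2 → ℝ => (w 0, w 1) := by fun_prop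
    have h2 : Continuous fun w : Fin 2 → ℝ => sphericalCoord (w 0) (w 1) :=
      continuous_sphericalCoord.comp h1
    exact (hf.comp h2).mul (by fun_prop)
  exact ⟨h0, BoxIntegral.integrable_of_continuousOn (I := angleBox)
    BoxIntegral.IntegrationParams.Riemann hc.continuousOn volume⟩

/-! ### Visibility -/

lemma measurableSet_exists_mem_of_isSigmaCompact {X : Type*} [TopologicalSpace X]
    [MeasurableSpace X] [OpensMeasurableSpace X] {s : Set ℝ} (hs : IsSigmaCompact s)
    {f : X × ℝ → E3} (hf : Continuous f) {C : Set E3} (hC : IsClosed C) :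
    MeasurableSet {x | ∃ t ∈ s, f (x, t) ∈ C} := by
  obtain ⟨K, hK, rfl⟩ := hs
  have : {x | ∃ t ∈ ⋃ n, K n, f (x, t) ∈ C} = ⋃ n, {x | ∃ t ∈ K n, f (x, t) ∈ C} := by
    ext x
    simp only [mem_iUnion, mem_ofPred_eq]
    exact ⟨fun ⟨t, ⟨n, hn⟩, h⟩ => ⟨n, t, hn, h⟩, fun ⟨n, t, hn, h⟩ => ⟨t, ⟨n, hn⟩, h⟩⟩
  rw [this]
  refine MeasurableSet.iUnion fun n => IsClosed.measurableSet ?_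
  have : CompactSpace (K n) := isCompact_iff_compactSpace.1 (hK n)
  have hcl : IsClosed {p : X × K n | f (p.1, p.2) ∈ C} :=
    hC.preimage (hf.comp (continuous_fst.prodMk (continuous_subtype_val.comp continuous_snd)))
  convert isClosedMap_fst_of_compactSpace _ hcl using 1
  ext x
  simp only [mem_ofPred_eq, mem_image, Prod.exists, exists_and_right, exists_eq_right]
  exact ⟨fun ⟨t, h1, h2⟩ => ⟨⟨t, h1⟩, h2⟩, fun ⟨t, h⟩ => ⟨t, t.2, h⟩⟩

lemma isSigmaCompact_of_isLocallyClosed {s : Set ℝ} (hs : IsLocallyClosed s) :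
    IsSigmaCompact s := by
  have : LocallyCompactSpace s := hs.locallyCompactSpace
  rw [isSigmaCompact_iff_sigmaCompactSpace]
  infer_instance

namespace TriangulatedObject

variable (O : TriangulatedObject)

/-- The open ray from `x` in direction `u` misses the body. -/
def Lit (x u : E3) : Prop := ∀ t : ℝ, 0 < t → x + t • u ∉ O.body

/-- The open segment between `x` and `x'` misses the body. -/
def Clear (x x' : E3) : Prop := ∀ t ∈ Ioo (0 : ℝ) 1, AffineMap.lineMap x x' t ∉ O.body

lemma measurableSet_lit : MeasurableSet {p : E3 × E3 | O.Lit p.1 p.2} := by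
  have h := measurableSet_exists_mem_of_isSigmaCompact (X := E3 × E3)
    (isSigmaCompact_of_isLocallyClosed (isOpen_Ioi (a := (0 : ℝ))).isLocallyClosed)
    (f := fun q => q.1.1 + q.2 • q.1.2) (by fun_prop) O.isCompact_body.isClosed
  convert h.compl using 1
  ext p
  simp [Lit]

lemma measurableSet_clear : MeasurableSet {p : E3 × E3 | O.Clear p.1 p.2} := by
  have h := measurableSet_exists_mem_of_isSigmaCompact (X := E3 × E3)
    (isSigmaCompact_of_isLocallyClosed (isOpen_Ioo (a := (0 : ℝ)) (b := 1)).isLocallyClosed)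
    (f := fun q => AffineMap.lineMap q.1.1 q.1.2 q.2)
    (by simp only [AffineMap.lineMap_apply_module]; fun_prop) O.isCompact_body.isClosed
  convert h.compl using 1
  ext p
  simp [Clear]

lemma clear_comm {x x' : E3} : O.Clear x x' ↔ O.Clear x' x := by
  have : ∀ x x', O.Clear x x' → O.Clear x' x := fun x x' h t ht => by
    rw [← AffineMap.lineMap_apply_one_sub]
    exact h _ ⟨by linarith [ht.2], by linarith [ht.1]⟩
  exact ⟨this _ _, this _ _⟩

open Classical in
lemma dirVisible_eq {x u : E3} (hx : x ∈ O.body) (hu : u ≠ 0) :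
    O.dirVisible x u = if O.Lit x u then 1 else 0 := by
  unfold dirVisible
  congr 1
  rw [eq_iff_iff]
  constructor
  · intro h t ht hmem
    have h1 : x + t • u ∈ ({x} : Set E3) := by
      rw [← h]; exact ⟨⟨t, ht.le, rfl⟩, hmem⟩
    have h2 : t • u = 0 := by simpa using h1
    exact hu ((smul_eq_zero.1 h2).resolve_left ht.ne')
  · intro h
    ext y
    constructor
    · rintro ⟨⟨t, ht, rfl⟩, hy⟩
      rcases ht.eq_or_lt with rfl | ht'
      · simp
      · exact absurd hy (h t ht')
    · rintro rfl
      exact ⟨⟨0, le_rfl, by simp⟩, hx⟩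

open Classical in
lemma ptVisible_eq {x x' : E3} (hx : x ∈ O.body) (hx' : x' ∈ O.body) (hne : x ≠ x') :
    O.ptVisible x x' = if O.Clear x x' then 1 else 0 := by
  unfold ptVisible
  congr 1
  rw [eq_iff_iff, segment_eq_image_lineMap]
  constructor
  · intro h t ht hmem
    have h1 : AffineMap.lineMap x x' t ∈ ({x, x'} : Set E3) := by
      rw [← h]; exact ⟨⟨t, ⟨ht.1.le, ht.2.le⟩, rfl⟩, hmem⟩
    have hinj := AffineMap.lineMap_injective ℝ hne
    rcases h1 with h1 | h1
    · have : t = 0 := hinj (by simpa using h1)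
      linarith [ht.1]
    · have : t = 1 := hinj (by simpa using h1)
      linarith [ht.2]
  · intro h
    ext y
    constructor
    · rintro ⟨⟨t, ht, rfl⟩, hy⟩
      rcases ht.1.eq_or_lt with rfl | h0
      · simp
      · rcases ht.2.eq_or_lt with rfl | h1
        · simp
        · exact absurd hy (h t ⟨h0, h1⟩)
    · rintro (rfl | rfl)
      · exact ⟨⟨0, by simp, by simp⟩, hx⟩
      · exact ⟨⟨1, by simp, by simp⟩, hx'⟩

lemma mem_body_of_mem_Φ {x : E3} (hx : x ∈ O.Φ) : x ∈ O.body :=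
  O.frontier_subset_body (O.Φ_subset_frontier hx)

lemma mem_body_of_mem_openTriangle {i : Fin O.N} {x : E3} (hx : x ∈ openTriangle (O.face i)) :
    x ∈ O.body := O.mem_body_of_mem_Φ (O.mem_Φ.2 ⟨i, hx⟩)

lemma eventually_ball (x v : E3) {r : ℝ} (hr : 0 < r) :
    ∀ᶠ t in 𝓝[>] (0 : ℝ), x + t • v ∈ Metric.ball x r := by
  have hc : Tendsto (fun t : ℝ => x + t • v) (𝓝 0) (𝓝 x) := by
    have : Continuous fun t : ℝ => x + t • v := by fun_prop
    simpa using this.tendsto 0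
  exact (hc.eventually (Metric.ball_mem_nhds x hr)).filter_mono nhdsWithin_le_nhds

lemma eventually_mem_body {i : Fin O.N} {x : E3} (hx : x ∈ openTriangle (O.face i)) {v : E3}
    (hv : ⟪O.normal i, v⟫_ℝ ≤ 0) : ∀ᶠ t in 𝓝[>] (0 : ℝ), x + t • v ∈ O.body := by
  obtain ⟨r, hr, hball⟩ := O.exists_ball_face hx
  filter_upwards [eventually_ball x v hr, self_mem_nhdsWithin] with t ht ht0
  have ht0' : 0 < t := ht0
  have hh : O.height i (x + t • v) = t * ⟪O.normal i, v⟫_ℝ := by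
    rw [height_add_smul, ((O.mem_openTriangle_iff i x).1 hx).1, zero_add]
  rcases hv.eq_or_lt with h0 | hlt
  · exact O.mem_body_of_mem_openTriangle ((hball _ ht).1 (by rw [hh, h0, mul_zero]))
  · exact (hball _ ht).2.2.2 (by rw [hh]; exact mul_neg_of_pos_of_neg ht0' hlt)

/-- Light reaches a face only from the outer side. -/
lemma inner_pos_of_lit {i : Fin O.N} {x : E3} (hx : x ∈ openTriangle (O.face i)) {u : E3}
    (h : O.Lit x u) : 0 < ⟪O.normal i, u⟫_ℝ := by
  by_contra hc
  obtain ⟨t, ht, ht0⟩ := ((O.eventually_mem_body hx (not_lt.1 hc)).and self_mem_nhdsWithin).exists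
  exact h t ht0 ht

lemma inner_pos_of_clear {i : Fin O.N} {x x' : E3} (hx : x ∈ openTriangle (O.face i))
    (h : O.Clear x x') : 0 < ⟪O.normal i, x' - x⟫_ℝ := by
  by_contra hc
  have h1 : ∀ᶠ t in 𝓝[>] (0 : ℝ), t < 1 := nhdsWithin_le_nhds (Iio_mem_nhds one_pos)
  obtain ⟨t, ⟨ht, ht1⟩, ht0⟩ :=
    (((O.eventually_mem_body hx (not_lt.1 hc)).and h1).and self_mem_nhdsWithin).exists
  refine h t ⟨ht0, ht1⟩ ?_
  rw [AffineMap.lineMap_apply]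
  simpa [add_comm] using ht

lemma measurable_normalAt : Measurable O.normalAt := by
  unfold normalAt
  refine Finset.measurable_sum _ fun i _ => ?_
  exact Measurable.ite (O.measurableSet_openTriangle i) measurable_const measurable_const

/-! ### The geometric part of the interreflection kernel -/

/-- The interreflection kernel without the factor `ρ / π`. -/
def formFactor (x x' : E3) : ℝ :=
  ⟪O.normalAt x', x - x'⟫_ℝ * ⟪O.normalAt x, x' - x⟫_ℝ / ‖x - x'‖ ^ 4 * O.ptVisible x x'

open Classical in
lemma formFactor_eq {x x' : E3} (hx : x ∈ O.body) (hx' : x' ∈ O.body) :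
    O.formFactor x x' = ⟪O.normalAt x', x - x'⟫_ℝ * ⟪O.normalAt x, x' - x⟫_ℝ / ‖x - x'‖ ^ 4 *
      if O.Clear x x' then 1 else 0 := by
  by_cases h : x = x'
  · subst h; simp [formFactor]
  · rw [formFactor, O.ptVisible_eq hx hx' h]

/-- A jointly measurable version of the form factor; both agree on the body. -/
lemma exists_measurable_formFactor : ∃ G : E3 × E3 → ℝ, Measurable G ∧
    ∀ x ∈ O.body, ∀ x' ∈ O.body, G (x, x') = O.formFactor x x' := by
  classical
  refine ⟨fun p => ⟪O.normalAt p.2, p.1 - p.2⟫_ℝ * ⟪O.normalAt p.1, p.2 - p.1⟫_ℝ /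
    ‖p.1 - p.2‖ ^ 4 * if O.Clear p.1 p.2 then 1 else 0, ?_,
    fun x hx x' hx' => (O.formFactor_eq hx hx').symm⟩
  have h1 : Measurable fun p : E3 × E3 => O.normalAt p.1 :=
    O.measurable_normalAt.comp measurable_fst
  have h2 : Measurable fun p : E3 × E3 => O.normalAt p.2 :=
    O.measurable_normalAt.comp measurable_snd
  refine Measurable.mul ?_ (Measurable.ite O.measurableSet_clear measurable_const measurable_const)
  fun_prop

lemma formFactor_nonneg {x x' : E3} (hx : x ∈ O.Φ) (hx' : x' ∈ O.Φ) : 0 ≤ O.formFactor x x' := by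
  rw [O.formFactor_eq (O.mem_body_of_mem_Φ hx) (O.mem_body_of_mem_Φ hx')]
  obtain ⟨i, hi⟩ := O.mem_Φ.1 hx
  obtain ⟨j, hj⟩ := O.mem_Φ.1 hx'
  rw [O.normalAt_eq hi, O.normalAt_eq hj]
  split_ifs with h
  · have h1 := O.inner_pos_of_clear hi h
    have h2 := O.inner_pos_of_clear hj (O.clear_comm.1 h)
    positivity
  · simp

lemma formFactor_comm {x x' : E3} (hx : x ∈ O.body) (hx' : x' ∈ O.body) :
    O.formFactor x x' = O.formFactor x' x := by
  rw [O.formFactor_eq hx hx', O.formFactor_eq hx' hx, norm_sub_rev x x',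
    mul_comm ⟪O.normalAt x', x - x'⟫_ℝ]
  by_cases h : O.Clear x x'
  · rw [if_pos h, if_pos (O.clear_comm.1 h)]
  · rw [if_neg h, if_neg fun h' => h (O.clear_comm.1 h')]

lemma ae_mem_Φ : ∀ᵐ x ∂O.surfaceMeasure, x ∈ O.Φ := by
  rw [surfaceMeasure_eq, ae_finsetSum_measure_iff]
  intro i _
  filter_upwards [ae_restrict_mem (O.measurableSet_openTriangle i)] with x hx
  exact O.mem_Φ.2 ⟨i, hx⟩

/-- The face `i` seen from a point `x` off its plane, in polar coordinates centred at `x`. -/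
lemma lintegral_face_eq_sphere (i : Fin O.N) {x : E3} {h : ℝ} (hh : h = -O.height i x)
    (hx : h ≠ 0) {F : E3 → ℝ≥0∞} (hF : Measurable F) :
    ∫⁻ w, F (‖O.facePoint i w - x‖⁻¹ • (O.facePoint i w - x)) *
        ENNReal.ofReal (|h| / ‖O.facePoint i w - x‖ ^ 3) =
      ∫⁻ u : S2, {y : E3 | 0 < h * ⟪O.normal i, y⟫_ℝ}.indicator F u ∂sphereMeasure := by
  have hs := lintegral_hemisphere (O.frame i) hF hx
  rw [frame_two] at hs
  rw [← hs]
  set b := O.frame i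
  set w₀ : ℝ × ℝ := (⟪b 0, (O.face i).points 0 - x⟫_ℝ, ⟪b 1, (O.face i).points 0 - x⟫_ℝ)
  have hw : ∀ w, O.facePoint i w - x = spaceParam b (h, w + w₀) := by
    intro w
    have hexp := b.sum_repr' ((O.face i).points 0 - x)
    rw [Fin.sum_univ_three] at hexp
    have e2 : ⟪b 2, (O.face i).points 0 - x⟫_ℝ = h := by
      rw [hh, O.frame_two, height, ← inner_neg_right, neg_sub]
    rw [e2] at hexp
    have : O.facePoint i w - x = ((O.face i).points 0 - x) + (w.1 • b 0 + w.2 • b 1) := by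
      simp only [facePoint, b]; abel
    rw [this, ← hexp]
    simp only [spaceParam, w₀, Prod.fst_add, Prod.snd_add]
    module
  simp_rw [hw]
  exact lintegral_add_right_eq_self (fun w => F (‖spaceParam b (h, w)‖⁻¹ • spaceParam b (h, w)) *
    ENNReal.ofReal (|h| / ‖spaceParam b (h, w)‖ ^ 3)) w₀

end TriangulatedObject

/-! ### The norm of the interreflection operator -/

namespace TriangulatedObject

variable (O : TriangulatedObject)

lemma lintegral_congr_Φ {F G : E3 → ℝ≥0∞} (h : ∀ x ∈ O.Φ, F x = G x) :
    ∫⁻ x, F x ∂O.surfaceMeasure = ∫⁻ x, G x ∂O.surfaceMeasure :=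
  lintegral_congr_ae (O.ae_mem_Φ.mono h)

/-- The directions from `x` in which the first obstacle lies on the open face `j`. -/
def seenFrom (x : E3) (j : Fin O.N) : Set E3 :=
  {u | x + (-O.height j x / ⟪O.normal j, u⟫_ℝ) • u ∈ openTriangle (O.face j) ∧
    O.Clear x (x + (-O.height j x / ⟪O.normal j, u⟫_ℝ) • u)}

lemma measurableSet_seenFrom (x : E3) (j : Fin O.N) : MeasurableSet (O.seenFrom x j) := by
  have hq : Measurable fun u : E3 => x + (-O.height j x / ⟪O.normal j, u⟫_ℝ) • u := by fun_prop
  refine (hq (O.measurableSet_openTriangle j)).inter ?_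
  exact (measurable_const.prodMk hq : Measurable fun u : E3 => (x, _)) O.measurableSet_clear

lemma inner_normalized (n p : E3) : ⟪n, ‖p‖⁻¹ • p⟫_ℝ = ⟪n, p⟫_ℝ / ‖p‖ := by
  rw [inner_smul_right, div_eq_inv_mul]

/-- The form factor from a point to a face is the integral of the cosine over the directions in
which the face is seen. -/
lemma lintegral_formFactor_face {i : Fin O.N} {x : E3} (hx : x ∈ openTriangle (O.face i))
    (j : Fin O.N) :
    ∫⁻ w, (openTriangle (O.face j)).indicator (fun x' => ENNReal.ofReal (O.formFactor x x'))
        (O.facePoint j w) ≤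
      ∫⁻ u : S2, {y : E3 | 0 < -O.height j x * ⟪O.normal j, y⟫_ℝ}.indicator
        ((O.seenFrom x j).indicator fun y => ENNReal.ofReal ⟪O.normal i, y⟫_ℝ) u
        ∂sphereMeasure := by
  classical
  have hxb := O.mem_body_of_mem_openTriangle hx
  -- In the plane of the face `j` the form factor vanishes.
  by_cases hh : O.height j x = 0
  · refine le_trans (le_of_eq ?_) zero_le
    rw [← lintegral_zero]
    refine lintegral_congr fun w => ?_
    by_cases hw : O.facePoint j w ∈ openTriangle (O.face j)
    · rw [indicator_of_mem hw, O.formFactor_eq hxb (O.mem_body_of_mem_openTriangle hw),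
        O.normalAt_eq hw, ← height_sub, hh, O.height_facePoint j w]
      simp
    · rw [indicator_of_notMem hw]
  · have hF : Measurable ((O.seenFrom x j).indicator fun y : E3 =>
        ENNReal.ofReal ⟪O.normal i, y⟫_ℝ) :=
      Measurable.indicator (by fun_prop) (O.measurableSet_seenFrom x j)
    rw [← O.lintegral_face_eq_sphere j rfl (neg_ne_zero.2 hh) hF]
    refine lintegral_mono fun w => ?_
    by_cases hw : O.facePoint j w ∈ openTriangle (O.face j)
    swap
    · rw [indicator_of_notMem hw]; exact zero_le
    rw [indicator_of_mem hw]
    set q := O.facePoint j w with hq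
    have hqb := O.mem_body_of_mem_openTriangle hw
    have hqh : O.height j q = 0 := O.height_facePoint j w
    rw [O.formFactor_eq hxb hqb, O.normalAt_eq hx, O.normalAt_eq hw]
    by_cases hc : O.Clear x q
    swap
    · rw [if_neg hc, mul_zero, ENNReal.ofReal_zero]; exact zero_le
    rw [if_pos hc, mul_one]
    have hne : q - x ≠ 0 := by
      intro h0
      rw [sub_eq_zero.1 h0] at hqh
      exact hh hqh
    have hn : 0 < ‖q - x‖ := norm_pos_iff.2 hne
    have hin : ⟪O.normal j, q - x⟫_ℝ = -O.height j x := by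
      rw [← height_sub, hqh]; ring
    have h1 := O.inner_pos_of_clear hx hc
    have h2 := O.inner_pos_of_clear hw (O.clear_comm.1 hc)
    have hin' : ⟪O.normal j, x - q⟫_ℝ = O.height j x := by
      rw [← neg_sub, inner_neg_right, hin, neg_neg]
    -- The direction from `x` to `q` meets the plane of the face `j` in `q`.
    have hback : x + (-O.height j x / ⟪O.normal j, ‖q - x‖⁻¹ • (q - x)⟫_ℝ) •
        (‖q - x‖⁻¹ • (q - x)) = q := by
      rw [inner_normalized, hin, smul_smul, div_div_eq_mul_div, mul_comm (-O.height j x),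
        mul_div_assoc, div_self (neg_ne_zero.2 hh), mul_one, mul_inv_cancel₀ hn.ne', one_smul,
        add_sub_cancel]
    have hmem : ‖q - x‖⁻¹ • (q - x) ∈ O.seenFrom x j := by
      simp only [seenFrom, mem_ofPred_eq]
      rw [hback]
      exact ⟨hw, hc⟩
    rw [indicator_of_mem hmem, inner_normalized, ← ENNReal.ofReal_mul (by positivity), hin',
      abs_neg, norm_sub_rev x q]
    refine ENNReal.ofReal_le_ofReal (le_of_eq ?_)
    rw [hin'] at h2
    rw [abs_of_pos h2]
    field_simp

/-- The directions in which different faces are seen first are different, and in none of them is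
there a free view. -/
lemma sum_indicator_seenFrom_le {x : E3} (u : E3) (c : ℝ≥0∞) :
    ∑ j, {y : E3 | 0 < -O.height j x * ⟪O.normal j, y⟫_ℝ}.indicator
        ((O.seenFrom x j).indicator fun _ => c) u +
      {y | O.Lit x y}.indicator (fun _ => c) u ≤ c := by
  classical
  set t : Fin O.N → ℝ := fun j => -O.height j x / ⟪O.normal j, u⟫_ℝ with ht
  set P : Fin O.N → Prop := fun j => 0 < -O.height j x * ⟪O.normal j, u⟫_ℝ ∧ u ∈ O.seenFrom x j
  have htpos : ∀ j, P j → 0 < t j := by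
    rintro j ⟨hj, _⟩
    rcases pos_and_pos_or_neg_and_neg_of_mul_pos hj with h | h
    · exact div_pos h.1 h.2
    · exact div_pos_of_neg_of_neg h.1 h.2
  have hbody : ∀ j, P j → x + t j • u ∈ O.body := fun j hj =>
    O.mem_body_of_mem_openTriangle hj.2.1
  have hterm : ∀ j, {y : E3 | 0 < -O.height j x * ⟪O.normal j, y⟫_ℝ}.indicator
        ((O.seenFrom x j).indicator fun _ => c) u = if P j then c else 0 := by
    intro j
    by_cases h1 : 0 < -O.height j x * ⟪O.normal j, u⟫_ℝ
    · rw [indicator_of_mem (show u ∈ {y : E3 | 0 < -O.height j x * ⟪O.normal j, y⟫_ℝ} from h1)]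
      by_cases h2 : u ∈ O.seenFrom x j
      · rw [indicator_of_mem h2, if_pos ⟨h1, h2⟩]
      · rw [indicator_of_notMem h2, if_neg fun h => h2 h.2]
    · rw [indicator_of_notMem (show u ∉ {y : E3 | 0 < -O.height j x * ⟪O.normal j, y⟫_ℝ} from h1),
        if_neg fun h => h1 h.1]
  simp_rw [hterm]
  -- If the face `k` is seen in direction `u`, no point of the body is nearer in this direction.
  have hlt : ∀ j k, P j → P k → ¬ t j < t k := by
    intro j k hj hk hjk
    have hc := hk.2.2
    have htk := htpos k hk
    refine hc (t j / t k) ⟨div_pos (htpos j hj) htk, (div_lt_one htk).2 hjk⟩ ?_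
    have : AffineMap.lineMap x (x + (-O.height k x / ⟪O.normal k, u⟫_ℝ) • u) (t j / t k) =
        x + t j • u := by
      rw [AffineMap.lineMap_apply, vsub_eq_sub, vadd_eq_add, add_sub_cancel_left, smul_smul,
        add_comm]
      congr 2
      exact div_mul_cancel₀ _ htk.ne'
    rw [this]
    exact hbody j hj
  have huniq : ∀ j k, P j → P k → j = k := by
    intro j k hj hk
    have htt : t j = t k := le_antisymm (not_lt.1 (hlt k j hk hj)) (not_lt.1 (hlt j k hj hk))
    have h1 : x + t j • u ∈ openTriangle (O.face j) := hj.2.1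
    have h2 : x + t k • u ∈ openTriangle (O.face k) := hk.2.1
    rw [htt] at h1
    exact O.eq_of_mem_openTriangle h1 h2
  by_cases hex : ∃ j, P j
  · obtain ⟨j, hj⟩ := hex
    have hnl : u ∉ {y | O.Lit x y} := fun h => h (t j) (htpos j hj) (hbody j hj)
    rw [indicator_of_notMem hnl, add_zero, Finset.sum_eq_single j]
    · rw [if_pos hj]
    · intro k _ hk
      exact if_neg fun h => hk (huniq k j h hj)
    · simp
  · push Not at hex
    rw [Finset.sum_eq_zero fun j _ => if_neg (hex j), zero_add]
    exact indicator_le_self' (fun _ _ => zero_le) u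

instance : IsFiniteMeasure sphereMeasure := by unfold sphereMeasure; infer_instance

lemma measurableSet_lit_right (x : E3) : MeasurableSet {u : E3 | O.Lit x u} :=
  (measurable_prodMk_left : Measurable fun u : E3 => (x, u)) O.measurableSet_lit

lemma sphere_ne_zero (u : S2) : (u : E3) ≠ 0 := by
  intro h
  have h1 : ‖(u : E3)‖ = 1 := norm_eq_of_mem_sphere u
  rw [h] at h1
  simp at h1

/-- The visibility as a Lebesgue integral, over the lit directions only. -/
lemma ofReal_visibility {i : Fin O.N} {x : E3} (hx : x ∈ openTriangle (O.face i)) :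
    ∫⁻ u : S2, {y | O.Lit x y}.indicator (fun y => ENNReal.ofReal ⟪O.normal i, y⟫_ℝ) u
      ∂sphereMeasure = ENNReal.ofReal (Real.pi * O.visibility x) ∧ 0 ≤ O.visibility x := by
  classical
  have hxb := O.mem_body_of_mem_openTriangle hx
  set F : S2 → ℝ := fun u => ⟪O.normal i, (u : E3)⟫_ℝ * if O.Lit x u then 1 else 0
  have hFm : Measurable F := by
    refine Measurable.mul (by fun_prop) (Measurable.ite ?_ measurable_const measurable_const)
    exact measurable_subtype_coe (O.measurableSet_lit_right x)
  have hF0 : ∀ u : S2, 0 ≤ F u := by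
    intro u
    simp only [F]
    split_ifs with h
    · rw [mul_one]; exact (O.inner_pos_of_lit hx h).le
    · simp
  have hF1 : ∀ u : S2, F u ≤ 1 := by
    intro u
    have h1 : ‖(u : E3)‖ = 1 := norm_eq_of_mem_sphere u
    have h2 := real_inner_le_norm (O.normal i) (u : E3)
    rw [O.norm_normal, h1] at h2
    simp only [F]
    split_ifs <;> linarith
  have hvis : Real.pi * O.visibility x = ∫ u : S2, F u ∂sphereMeasure := by
    have hset : MeasurableSet {u : S2 | 0 ≤ ⟪(u : E3), O.normalAt x⟫_ℝ} :=
      (isClosed_le continuous_const (by fun_prop)).measurableSet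
    rw [visibility, one_div, mul_inv_cancel_left₀ Real.pi_ne_zero, ← integral_indicator hset]
    refine integral_congr_ae (ae_of_all _ fun u => ?_)
    simp only [F]
    rw [O.normalAt_eq hx]
    by_cases hu : u ∈ {u : S2 | 0 ≤ ⟪(u : E3), O.normal i⟫_ℝ}
    · rw [indicator_of_mem hu, O.dirVisible_eq hxb (sphere_ne_zero u)]
    · rw [indicator_of_notMem hu, if_neg, mul_zero]
      intro hl
      refine hu ?_
      rw [mem_ofPred_eq, real_inner_comm]
      exact (O.inner_pos_of_lit hx hl).le
  have hint : Integrable F sphereMeasure := by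
    refine Integrable.of_bound hFm.aestronglyMeasurable 1 (ae_of_all _ fun u => ?_)
    rw [Real.norm_eq_abs, abs_of_nonneg (hF0 u)]
    exact hF1 u
  constructor
  · rw [hvis, ofReal_integral_eq_lintegral_ofReal hint (ae_of_all _ hF0)]
    refine lintegral_congr fun u => ?_
    simp only [F, indicator, mem_ofPred_eq]
    split_ifs <;> simp
  · have : 0 ≤ Real.pi * O.visibility x := by
      rw [hvis]; exact integral_nonneg hF0
    exact nonneg_of_mul_nonneg_right this Real.pi_pos

/-- Each direction of the upper hemisphere shows at most one point of the surface or the free sky,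
so that the form factors and the visibility share the total `π`. -/
lemma lintegral_formFactor_add {i : Fin O.N} {x : E3} (hx : x ∈ openTriangle (O.face i)) :
    ∫⁻ x', ENNReal.ofReal (O.formFactor x x') ∂O.surfaceMeasure +
      ENNReal.ofReal (Real.pi * O.visibility x) ≤ ENNReal.ofReal Real.pi := by
  have hxb := O.mem_body_of_mem_openTriangle hx
  obtain ⟨G, hG, hGF⟩ := O.exists_measurable_formFactor
  have hGm : Measurable fun x' => ENNReal.ofReal (G (x, x')) :=
    (hG.comp measurable_prodMk_left).ennreal_ofReal
  rw [O.lintegral_congr_Φ (G := fun x' => ENNReal.ofReal (G (x, x'))) fun x' hx' => by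
    rw [hGF x hxb x' (O.mem_body_of_mem_Φ hx')], O.lintegral_surfaceMeasure hGm]
  have hj : ∀ j, ∫⁻ w, (openTriangle (O.face j)).indicator (fun x' => ENNReal.ofReal (G (x, x')))
      (O.facePoint j w) ≤ ∫⁻ u : S2, {y : E3 | 0 < -O.height j x * ⟪O.normal j, y⟫_ℝ}.indicator
        ((O.seenFrom x j).indicator fun y => ENNReal.ofReal ⟪O.normal i, y⟫_ℝ) u
        ∂sphereMeasure := by
    intro j
    refine le_trans (le_of_eq ?_) (O.lintegral_formFactor_face hx j)
    refine lintegral_congr fun w => ?_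
    by_cases hw : O.facePoint j w ∈ openTriangle (O.face j)
    · rw [indicator_of_mem hw, indicator_of_mem hw,
        hGF x hxb _ (O.mem_body_of_mem_openTriangle hw)]
    · rw [indicator_of_notMem hw, indicator_of_notMem hw]
  have hm : ∀ j, Measurable fun u : S2 =>
      {y : E3 | 0 < -O.height j x * ⟪O.normal j, y⟫_ℝ}.indicator
        ((O.seenFrom x j).indicator fun y => ENNReal.ofReal ⟪O.normal i, y⟫_ℝ) (u : E3) := by
    intro j
    refine Measurable.comp (Measurable.indicator (Measurable.indicator (by fun_prop)
      (O.measurableSet_seenFrom x j)) ?_) measurable_subtype_coe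
    exact (isOpen_lt continuous_const (by fun_prop)).measurableSet
  refine (add_le_add_left (Finset.sum_le_sum fun j _ => hj j) _).trans ?_
  rw [← lintegral_finsetSum _ fun j _ => hm j, ← (O.ofReal_visibility hx).1,
    ← lintegral_add_left (Finset.measurable_sum _ fun j _ => hm j),
    ← lintegral_cos_sphereMeasure (O.norm_normal i)]
  refine lintegral_mono fun u => ?_
  have h := O.sum_indicator_seenFrom_le (x := x) (u : E3) (ENNReal.ofReal ⟪O.normal i, (u : E3)⟫_ℝ)
  refine le_trans (le_of_eq ?_) h
  simp only [indicator]

lemma visibility_le_one {x : E3} (hx : x ∈ O.Φ) : O.visibility x ≤ 1 := by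
  obtain ⟨i, hi⟩ := O.mem_Φ.1 hx
  have h := le_trans (self_le_add_left _ _) (O.lintegral_formFactor_add hi)
  rw [ENNReal.ofReal_le_ofReal_iff Real.pi_pos.le] at h
  nlinarith [Real.pi_pos]

lemma visibility_nonneg {x : E3} (hx : x ∈ O.Φ) : 0 ≤ O.visibility x := by
  obtain ⟨i, hi⟩ := O.mem_Φ.1 hx
  exact (O.ofReal_visibility hi).2

lemma minVisibility_le {x : E3} (hx : x ∈ O.Φ) : O.minVisibility ≤ O.visibility x :=
  csInf_le ⟨0, by rintro _ ⟨y, hy, rfl⟩; exact O.visibility_nonneg hy⟩ ⟨x, hx, rfl⟩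

lemma minVisibility_le_one : O.minVisibility ≤ 1 := by
  rcases O.Φ.eq_empty_or_nonempty with h | ⟨x, hx⟩
  · simp [minVisibility, h]
  · exact (O.minVisibility_le hx).trans (O.visibility_le_one hx)

/-- What is not visible of the sky is other points of the surface: the total form factor is at
most `π` minus the visibility. -/
lemma lintegral_formFactor_le {x : E3} (hx : x ∈ O.Φ) :
    ∫⁻ x', ENNReal.ofReal (O.formFactor x x') ∂O.surfaceMeasure ≤
      ENNReal.ofReal (Real.pi * (1 - O.minVisibility)) := by
  obtain ⟨i, hi⟩ := O.mem_Φ.1 hx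
  have h := O.lintegral_formFactor_add hi
  have h1 : ∫⁻ x', ENNReal.ofReal (O.formFactor x x') ∂O.surfaceMeasure ≤
      ENNReal.ofReal Real.pi - ENNReal.ofReal (Real.pi * O.visibility x) :=
    ENNReal.le_sub_of_add_le_right ENNReal.ofReal_ne_top h
  refine h1.trans ?_
  rw [← ENNReal.ofReal_sub _ (mul_nonneg Real.pi_pos.le (O.visibility_nonneg hx))]
  refine ENNReal.ofReal_le_ofReal ?_
  nlinarith [O.minVisibility_le hx, Real.pi_pos]

end TriangulatedObject

/-- The Cauchy-Schwarz inequality for the measure with density `k`. -/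
lemma sq_lintegral_mul_le {α : Type*} [MeasurableSpace α] {μ : Measure α} {k g : α → ℝ≥0∞}
    (hk : AEMeasurable k μ) (hg : AEMeasurable g μ) :
    (∫⁻ x, k x * g x ∂μ) ^ 2 ≤ (∫⁻ x, k x ∂μ) * ∫⁻ x, k x * g x ^ 2 ∂μ := by
  have h := ENNReal.lintegral_mul_le_Lp_mul_Lq μ Real.HolderConjugate.two_two
    (f := fun x => k x ^ (1 / 2 : ℝ)) (g := fun x => k x ^ (1 / 2 : ℝ) * g x)
    (hk.pow_const _) ((hk.pow_const _).mul hg)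
  have hsq : ∀ a : ℝ≥0∞, (a ^ (1 / 2 : ℝ)) ^ 2 = a := fun a => by
    rw [← ENNReal.rpow_two, ← ENNReal.rpow_mul]; norm_num
  simp only [Pi.mul_apply, ENNReal.rpow_two, mul_pow, hsq] at h
  have h2 := pow_le_pow_left' h 2
  rw [mul_pow, hsq, hsq] at h2
  refine le_trans (le_of_eq ?_) h2
  congr 1
  refine lintegral_congr fun x => ?_
  rw [← mul_assoc, ← sq, hsq]

/-- The Schur test for a nonnegative symmetric kernel. -/
lemma lintegral_sq_lintegral_mul_le {α : Type*} [MeasurableSpace α] {μ : Measure α} [SFinite μ]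
    {G : α × α → ℝ≥0∞} (hG : Measurable G) (hsymm : ∀ x y, G (x, y) = G (y, x)) {C : ℝ≥0∞}
    (hC : ∀ x, ∫⁻ y, G (x, y) ∂μ ≤ C) {g : α → ℝ≥0∞} (hg : Measurable g) :
    ∫⁻ x, (∫⁻ y, G (x, y) * g y ∂μ) ^ 2 ∂μ ≤ C ^ 2 * ∫⁻ y, g y ^ 2 ∂μ := by
  calc ∫⁻ x, (∫⁻ y, G (x, y) * g y ∂μ) ^ 2 ∂μ
      ≤ ∫⁻ x, C * ∫⁻ y, G (x, y) * g y ^ 2 ∂μ ∂μ := by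
        refine lintegral_mono fun x => ?_
        refine (sq_lintegral_mul_le (hG.comp measurable_prodMk_left).aemeasurable
          hg.aemeasurable).trans ?_
        exact mul_le_mul_left (hC x) _
    _ = C * ∫⁻ y, ∫⁻ x, G (x, y) * g y ^ 2 ∂μ ∂μ := by
        have hm : Measurable fun p : α × α => G p * g p.2 ^ 2 := by fun_prop
        rw [lintegral_const_mul _ hm.lintegral_prod_right',
          lintegral_lintegral_swap (f := fun x y => G (x, y) * g y ^ 2) hm.aemeasurable]
    _ ≤ C * ∫⁻ y, C * g y ^ 2 ∂μ := by
        gcongr with y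
        rw [lintegral_mul_const (f := fun x => G (x, y)) _ (hG.comp measurable_prodMk_right)]
        gcongr
        refine le_trans (le_of_eq ?_) (hC y)
        exact lintegral_congr fun x => hsymm x y
    _ = C ^ 2 * ∫⁻ y, g y ^ 2 ∂μ := by
        rw [lintegral_const_mul _ (by fun_prop), ← mul_assoc, sq]

lemma eLpNorm_two_sq {α : Type*} [MeasurableSpace α] {μ : Measure α} (f : α → ℝ) :
    eLpNorm f 2 μ ^ 2 = ∫⁻ x, ‖f x‖ₑ ^ 2 ∂μ := by
  rw [eLpNorm_eq_lintegral_rpow_enorm_toReal two_ne_zero ENNReal.ofNat_ne_top, ← ENNReal.rpow_two,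
    ← ENNReal.rpow_mul]
  norm_num

namespace TriangulatedObject

variable (O : TriangulatedObject)

lemma dist_facePoint (i : Fin O.N) (w : ℝ × ℝ) :
    ‖w‖ ≤ ‖O.facePoint i w - (O.face i).points 0‖ := by
  have h : ‖O.facePoint i w - (O.face i).points 0‖ ^ 2 = w.1 ^ 2 + w.2 ^ 2 := by
    rw [facePoint_sub, show (0, w) = ((0 : ℝ), (w.1, w.2)) from rfl, norm_sq_spaceParam]; ring
  rw [Prod.norm_def]
  refine max_le ?_ ?_ <;> rw [Real.norm_eq_abs] <;> refine abs_le_of_sq_le_sq ?_ (norm_nonneg _)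
    <;> rw [h] <;> nlinarith [sq_nonneg w.1, sq_nonneg w.2]

instance : IsFiniteMeasure O.surfaceMeasure := by
  rw [surfaceMeasure_eq]
  constructor
  rw [Measure.finsetSum_apply _ _ _]
  refine ENNReal.sum_lt_top.2 fun i _ => ?_
  rw [Measure.restrict_apply_univ, Measure.map_apply (O.continuous_facePoint i).measurable
    (O.measurableSet_openTriangle i)]
  refine Bornology.IsBounded.measure_lt_top ?_
  obtain ⟨R, hR⟩ := O.isCompact_body.isBounded.exists_norm_le
  refine isBounded_iff_forall_norm_le.2 ⟨R + ‖(O.face i).points 0‖, fun w hw => ?_⟩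
  refine (O.dist_facePoint i w).trans ((norm_sub_le _ _).trans ?_)
  gcongr
  exact hR _ (O.mem_body_of_mem_openTriangle hw)

/-- The form factor as a symmetric measurable kernel. -/
lemma exists_symm_formFactor : ∃ G : E3 × E3 → ℝ, Measurable G ∧ (∀ p, 0 ≤ G p) ∧
    (∀ x y, G (x, y) = G (y, x)) ∧ (∀ x ∈ O.Φ, ∀ y ∈ O.Φ, G (x, y) = O.formFactor x y) ∧
    ∀ x, ∫⁻ y, ENNReal.ofReal (G (x, y)) ∂O.surfaceMeasure ≤
      ENNReal.ofReal (Real.pi * (1 - O.minVisibility)) := by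
  classical
  obtain ⟨G, hG, hGF⟩ := O.exists_measurable_formFactor
  have hval : ∀ x ∈ O.Φ, ∀ y ∈ O.Φ, (O.Φ ×ˢ O.Φ).indicator G (x, y) = O.formFactor x y := by
    intro x hx y hy
    rw [indicator_of_mem (mk_mem_prod hx hy),
      hGF x (O.mem_body_of_mem_Φ hx) y (O.mem_body_of_mem_Φ hy)]
  refine ⟨(O.Φ ×ˢ O.Φ).indicator G, hG.indicator (O.measurableSet_Φ.prod O.measurableSet_Φ), ?_, ?_,
    hval, ?_⟩
  · rintro ⟨x, y⟩
    by_cases h : (x, y) ∈ O.Φ ×ˢ O.Φ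
    · rw [hval x h.1 y h.2]; exact O.formFactor_nonneg h.1 h.2
    · rw [indicator_of_notMem h]
  · intro x y
    by_cases h : x ∈ O.Φ ∧ y ∈ O.Φ
    · rw [hval x h.1 y h.2, hval y h.2 x h.1,
        O.formFactor_comm (O.mem_body_of_mem_Φ h.1) (O.mem_body_of_mem_Φ h.2)]
    · rw [indicator_of_notMem (fun h' => h ⟨h'.1, h'.2⟩),
        indicator_of_notMem (fun h' => h ⟨h'.2, h'.1⟩)]
  · intro x
    by_cases hx : x ∈ O.Φ
    · refine le_trans (le_of_eq ?_) (O.lintegral_formFactor_le hx)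
      exact O.lintegral_congr_Φ fun y hy => by rw [hval x hx y hy]
    · refine le_trans (le_of_eq ?_) zero_le
      rw [← lintegral_zero]
      refine lintegral_congr fun y => ?_
      rw [indicator_of_notMem (fun h => hx h.1), ENNReal.ofReal_zero]

end TriangulatedObject

namespace LambertianObject

variable (O : LambertianObject)

lemma albedo_le_maxAlbedo {x : E3} (hx : x ∈ frontier O.body) : O.albedo x ≤ O.maxAlbedo :=
  le_csSup ⟨1, by rintro _ ⟨y, hy, rfl⟩; exact O.albedo_le_one y hy⟩ ⟨x, hx, rfl⟩

lemma maxAlbedo_nonneg : 0 ≤ O.maxAlbedo :=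
  Real.sSup_nonneg (by rintro _ ⟨y, hy, rfl⟩; exact (O.albedo_pos y hy).le)

/-- The bound `ρ⋆ (1 - ν⋆)` for the norm of the interreflection operator. -/
def reflectivity : ℝ := O.maxAlbedo * (1 - O.minVisibility)

lemma reflectivity_nonneg : 0 ≤ O.reflectivity :=
  mul_nonneg O.maxAlbedo_nonneg (sub_nonneg.2 O.minVisibility_le_one)

lemma kernel_eq (x x' : E3) : O.kernel x x' = O.albedo x / Real.pi * O.formFactor x x' := by
  unfold kernel TriangulatedObject.formFactor; ring

/-- The interreflection integral converges almost everywhere and is bounded on `L²` by the Schur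
test: the form factors are symmetric, and their total is at most `π (1 - ν⋆)`. -/
lemma interreflect_spec (g : E3 → ℝ) (hg : StronglyMeasurable g)
    (hg2 : MemLp g 2 O.surfaceMeasure) :
    (∀ᵐ x ∂O.surfaceMeasure, x ∈ O.Φ →
      Integrable (fun x' => O.kernel x x' * g x') O.surfaceMeasure) ∧
    AEStronglyMeasurable (O.interreflect g) O.surfaceMeasure ∧
    eLpNorm (O.interreflect g) 2 O.surfaceMeasure ≤
      ENNReal.ofReal O.reflectivity * eLpNorm g 2 O.surfaceMeasure := by
  obtain ⟨G, hG, hG0, hsymm, hval, hle⟩ := O.exists_symm_formFactor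
  set μ := O.surfaceMeasure with hμ
  have hschur := lintegral_sq_lintegral_mul_le (μ := μ) (hG.ennreal_ofReal)
    (fun x y => by rw [hsymm]) hle hg.measurable.enorm
  rw [← eLpNorm_two_sq] at hschur
  have henorm : ∀ x y, ‖G (x, y) * g y‖ₑ = ENNReal.ofReal (G (x, y)) * ‖g y‖ₑ := by
    intro x y
    rw [enorm_mul, Real.enorm_eq_ofReal (hG0 _)]
  have hmeas : StronglyMeasurable fun p : E3 × E3 => G p * g p.2 :=
    (hG.mul (hg.measurable.comp measurable_snd)).stronglyMeasurable
  -- A function with finite integral is finite almost everywhere, so that the integrals of the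
  -- absolute values converge.
  have hfin : ∫⁻ x, (∫⁻ y, ENNReal.ofReal (G (x, y)) * ‖g y‖ₑ ∂μ) ^ 2 ∂μ ≠ ⊤ := by
    refine ne_top_of_le_ne_top ?_ hschur
    exact ENNReal.mul_ne_top (ENNReal.pow_ne_top ENNReal.ofReal_ne_top)
      (ENNReal.pow_ne_top hg2.eLpNorm_ne_top)
  have hmeas' : Measurable fun x => ∫⁻ y, ENNReal.ofReal (G (x, y)) * ‖g y‖ₑ ∂μ := by
    have h2 : Measurable fun p : E3 × E3 => ENNReal.ofReal (G p) * ‖g p.2‖ₑ :=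
      hG.ennreal_ofReal.mul (hg.measurable.comp measurable_snd).enorm
    exact h2.lintegral_prod_right'
  have hint : ∀ᵐ x ∂μ, Integrable (fun y => G (x, y) * g y) μ := by
    filter_upwards [ae_lt_top (hmeas'.pow_const 2) hfin] with x hx
    refine ⟨(hmeas.comp_measurable measurable_prodMk_left).aestronglyMeasurable, ?_⟩
    rw [HasFiniteIntegral]
    simp_rw [henorm]
    exact (ENNReal.pow_lt_top_iff (n := 2)).1 hx |>.resolve_right two_ne_zero
  have hker : ∀ x ∈ O.Φ, ∀ y ∈ O.Φ, O.kernel x y * g y =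
      O.albedo x / Real.pi * (G (x, y) * g y) := by
    intro x hx y hy
    rw [kernel_eq, hval x hx y hy]; ring
  have heq : O.interreflect g =ᵐ[μ] fun x => O.albedo x / Real.pi * ∫ y, G (x, y) * g y ∂μ := by
    filter_upwards [O.ae_mem_Φ] with x hx
    rw [interreflect, if_pos hx, ← integral_const_mul]
    exact integral_congr_ae (O.ae_mem_Φ.mono fun y hy => hker x hx y hy)
  refine ⟨?_, ?_, ?_⟩
  · filter_upwards [hint] with x hx hxΦ
    refine (hx.const_mul (O.albedo x / Real.pi)).congr ?_
    exact O.ae_mem_Φ.mono fun y hy => (hker x hxΦ y hy).symm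
  · refine AEStronglyMeasurable.congr ?_ heq.symm
    refine AEStronglyMeasurable.mul ?_ hmeas.integral_prod_right'.aestronglyMeasurable
    exact (O.aemeasurable_albedo.div_const _).aestronglyMeasurable
  · rw [eLpNorm_congr_ae heq]
    refine (ENNReal.pow_le_pow_left_iff two_ne_zero).1 ?_
    rw [eLpNorm_two_sq, mul_pow]
    have hbound : ∀ᵐ x ∂μ, ‖O.albedo x / Real.pi * ∫ y, G (x, y) * g y ∂μ‖ₑ ^ 2 ≤
        ENNReal.ofReal (O.maxAlbedo / Real.pi) ^ 2 *
          (∫⁻ y, ENNReal.ofReal (G (x, y)) * ‖g y‖ₑ ∂μ) ^ 2 := by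
      filter_upwards [O.ae_mem_Φ] with x hx
      have hxf := O.Φ_subset_frontier hx
      rw [enorm_mul, mul_pow]
      gcongr
      · rw [Real.enorm_eq_ofReal (div_nonneg (O.albedo_pos x hxf).le Real.pi_pos.le)]
        refine ENNReal.ofReal_le_ofReal ?_
        gcongr
        exact O.albedo_le_maxAlbedo hxf
      · refine (enorm_integral_le_lintegral_enorm _).trans (le_of_eq ?_)
        simp_rw [henorm]
    refine (lintegral_mono_ae hbound).trans ?_
    rw [lintegral_const_mul _ (hmeas'.pow_const 2)]
    refine (mul_le_mul_right hschur _).trans (le_of_eq ?_)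
    rw [← mul_assoc, ← mul_pow, ← ENNReal.ofReal_mul (div_nonneg O.maxAlbedo_nonneg Real.pi_pos.le),
      reflectivity]
    congr 3
    field_simp

lemma interreflect_congr {g g' : E3 → ℝ} (h : g =ᵐ[O.surfaceMeasure] g') :
    O.interreflect g = O.interreflect g' := by
  ext x
  unfold interreflect
  split_ifs
  · exact integral_congr_ae (h.mono fun y hy => by simp only [hy])
  · rfl

lemma interreflect_memLp (g : O.L2) : MemLp (O.interreflect g) 2 O.surfaceMeasure := by
  obtain ⟨-, h1, h2⟩ := O.interreflect_spec g (Lp.stronglyMeasurable g) (Lp.memLp g)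
  exact ⟨h1, h2.trans_lt (ENNReal.mul_lt_top ENNReal.ofReal_lt_top (Lp.memLp g).eLpNorm_lt_top)⟩

lemma exists_interreflect : ∃ A : O.L2 →L[ℝ] O.L2,
    (∀ g : O.L2, A g =ᵐ[O.surfaceMeasure] O.interreflect g) ∧ ‖A‖ ≤ O.reflectivity := by
  have hint := fun g : O.L2 => (O.interreflect_spec g (Lp.stronglyMeasurable g) (Lp.memLp g)).1
  let A₀ : O.L2 →ₗ[ℝ] O.L2 :=
    { toFun := fun g => (O.interreflect_memLp g).toLp _
      map_add' := by
        intro g h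
        rw [← MemLp.toLp_add, MemLp.toLp_eq_toLp_iff]
        filter_upwards [hint g, hint h, O.ae_mem_Φ] with x h1 h2 hx
        rw [O.interreflect_congr (Lp.coeFn_add g h)]
        simp only [interreflect, if_pos hx, Pi.add_apply, mul_add]
        exact integral_add (h1 hx) (h2 hx)
      map_smul' := by
        intro r g
        rw [RingHom.id_apply, ← MemLp.toLp_const_smul, MemLp.toLp_eq_toLp_iff]
        filter_upwards [O.ae_mem_Φ] with x hx
        rw [O.interreflect_congr (Lp.coeFn_smul r g)]
        simp only [interreflect, if_pos hx, Pi.smul_apply, smul_eq_mul, mul_left_comm _ r]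
        exact integral_const_mul _ _ }
  refine ⟨A₀.mkContinuous O.reflectivity fun g => ?_, fun g => ?_, ?_⟩
  · obtain ⟨-, -, h2⟩ := O.interreflect_spec g (Lp.stronglyMeasurable g) (Lp.memLp g)
    change ‖(O.interreflect_memLp g).toLp _‖ ≤ _
    rw [Lp.norm_toLp, Lp.norm_def, ← ENNReal.toReal_ofReal O.reflectivity_nonneg,
      ← ENNReal.toReal_mul]
    exact ENNReal.toReal_mono
      (ENNReal.mul_ne_top ENNReal.ofReal_ne_top (Lp.eLpNorm_ne_top g)) h2
  · exact (O.interreflect_memLp g).coeFn_toLp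
  · exact LinearMap.mkContinuous_norm_le _ O.reflectivity_nonneg _

lemma T_apply (g : O.L2) : O.T g =ᵐ[O.surfaceMeasure] O.interreflect g := by
  obtain ⟨A, hA, -⟩ := O.exists_interreflect
  have h : ∃ A : O.L2 →L[ℝ] O.L2, ∀ g : O.L2, A g =ᵐ[O.surfaceMeasure] O.interreflect g := ⟨A, hA⟩
  rw [T, dif_pos h]
  exact h.choose_spec g

lemma norm_T_le : ‖O.T‖ ≤ O.reflectivity := by
  obtain ⟨A, hA, hn⟩ := O.exists_interreflect
  have : O.T = A := by
    ext1 g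
    exact Lp.ext ((O.T_apply g).trans (hA g).symm)
  rwa [this]

lemma isUnit_one_sub_T (h : O.reflectivity < 1) : IsUnit (1 - O.T) :=
  isUnit_one_sub_of_norm_lt_one (O.norm_T_le.trans_lt h)

lemma norm_inverse_apply_le (h : O.reflectivity < 1) (g : O.L2) :
    ‖Ring.inverse (1 - O.T) g‖ ≤ ‖g‖ / (1 - O.reflectivity) := by
  have h1 : (1 - O.T) (Ring.inverse (1 - O.T) g) = g := by
    rw [← mul_apply_eq_comp, Ring.mul_inverse_cancel _ (O.isUnit_one_sub_T h)]
    rfl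
  set k := Ring.inverse (1 - O.T) g
  have h2 : k = g + O.T k := by
    rw [← h1]; simp
  have h3 : ‖k‖ ≤ ‖g‖ + O.reflectivity * ‖k‖ := by
    calc ‖k‖ = ‖g + O.T k‖ := by rw [← h2]
      _ ≤ ‖g‖ + ‖O.T k‖ := norm_add_le _ _
      _ ≤ _ := by gcongr; exact O.T.le_of_opNorm_le O.norm_T_le k
  rw [le_div_iff₀ (by linarith)]
  linarith

lemma T_nonneg {g : O.L2} (hg : 0 ≤ᵐ[O.surfaceMeasure] g) : 0 ≤ᵐ[O.surfaceMeasure] O.T g := by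
  filter_upwards [O.T_apply g, O.ae_mem_Φ] with x h1 hx
  rw [h1, interreflect, if_pos hx]
  refine integral_nonneg_of_ae ?_
  filter_upwards [hg, O.ae_mem_Φ] with y hy hyΦ
  rw [kernel_eq]
  exact mul_nonneg (mul_nonneg (div_nonneg (O.albedo_pos x (O.Φ_subset_frontier hx)).le
    Real.pi_pos.le) (O.formFactor_nonneg hx hyΦ)) hy

/-- The multiply reflected light is nonnegative, as the sum of a Neumann series. -/
lemma inverse_nonneg (h : O.reflectivity < 1) {g : O.L2} (hg : 0 ≤ g) :
    0 ≤ Ring.inverse (1 - O.T) g := by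
  have hpos : ∀ k : O.L2, 0 ≤ k → 0 ≤ O.T k := fun k hk =>
    (Lp.coeFn_nonneg _).1 (O.T_nonneg ((Lp.coeFn_nonneg _).2 hk))
  have hn := O.norm_T_le.trans_lt h
  have hs := summable_geometric_of_norm_lt_one (x := O.T) hn
  have h2 : HasSum (fun n => (O.T ^ n) g) ((∑' n, O.T ^ n) g) :=
    (ContinuousLinearMap.apply ℝ O.L2 g).hasSum hs.hasSum
  rw [NormedRing.inverse_one_sub _ hn]
  change 0 ≤ (∑' n, O.T ^ n) g
  refine h2.nonneg fun n => ?_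
  induction n with
  | zero => simpa using hg
  | succ n ih =>
    rw [pow_succ', mul_apply_eq_comp]
    exact hpos _ ih

end LambertianObject

/-! ### Direct illumination -/

namespace TriangulatedObject

variable (O : TriangulatedObject)

open Classical in
/-- The cosine of the angle of incidence of the light from direction `u`, or `0` in the shadow. -/
def litCos (x u : E3) : ℝ := max ⟪O.normalAt x, u⟫_ℝ 0 * if O.Lit x u then 1 else 0

lemma measurable_litCos : Measurable fun p : E3 × E3 => O.litCos p.1 p.2 := by
  classical
  have h1 : Measurable fun p : E3 × E3 => O.normalAt p.1 :=
    O.measurable_normalAt.comp measurable_fst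
  exact Measurable.mul (by fun_prop)
    (Measurable.ite O.measurableSet_lit measurable_const measurable_const)

lemma litCos_nonneg (x u : E3) : 0 ≤ O.litCos x u := by
  unfold litCos
  split_ifs <;> simp

lemma norm_normalAt_le (x : E3) : ‖O.normalAt x‖ ≤ 1 := by
  by_cases hx : x ∈ O.Φ
  · obtain ⟨i, hi⟩ := O.mem_Φ.1 hx
    rw [O.normalAt_eq hi, O.norm_normal]
  · rw [normalAt, Finset.sum_eq_zero, norm_zero]
    · exact zero_le_one
    · intro i _
      exact if_neg fun h => hx (O.mem_Φ.2 ⟨i, h⟩)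

lemma litCos_le_one (x : E3) (u : S2) : O.litCos x u ≤ 1 := by
  have h2 := real_inner_le_norm (O.normalAt x) (u : E3)
  rw [norm_eq_of_mem_sphere u, mul_one] at h2
  have h3 := h2.trans (O.norm_normalAt_le x)
  unfold litCos
  split_ifs <;> simp [h3]

end TriangulatedObject

namespace LambertianObject

variable (O : LambertianObject)

lemma directPoint_eq {u : E3} (hu : u ≠ 0) (x : E3) :
    O.directPoint u x = O.albedo x * O.litCos x u := by
  unfold directPoint TriangulatedObject.litCos
  by_cases hx : x ∈ O.Φ
  · rw [if_pos hx, O.dirVisible_eq (O.mem_body_of_mem_Φ hx) hu]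
    ring
  · have : O.normalAt x = 0 := Finset.sum_eq_zero fun i _ =>
      if_neg fun h => hx (O.mem_Φ.2 ⟨i, h⟩)
    rw [if_neg hx, this]
    simp

lemma directPoint_nonneg (u : S2) (x : E3) : 0 ≤ O.directPoint u x := by
  by_cases hx : x ∈ O.Φ
  · rw [O.directPoint_eq (TriangulatedObject.sphere_ne_zero u)]
    exact mul_nonneg (O.albedo_pos x (O.Φ_subset_frontier hx)).le (O.litCos_nonneg _ _)
  · rw [directPoint, if_neg hx]

lemma directPoint_le_one (u : S2) (x : E3) : O.directPoint u x ≤ 1 := by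
  by_cases hx : x ∈ O.Φ
  · have hf := O.Φ_subset_frontier hx
    rw [O.directPoint_eq (TriangulatedObject.sphere_ne_zero u)]
    exact mul_le_one₀ (O.albedo_le_one x hf) (O.litCos_nonneg _ _) (O.litCos_le_one _ _)
  · rw [directPoint, if_neg hx]
    exact zero_le_one

lemma memLp_directPoint (u : S2) : MemLp (O.directPoint u) 2 O.surfaceMeasure := by
  refine MemLp.of_bound ?_ 1 (ae_of_all _ fun x => ?_)
  · have h : O.directPoint u = fun x => O.albedo x * O.litCos x u :=
      funext (O.directPoint_eq (TriangulatedObject.sphere_ne_zero u))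
    rw [h]
    exact (O.aemeasurable_albedo.mul
      (O.measurable_litCos.comp measurable_prodMk_right).aemeasurable).aestronglyMeasurable
  · rw [Real.norm_eq_abs, abs_of_nonneg (O.directPoint_nonneg u x)]
    exact O.directPoint_le_one u x

lemma integrable_direct {f : S2 → ℝ} (hf : Integrable f sphereMeasure) (x : E3) :
    Integrable (fun u : S2 => O.directPoint u x * f u) sphereMeasure := by
  refine Integrable.bdd_mul (c := 1) hf ?_ (ae_of_all _ fun u => ?_)
  · have h : (fun u : S2 => O.directPoint u x) = fun u : S2 => O.albedo x * O.litCos x u :=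
      funext fun u => O.directPoint_eq (TriangulatedObject.sphere_ne_zero u) x
    rw [h]
    have hm : Measurable fun u : S2 => O.litCos x u :=
      O.measurable_litCos.comp
        (f := fun u : S2 => (x, (u : E3))) (measurable_const.prodMk measurable_subtype_coe)
    exact (hm.const_mul (O.albedo x)).aestronglyMeasurable
  · rw [Real.norm_eq_abs, abs_of_nonneg (O.directPoint_nonneg u x)]
    exact O.directPoint_le_one u x

lemma memLp_direct {f : S2 → ℝ} (hf : Integrable f sphereMeasure) :
    MemLp (O.direct f) 2 O.surfaceMeasure := by
  refine MemLp.of_bound ?_ (∫ u, ‖f u‖ ∂sphereMeasure) (ae_of_all _ fun x => ?_)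
  · obtain ⟨f', hf', hff'⟩ := hf.aestronglyMeasurable
    have h : O.direct f = fun x => O.albedo x * ∫ u : S2, O.litCos x u * f' u ∂sphereMeasure := by
      ext x
      rw [direct, ← integral_const_mul]
      refine integral_congr_ae (hff'.mono fun u hu => ?_)
      simp only [O.directPoint_eq (TriangulatedObject.sphere_ne_zero u) x, hu]
      ring
    rw [h]
    refine O.aemeasurable_albedo.aestronglyMeasurable.mul ?_
    have hm : Measurable fun p : E3 × S2 => O.litCos p.1 p.2 * f' p.2 :=
      (O.measurable_litCos.comp (measurable_fst.prodMk
        (measurable_subtype_coe.comp measurable_snd))).mul (hf'.measurable.comp measurable_snd)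
    exact hm.stronglyMeasurable.integral_prod_right'.aestronglyMeasurable
  · refine norm_integral_le_of_norm_le hf.norm (ae_of_all _ fun u => ?_)
    rw [norm_mul, Real.norm_eq_abs, abs_of_nonneg (O.directPoint_nonneg u x)]
    exact mul_le_of_le_one_left (norm_nonneg _) (O.directPoint_le_one u x)

end LambertianObject

/-! ### The image plane -/

lemma inner_e3 (x : E3) : ⟪e3, x⟫_ℝ = x 2 := by
  simp [e3, EuclideanSpace.inner_single_left]

lemma inner_e3_right (x : E3) : ⟪x, e3⟫_ℝ = x 2 := by
  rw [real_inner_comm, inner_e3]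

lemma norm_e3 : ‖e3‖ = 1 := by simp [e3]

namespace TriangulatedObject

variable (O : TriangulatedObject)

lemma depth_le {x : E3} (hx : x ∈ O.body) : O.depth ≤ x 2 := by
  rw [← inner_e3]
  refine csInf_le ?_ ⟨x, hx, rfl⟩
  exact (O.isCompact_body.image (by fun_prop : Continuous fun x => ⟪e3, x⟫_ℝ)).bddBelow

variable {O}

lemma zero_notMem_body (h : 0 < O.depth) : (0 : E3) ∉ O.body := by
  intro h0
  have := O.depth_le h0
  simp at this
  linarith

/-- Since the centre of projection is not in the body, visibility from it is a matter of the open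
segment. -/
lemma mem_visiblePart_iff (h : 0 < O.depth) {x : E3} :
    x ∈ Camera.visiblePart O ↔ x ∈ frontier O.body ∧ O.Clear x 0 := by
  refine and_congr_right fun hx => ?_
  have hxb := O.frontier_subset_body hx
  constructor
  · intro hs t ht hmem
    have h1 : AffineMap.lineMap x (0 : E3) t ∈ segment ℝ x 0 ∩ O.body := by
      refine ⟨?_, hmem⟩
      rw [segment_eq_image_lineMap]
      exact ⟨t, Ioo_subset_Icc_self ht, rfl⟩
    rw [hs, mem_singleton_iff, AffineMap.lineMap_apply, vsub_eq_sub, vadd_eq_add, zero_sub,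
      add_eq_right, smul_eq_zero, neg_eq_zero] at h1
    rcases h1 with h1 | h1
    · exact ht.1.ne' h1
    · exact zero_notMem_body h (h1 ▸ hxb)
  · intro hc
    refine Subset.antisymm ?_ (singleton_subset_iff.2 ⟨left_mem_segment ℝ x 0, hxb⟩)
    rintro y ⟨hy, hyb⟩
    rw [segment_eq_image_lineMap] at hy
    obtain ⟨t, ht, rfl⟩ := hy
    rcases eq_or_lt_of_le ht.1 with h0 | h0
    · rw [← h0, AffineMap.lineMap_apply_zero]; rfl
    rcases eq_or_lt_of_le ht.2 with h1 | h1
    · rw [h1, AffineMap.lineMap_apply_one] at hyb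
      exact absurd hyb (zero_notMem_body h)
    · exact absurd hyb (hc t ⟨h0, h1⟩)

/-- The point in which the line of sight `ℝ u` from the centre of projection meets the plane of
the face `j`. -/
def sightPoint (O : TriangulatedObject) (j : Fin O.N) (u : E3) : E3 :=
  (-O.height j 0 / ⟪O.normal j, u⟫_ℝ) • u

lemma measurable_sightPoint (j : Fin O.N) : Measurable (O.sightPoint j) := by
  unfold sightPoint; fun_prop

lemma mem_seenFrom_zero {j : Fin O.N} {u : E3} : u ∈ O.seenFrom 0 j ↔
    O.sightPoint j u ∈ openTriangle (O.face j) ∧ O.Clear 0 (O.sightPoint j u) := by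
  simp only [seenFrom, sightPoint, zero_add, mem_ofPred_eq]

lemma sightPoint_smul (j : Fin O.N) {r : ℝ} (hr : r ≠ 0) (u : E3) :
    O.sightPoint j (r • u) = O.sightPoint j u := by
  rw [sightPoint, sightPoint, inner_smul_right, smul_smul]
  congr 1
  by_cases h : ⟪O.normal j, u⟫_ℝ = 0
  · simp [h]
  · field_simp

lemma inner_normal_of_height_eq_zero {j : Fin O.N} {x : E3} (hx : O.height j x = 0) :
    ⟪O.normal j, x⟫_ℝ = -O.height j 0 := by
  have := O.height_sub j x 0
  rw [hx, sub_zero] at this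
  linarith

lemma sightPoint_self {j : Fin O.N} (hj : O.height j 0 ≠ 0) {x : E3} (hx : O.height j x = 0) :
    O.sightPoint j x = x := by
  rw [sightPoint, inner_normal_of_height_eq_zero hx, div_self (neg_ne_zero.2 hj), one_smul]

end TriangulatedObject

namespace Camera

open TriangulatedObject

variable {m : ℕ} (c : Camera m) {O : TriangulatedObject}

/-- The direction in which one looks to see what is imaged at `z`. -/
def sight (z : E2) : E3 := -c.imagePoint z

lemma sight_apply_zero (z : E2) : c.sight z 0 = -z 0 := by simp [sight, imagePoint]
lemma sight_apply_one (z : E2) : c.sight z 1 = -z 1 := by simp [sight, imagePoint]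
lemma sight_apply_two (z : E2) : c.sight z 2 = c.focal := by simp [sight, imagePoint]

lemma sight_ne_zero (z : E2) : c.sight z ≠ 0 := by
  intro h
  have := c.sight_apply_two z
  rw [h] at this
  exact c.focal_pos.ne this

lemma inner_sight (ν : E3) (z : E2) :
    ⟪ν, c.sight z⟫_ℝ = -(ν 0 * z 0) - ν 1 * z 1 + ν 2 * c.focal := by
  rw [PiLp.inner_apply, Fin.sum_univ_three, sight_apply_zero, sight_apply_one, sight_apply_two]
  simp
  ring

lemma measurable_sight : Measurable c.sight := by
  have h : Continuous c.sight := by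
    refine (PiLp.continuous_toLp 2 _).comp ?_ |>.neg
    refine continuous_pi fun i => ?_
    fin_cases i <;> simp <;> fun_prop
  exact h.measurable

lemma sight_proj {x : E3} (hx : x 2 ≠ 0) : c.sight (c.proj x) = (c.focal / x 2) • x := by
  ext i
  fin_cases i
  · simp [sight, imagePoint, proj, inner_e3_right]; field_simp
  · simp [sight, imagePoint, proj, inner_e3_right]; field_simp
  · simp [sight, imagePoint]; field_simp

lemma proj_smul_sight {t : ℝ} (ht : t ≠ 0) (z : E2) : c.proj (t • c.sight z) = z := by
  have hf := c.focal_pos.ne'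
  ext i
  fin_cases i
  · simp [proj, inner_e3_right, sight_apply_zero, sight_apply_two]; field_simp
  · simp [proj, inner_e3_right, sight_apply_one, sight_apply_two]; field_simp

/-- A body in front of the camera cannot be seen twice at the same place. -/
lemma injOn_proj (h : 0 < O.depth) : InjOn c.proj (visiblePart O) := by
  have key : ∀ x ∈ visiblePart O, ∀ y ∈ visiblePart O, c.proj x = c.proj y → ¬ x 2 < y 2 := by
    intro x hx y hy hxy hlt
    rw [mem_visiblePart_iff h] at hx hy
    have hx2 : 0 < x 2 := h.trans_le (O.depth_le (O.frontier_subset_body hx.1))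
    have hy2 : 0 < y 2 := hx2.trans hlt
    have h1 := congrArg c.sight hxy
    rw [c.sight_proj hx2.ne', c.sight_proj hy2.ne'] at h1
    have h2 : x = (x 2 / y 2) • y := by
      have h3 := congrArg (fun v => (x 2 / c.focal) • v) h1
      simp only [smul_smul] at h3
      have hf := c.focal_pos.ne'
      rw [show x 2 / c.focal * (c.focal / x 2) = 1 by field_simp, one_smul,
        show x 2 / c.focal * (c.focal / y 2) = x 2 / y 2 by field_simp] at h3
      exact h3
    refine hy.2 (1 - x 2 / y 2) ⟨sub_pos.2 ((div_lt_one hy2).2 hlt),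
      sub_lt_self _ (div_pos hx2 hy2)⟩ ?_
    have h4 : AffineMap.lineMap y (0 : E3) (1 - x 2 / y 2) = x := by
      rw [AffineMap.lineMap_apply, vsub_eq_sub, vadd_eq_add]
      conv_rhs => rw [h2]
      module
    rw [h4]
    exact O.frontier_subset_body hx.1
  intro x hx y hy hxy
  have he : x 2 = y 2 :=
    le_antisymm (not_lt.1 (key y hy x hx hxy.symm)) (not_lt.1 (key x hx y hy hxy))
  have hx2 : 0 < x 2 :=
    h.trans_le (O.depth_le (O.frontier_subset_body ((mem_visiblePart_iff h).1 hx).1))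
  have h1 := congrArg c.sight hxy
  rw [c.sight_proj hx2.ne', c.sight_proj (he ▸ hx2.ne'), he] at h1
  exact smul_right_injective _ (div_pos c.focal_pos (he ▸ hx2)).ne' h1

variable (O) in
/-- The part of the image plane in which the open face `j` is seen. -/
def faceImage (j : Fin O.N) : Set E2 :=
  {z | 0 < -O.height j 0 * ⟪O.normal j, c.sight z⟫_ℝ ∧ c.sight z ∈ O.seenFrom 0 j}

lemma measurableSet_faceImage (j : Fin O.N) : MeasurableSet (c.faceImage O j) := by
  have h := c.measurable_sight
  have hm : Measurable fun z => -O.height j 0 * ⟪O.normal j, c.sight z⟫_ℝ := by fun_prop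
  refine MeasurableSet.inter (measurableSet_lt measurable_const hm) ?_
  exact h (O.measurableSet_seenFrom 0 j)

lemma sightPoint_mem_visiblePart (h : 0 < O.depth) {j : Fin O.N} {z : E2}
    (hz : z ∈ c.faceImage O j) : O.sightPoint j (c.sight z) ∈ visiblePart O ∧
      c.proj (O.sightPoint j (c.sight z)) = z := by
  obtain ⟨h1, h2⟩ := hz
  rw [mem_seenFrom_zero] at h2
  refine ⟨(mem_visiblePart_iff h).2
    ⟨O.openTriangle_subset_frontier j h2.1, O.clear_comm.1 h2.2⟩, ?_⟩
  refine c.proj_smul_sight (div_ne_zero ?_ ?_) z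
  · intro h0; simp [h0] at h1
  · intro h0; simp [h0] at h1

lemma invFunOn_proj_eq (h : 0 < O.depth) {j : Fin O.N} {z : E2} (hz : z ∈ c.faceImage O j) :
    Function.invFunOn c.proj (visiblePart O) z = O.sightPoint j (c.sight z) := by
  obtain ⟨h1, h2⟩ := c.sightPoint_mem_visiblePart h hz
  have := (c.injOn_proj h).leftInvOn_invFunOn h1
  rwa [h2] at this

/-- Planes through the centre of projection are imaged to null sets. -/
lemma volume_inner_sight_eq_zero {ν : E3} (hν : ν ≠ 0) :
    volume {z : E2 | ⟪ν, c.sight z⟫_ℝ = 0} = 0 := by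
  let s : AffineSubspace ℝ E2 :=
    { carrier := {z : E2 | ⟪ν, c.sight z⟫_ℝ = 0}
      smul_vsub_vadd_mem' := by
        intro t p q r hp hq hr
        simp only [mem_ofPred_eq, inner_sight] at *
        simp only [vsub_eq_sub, vadd_eq_add, PiLp.add_apply, PiLp.smul_apply, PiLp.sub_apply,
          smul_eq_mul]
        linear_combination t * hp - t * hq + hr }
  refine Measure.addHaar_affineSubspace volume s fun hs => hν ?_
  have hall : ∀ z : E2, ⟪ν, c.sight z⟫_ℝ = 0 := fun z => by
    have : z ∈ s := hs ▸ AffineSubspace.mem_top ℝ E2 z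
    exact this
  simp only [inner_sight] at hall
  have h0 := hall 0
  have h1 := hall (EuclideanSpace.single 0 1)
  have h2 := hall (EuclideanSpace.single 1 1)
  have hf := c.focal_pos.ne'
  simp at h0 h1 h2
  have h2z := h0.resolve_right hf
  rw [h2z] at h1 h2
  simp at h1 h2
  ext i
  fin_cases i
  · simpa using h1
  · simpa using h2
  · simpa using h2z

lemma exists_orthogonal_pair (p q : E3) : ∃ ν : E3, ν ≠ 0 ∧ ⟪ν, p⟫_ℝ = 0 ∧ ⟪ν, q⟫_ℝ = 0 := by
  have hlt : Submodule.span ℝ ({p, q} : Set E3) ≠ ⊤ := by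
    intro h
    have h1 := finrank_span_le_card (R := ℝ) ({p, q} : Set E3)
    rw [h, finrank_top, finrank_euclideanSpace_fin] at h1
    have h2 : ({p, q} : Set E3).toFinset.card ≤ 2 := by
      rw [Set.toFinset_insert, Set.toFinset_singleton]; exact Finset.card_le_two
    omega
  obtain ⟨ν, hν, hν0⟩ := Submodule.exists_mem_ne_zero_of_ne_bot
    (mt (Submodule.orthogonal_eq_bot_iff).1 hlt)
  rw [Submodule.mem_orthogonal'] at hν
  exact ⟨ν, hν0, hν p (Submodule.subset_span (by simp)), hν q (Submodule.subset_span (by simp))⟩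

/-- Almost everywhere, what is seen is a point in the relative interior of a face. -/
lemma image_visiblePart_ae_eq (h : 0 < O.depth) :
    c.proj '' visiblePart O =ᵐ[volume] ⋃ j, c.faceImage O j := by
  choose ν hν0 hνp hνq using exists_orthogonal_pair
  have hsub : (⋃ j, c.faceImage O j) ⊆ c.proj '' visiblePart O := by
    refine iUnion_subset fun j z hz => ?_
    obtain ⟨h1, h2⟩ := c.sightPoint_mem_visiblePart h hz
    exact ⟨_, h1, h2⟩
  -- The exceptions are the faces seen edge-on and the edges; all of these lie in planes through
  -- the centre of projection.
  have hcover : c.proj '' visiblePart O ⊆ (⋃ j, c.faceImage O j) ∪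
      ((⋃ j, {z | ⟪O.normal j, c.sight z⟫_ℝ = 0}) ∪ ⋃ i, ⋃ k : Fin 3,
        {z | ⟪ν ((O.face i).points (k + 1)) ((O.face i).points (k + 2)), c.sight z⟫_ℝ = 0}) := by
    rintro _ ⟨x, hx, rfl⟩
    obtain ⟨hxf, hxc⟩ := (mem_visiblePart_iff h).1 hx
    have hx2 : 0 < x 2 := h.trans_le (O.depth_le (O.frontier_subset_body hxf))
    have hfx := div_pos c.focal_pos hx2
    by_cases hΦ : x ∈ O.Φ
    · obtain ⟨j, hj⟩ := O.mem_Φ.1 hΦ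
      have hh := ((O.mem_openTriangle_iff j x).1 hj).1
      have hin := inner_normal_of_height_eq_zero hh
      by_cases h0 : O.height j 0 = 0
      · refine Or.inr (Or.inl (mem_iUnion.2 ⟨j, ?_⟩))
        rw [mem_ofPred_eq, c.sight_proj hx2.ne', inner_smul_right, hin, h0]
        simp
      · refine Or.inl (mem_iUnion.2 ⟨j, ?_, ?_⟩)
        · rw [c.sight_proj hx2.ne', inner_smul_right, hin]
          have : 0 < O.height j 0 * O.height j 0 := mul_self_pos.2 h0
          nlinarith [mul_pos hfx this]
        · rw [c.sight_proj hx2.ne', mem_seenFrom_zero, sightPoint_smul _ hfx.ne',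
            sightPoint_self h0 hh]
          exact ⟨hj, O.clear_comm.1 hxc⟩
    · obtain ⟨i, k, hik⟩ := O.mem_edge_of_mem_frontier hxf hΦ
      refine Or.inr (Or.inr (mem_iUnion₂.2 ⟨i, k, ?_⟩))
      obtain ⟨a, b, -, -, -, rfl⟩ := hik
      rw [mem_ofPred_eq, c.sight_proj hx2.ne', inner_smul_right, inner_add_right,
        inner_smul_right, inner_smul_right, hνp, hνq]
      simp
  refine (ae_eq_set.2 ⟨measure_mono_null (sdiff_subset_iff.2 hcover) ?_, ?_⟩)
  · refine measure_union_null (measure_iUnion_null fun j => ?_)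
      (measure_iUnion_null fun i => measure_iUnion_null fun k => ?_)
    · refine c.volume_inner_sight_eq_zero fun h0 => ?_
      have := O.norm_normal j
      rw [h0, norm_zero] at this
      exact zero_ne_one this
    · exact c.volume_inner_sight_eq_zero (hν0 _ _)
  · rw [sdiff_eq_empty.2 hsub, measure_empty]

end Camera

/-! ### The sensor as a bounded operator -/

namespace Camera

open TriangulatedObject

variable {m : ℕ} (c : Camera m) {O : TriangulatedObject}

/-- The factor `cos⁴` of the irradiance equation. -/
def cosFour (z : E2) : ℝ := ⟪(‖c.imagePoint z‖⁻¹ : ℝ) • c.imagePoint z, e3⟫_ℝ ^ 4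

lemma norm_imagePoint (z : E2) : ‖c.imagePoint z‖ = ‖c.sight z‖ := by rw [sight, norm_neg]

lemma norm_sight_pos (z : E2) : 0 < ‖c.sight z‖ := norm_pos_iff.2 (c.sight_ne_zero z)

lemma cosFour_eq (z : E2) : c.cosFour z = (c.focal / ‖c.sight z‖) ^ 4 := by
  rw [cosFour, inner_smul_left, norm_imagePoint, inner_e3_right]
  simp only [imagePoint]
  simp
  ring

lemma cosFour_pos (z : E2) : 0 < c.cosFour z := by
  rw [cosFour_eq]
  have := c.norm_sight_pos z
  have := c.focal_pos
  positivity

lemma measurable_cosFour : Measurable c.cosFour := by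
  have h : c.cosFour = fun z => (c.focal / ‖c.sight z‖) ^ 4 := funext c.cosFour_eq
  rw [h]
  have := c.measurable_sight
  fun_prop

lemma lintegral_imagePlane (F : E2 → ℝ≥0∞) (hF : Measurable F) :
    ∫⁻ z, F z = ∫⁻ w : ℝ × ℝ, F (!₂[-w.1, -w.2]) := by
  have h1 := PiLp.volume_preserving_toLp (Fin 2)
  have h2 := (volume_preserving_finTwoArrow ℝ).symm
  rw [← h1.lintegral_comp hF, ← h2.lintegral_comp (f := fun a => F (WithLp.toLp 2 a))
    (hF.comp h1.measurable), ← lintegral_neg_eq_self]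
  refine lintegral_congr fun w => ?_
  congr 2

lemma sight_eq_spaceParam (w : ℝ × ℝ) : c.sight (!₂[-w.1, -w.2]) =
    spaceParam (EuclideanSpace.basisFun (Fin 3) ℝ) (c.focal, w) := by
  ext i
  fin_cases i
  · simp [sight, imagePoint, spaceParam]
  · simp [sight, imagePoint, spaceParam]
  · simp [sight, imagePoint, spaceParam]

/-- The part of the sensor in which a face is seen, and the visible part of this face, are related
by central projection to the same set of directions. As the solid angle of a piece of a surface at
distance `d` is at most `d⁻²` times its area, integrals over the sensor are bounded by integrals
over the face. -/
lemma lintegral_faceImage_le (h : 0 < O.depth) (j : Fin O.N) {F : E3 → ℝ≥0∞} (hF : Measurable F) :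
    ∫⁻ z in c.faceImage O j, F (O.sightPoint j (c.sight z)) * ENNReal.ofReal (c.cosFour z ^ 2) ≤
      ENNReal.ofReal (c.focal ^ 2 / O.depth ^ 2) *
        ∫⁻ w, (openTriangle (O.face j)).indicator F (O.facePoint j w) := by
  by_cases h0 : O.height j 0 = 0
  · have : c.faceImage O j = ∅ := by
      refine eq_empty_of_forall_notMem fun z hz => ?_
      have := hz.1
      simp [h0] at this
    rw [this]; simp
  set b := EuclideanSpace.basisFun (Fin 3) ℝ
  have hb2 : ∀ y : E3, ⟪b 2, y⟫_ℝ = y 2 := fun y => by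
    simp [b, EuclideanSpace.inner_single_left]
  -- Both sides are integrals over directions. The power `5` of the cosine is the power `8` of the
  -- weight, less the power `3` in the density of the solid angle in the image plane.
  set H₀ : E3 → ℝ≥0∞ := (O.seenFrom 0 j).indicator fun y =>
    F (O.sightPoint j y) * ENNReal.ofReal (c.focal ^ 2 * (⟪b 2, y⟫_ℝ) ^ 5) with hH₀
  have hq := O.measurable_sightPoint j
  have hH₀m : Measurable H₀ :=
    Measurable.indicator ((hF.comp hq).mul (by fun_prop)) (O.measurableSet_seenFrom 0 j)
  set A : Set E3 := {y | 0 < -O.height j 0 * ⟪O.normal j, y⟫_ℝ} with hA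
  have hAm : MeasurableSet A := (isOpen_lt continuous_const (by fun_prop)).measurableSet
  have hs := c.measurable_sight
  have hc := c.measurable_cosFour
  have hfp := c.focal_pos
  have hscale : ∀ r : ℝ, 0 < r → ∀ y, A.indicator H₀ (r • y) = A.indicator
      ((O.seenFrom 0 j).indicator fun y => F (O.sightPoint j y) *
        ENNReal.ofReal (c.focal ^ 2 * (r * ⟪b 2, y⟫_ℝ) ^ 5)) y := by
    intro r hr y
    have e1 : r • y ∈ A ↔ y ∈ A := by
      simp only [hA, mem_ofPred_eq, inner_smul_right]
      rw [mul_left_comm]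
      exact mul_pos_iff_of_pos_left hr
    have e2 : r • y ∈ O.seenFrom 0 j ↔ y ∈ O.seenFrom 0 j := by
      rw [mem_seenFrom_zero, mem_seenFrom_zero, O.sightPoint_smul j hr.ne']
    by_cases h1 : y ∈ A
    · rw [indicator_of_mem h1, indicator_of_mem (e1.2 h1), hH₀]
      by_cases h2 : y ∈ O.seenFrom 0 j
      · rw [indicator_of_mem h2, indicator_of_mem (e2.2 h2), O.sightPoint_smul j hr.ne',
          inner_smul_right]
      · rw [indicator_of_notMem h2, indicator_of_notMem (mt e2.1 h2)]
    · rw [indicator_of_notMem h1, indicator_of_notMem (mt e1.1 h1)]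
  calc ∫⁻ z in c.faceImage O j, F (O.sightPoint j (c.sight z)) * ENNReal.ofReal (c.cosFour z ^ 2)
      = ∫⁻ w : ℝ × ℝ, A.indicator H₀ (‖spaceParam b (c.focal, w)‖⁻¹ • spaceParam b (c.focal, w)) *
          ENNReal.ofReal (|c.focal| / ‖spaceParam b (c.focal, w)‖ ^ 3) := by
        rw [← lintegral_indicator (c.measurableSet_faceImage j), lintegral_imagePlane]
        · refine lintegral_congr fun w => ?_
          rw [← c.sight_eq_spaceParam]
          set z : E2 := !₂[-w.1, -w.2]
          have hpos := c.norm_sight_pos z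
          rw [hscale _ (inv_pos.2 hpos)]
          by_cases hz : z ∈ c.faceImage O j
          · rw [indicator_of_mem hz, indicator_of_mem (show c.sight z ∈ A from hz.1),
              indicator_of_mem hz.2, hb2, sight_apply_two, mul_assoc,
              ← ENNReal.ofReal_mul (by positivity), cosFour_eq, abs_of_pos hfp]
            congr 2
            field_simp
          · rw [indicator_of_notMem hz]
            by_cases h1 : c.sight z ∈ A
            · rw [indicator_of_mem h1, indicator_of_notMem fun h2 => hz ⟨h1, h2⟩, zero_mul]
            · rw [indicator_of_notMem h1, zero_mul]
        · refine Measurable.indicator ?_ (c.measurableSet_faceImage j)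
          exact (hF.comp (hq.comp hs)).mul (hc.pow_const 2).ennreal_ofReal
    _ ≤ ∫⁻ u : S2, A.indicator H₀ u ∂sphereMeasure := by
        rw [lintegral_hemisphere b (hH₀m.indicator hAm) hfp.ne']
        exact lintegral_mono fun u => indicator_le_self' (fun _ _ => zero_le) _
    _ = ∫⁻ w, H₀ (‖O.facePoint j w - 0‖⁻¹ • (O.facePoint j w - 0)) *
          ENNReal.ofReal (|-O.height j 0| / ‖O.facePoint j w - 0‖ ^ 3) :=
        (O.lintegral_face_eq_sphere j rfl (neg_ne_zero.2 h0) hH₀m).symm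
    _ ≤ ∫⁻ w, ENNReal.ofReal (c.focal ^ 2 / O.depth ^ 2) *
          (openTriangle (O.face j)).indicator F (O.facePoint j w) := by
        refine lintegral_mono fun w => ?_
        rw [sub_zero]
        set x := O.facePoint j w
        have hx0 : O.height j x = 0 := O.height_facePoint j w
        have hin := inner_normal_of_height_eq_zero hx0
        have hxne : x ≠ 0 := fun hx => by
          rw [hx, inner_zero_right] at hin
          exact neg_ne_zero.2 h0 hin.symm
        have hxn := norm_pos_iff.2 hxne
        by_cases hmem : ‖x‖⁻¹ • x ∈ O.seenFrom 0 j
        swap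
        · simp only [hH₀, indicator_of_notMem hmem, zero_mul]; exact zero_le
        simp only [hH₀, indicator_of_mem hmem]
        rw [mem_seenFrom_zero, O.sightPoint_smul j (inv_pos.2 hxn).ne', sightPoint_self h0 hx0]
          at hmem
        rw [indicator_of_mem hmem.1, O.sightPoint_smul j (inv_pos.2 hxn).ne',
          sightPoint_self h0 hx0, mul_assoc, mul_comm, inner_smul_right, hb2]
        gcongr
        have hx2 := O.depth_le (O.mem_body_of_mem_openTriangle hmem.1)
        have hx2' : 0 < x 2 := h.trans_le hx2
        have hx2n : x 2 ≤ ‖x‖ := by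
          have := real_inner_le_norm e3 x
          rwa [inner_e3, norm_e3, one_mul] at this
        have hle : |-O.height j 0| ≤ ‖x‖ := by
          rw [← hin]
          have := abs_real_inner_le_norm (O.normal j) x
          rwa [O.norm_normal, one_mul] at this
        rw [← ENNReal.ofReal_mul (by positivity)]
        refine ENNReal.ofReal_le_ofReal ?_
        -- The cosine of incidence on the face and that on the sensor are at most `1`.
        have h5 : (‖x‖⁻¹ * x 2) ^ 5 ≤ 1 := by
          refine pow_le_one₀ (by positivity) ?_
          rw [inv_mul_le_iff₀ hxn, mul_one]; exact hx2n
        have h6 : |-O.height j 0| / ‖x‖ ^ 3 ≤ 1 / O.depth ^ 2 := by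
          rw [div_le_div_iff₀ (by positivity) (by positivity), one_mul]
          calc |-O.height j 0| * O.depth ^ 2 ≤ ‖x‖ * ‖x‖ ^ 2 := by
                gcongr; exact hx2.trans hx2n
            _ = ‖x‖ ^ 3 := by ring
        calc c.focal ^ 2 * (‖x‖⁻¹ * x 2) ^ 5 * (|-O.height j 0| / ‖x‖ ^ 3)
            ≤ c.focal ^ 2 * 1 * (1 / O.depth ^ 2) := by gcongr
          _ = c.focal ^ 2 / O.depth ^ 2 := by ring
    _ = _ := by
        rw [lintegral_const_mul]
        exact (hF.indicator (O.measurableSet_openTriangle j)).comp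
          (O.continuous_facePoint j).measurable

variable (O) in
/-- The part of the image plane in which the relative interior of some face is seen. -/
def objectImage : Set E2 := ⋃ j, c.faceImage O j

variable (O) in
/-- The visible point imaged at `z`. -/
def backProj (z : E2) : E3 := Function.invFunOn c.proj (visiblePart O) z

lemma measurableSet_objectImage : MeasurableSet (c.objectImage O) :=
  MeasurableSet.iUnion c.measurableSet_faceImage

lemma aemeasurable_backProj (h : 0 < O.depth) :
    AEMeasurable (c.backProj O) (volume.restrict (c.objectImage O)) := by
  rw [objectImage, aemeasurable_iUnion_iff]
  intro j
  refine ⟨fun z => O.sightPoint j (c.sight z),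
    (O.measurable_sightPoint j).comp c.measurable_sight, ?_⟩
  filter_upwards [ae_restrict_mem (c.measurableSet_faceImage j)] with z hz
  exact c.invFunOn_proj_eq h hz

/-- Integrals over the sensor, weighted with `cos⁸`, are bounded by integrals over the surface. -/
lemma lintegral_objectImage_le (h : 0 < O.depth) {F : E3 → ℝ≥0∞} (hF : Measurable F) :
    ∫⁻ z in c.objectImage O, F (c.backProj O z) * ENNReal.ofReal (c.cosFour z ^ 2) ≤
      ENNReal.ofReal (c.focal ^ 2 / O.depth ^ 2) * ∫⁻ x, F x ∂O.surfaceMeasure := by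
  rw [O.lintegral_surfaceMeasure hF, Finset.mul_sum, objectImage]
  refine (lintegral_iUnion_le _ _).trans ?_
  rw [tsum_fintype]
  refine Finset.sum_le_sum fun j _ => le_trans (le_of_eq ?_) (c.lintegral_faceImage_le h j hF)
  refine setLIntegral_congr_fun (c.measurableSet_faceImage j) fun z hz => ?_
  simp only [backProj, c.invFunOn_proj_eq h hz]

/-- The inverse projection pulls null sets of the surface back to null sets of the sensor, so that
the irradiance depends on the class of the reflectance only. -/
lemma map_backProj_absolutelyContinuous (h : 0 < O.depth) :
    (volume.restrict (c.objectImage O)).map (c.backProj O) ≪ O.surfaceMeasure := by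
  refine Measure.AbsolutelyContinuous.mk fun N hN h0 => ?_
  rw [Measure.map_apply_of_aemeasurable (c.aemeasurable_backProj h) hN]
  have h1 := c.lintegral_objectImage_le h (F := N.indicator 1) (measurable_one.indicator hN)
  rw [lintegral_indicator_one hN, h0, mul_zero, nonpos_iff_eq_zero, lintegral_eq_zero_iff'] at h1
  · rw [← compl_compl (c.backProj O ⁻¹' N)]
    refine (mem_ae_iff).1 ?_
    filter_upwards [h1] with z hz hzN
    rw [indicator_of_mem (show c.backProj O z ∈ N from hzN)] at hz
    simp only [Pi.one_apply, one_mul, Pi.zero_apply, ENNReal.ofReal_eq_zero] at hz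
    have := c.cosFour_pos z
    exact absurd hz (not_le.2 (by positivity))
  · refine AEMeasurable.mul ?_ (c.measurable_cosFour.pow_const 2).ennreal_ofReal.aemeasurable
    exact (measurable_one.indicator hN).comp_aemeasurable (c.aemeasurable_backProj h)

lemma irradiance_eq (g : E3 → ℝ) (z : E2) :
    c.irradiance O g z = g (c.backProj O z) * c.cosFour z := rfl

lemma irradiance_ae_eq (h : 0 < O.depth) {g g' : E3 → ℝ} (hg : g =ᵐ[O.surfaceMeasure] g') :
    c.irradiance O g =ᵐ[volume.restrict (c.objectImage O)] c.irradiance O g' := by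
  have h1 := ae_of_ae_map (c.aemeasurable_backProj h)
    ((c.map_backProj_absolutelyContinuous h).ae_le hg)
  filter_upwards [h1] with z hz
  rw [irradiance_eq, irradiance_eq, hz]

lemma irradiance_spec (h : 0 < O.depth) {g : E3 → ℝ}
    (hg : AEStronglyMeasurable g O.surfaceMeasure) :
    AEStronglyMeasurable (c.irradiance O g) (volume.restrict (c.objectImage O)) ∧
    ∫⁻ z in c.objectImage O, ‖c.irradiance O g z‖ₑ ^ 2 ≤
      ENNReal.ofReal (c.focal ^ 2 / O.depth ^ 2) * eLpNorm g 2 O.surfaceMeasure ^ 2 := by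
  constructor
  · refine AEStronglyMeasurable.mul ?_ c.measurable_cosFour.aestronglyMeasurable
    exact (hg.mono_ac (c.map_backProj_absolutelyContinuous h)).comp_aemeasurable
      (c.aemeasurable_backProj h)
  · obtain ⟨g', hg', hgg'⟩ := hg
    have h1 := c.lintegral_objectImage_le h (F := fun x => ‖g' x‖ₑ ^ 2)
      (hg'.measurable.enorm.pow_const 2)
    rw [← eLpNorm_two_sq, ← eLpNorm_congr_ae hgg'] at h1
    refine le_trans (le_of_eq ?_) h1
    refine lintegral_congr_ae ?_
    filter_upwards [c.irradiance_ae_eq h hgg'] with z hz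
    rw [hz, irradiance_eq, enorm_mul, mul_pow, Real.enorm_eq_ofReal (c.cosFour_pos z).le,
      ENNReal.ofReal_pow (c.cosFour_pos z).le]

end Camera

/-! #### Pixels -/

lemma volume_square {s : ℝ} : volume {z : E2 | ∀ k, z k ∈ Icc 0 s} = ENNReal.ofReal s ^ 2 := by
  have h := (EuclideanSpace.volume_preserving_symm_measurableEquiv_toLp (Fin 2)).measure_preimage
    (s := Icc (fun _ => 0) fun _ => s) measurableSet_Icc.nullMeasurableSet
  rw [Real.volume_Icc_pi] at h
  simp only [sub_zero, Fin.prod_univ_two, ← sq] at h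
  rw [← h]
  congr 1
  ext z
  simp [Pi.le_def, forall_and]

lemma IsSquare.convex {s : ℝ} {Q : Set E2} (h : IsSquare s Q) : Convex ℝ Q := by
  obtain ⟨f, rfl⟩ := h
  have hc : Convex ℝ {z : E2 | ∀ k, z k ∈ Icc 0 s} := by
    intro x hx y hy a b ha hb hab k
    exact (convex_Icc (0 : ℝ) s) (hx k) (hy k) ha hb hab
  have := hc.affine_image (f.toRealAffineIsometryEquiv.toAffineEquiv.toAffineMap)
  exact this

lemma IsSquare.isCompact {s : ℝ} {Q : Set E2} (h : IsSquare s Q) : IsCompact Q := by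
  obtain ⟨f, rfl⟩ := h
  refine IsCompact.image ?_ f.continuous
  have := (isCompact_univ_pi fun _ : Fin 2 => isCompact_Icc (a := (0 : ℝ)) (b := s)).image
    (PiLp.continuous_toLp 2 fun _ : Fin 2 => ℝ)
  convert! this using 1
  ext z
  constructor
  · intro hz
    exact ⟨fun k => z k, fun k _ => hz k, rfl⟩
  · rintro ⟨w, hw, rfl⟩ k
    exact hw k (mem_univ k)

lemma IsSquare.volume {s : ℝ} {Q : Set E2} (h : IsSquare s Q) :
    volume Q = ENNReal.ofReal s ^ 2 := by
  obtain ⟨f, rfl⟩ := h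
  rw [← volume_square, ← EuclideanSpace.euclideanHausdorffMeasure_eq_volume,
    f.isometry.euclideanHausdorffMeasure_image]

namespace Camera

open TriangulatedObject

variable {m : ℕ} (c : Camera m) {O : TriangulatedObject}

lemma aedisjoint_pixel : Pairwise fun i j => AEDisjoint volume (c.pixel i) (c.pixel j) := by
  intro i j hij
  have hi := (c.isSquare_pixel i)
  have hj := (c.isSquare_pixel j)
  have e : ∀ k, (interior (c.pixel k) : Set E2) =ᵐ[volume] c.pixel k := fun k =>
    interior_ae_eq_of_null_frontier ((c.isSquare_pixel k).convex.addHaar_frontier volume)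
  exact (c.nonoverlapping i j hij).aedisjoint.congr (e i).symm (e j).symm

lemma setLIntegral_seen_eq (h : 0 < O.depth) (i : Fin m) :
    volume.restrict (c.seen O i) = volume.restrict (c.pixel i ∩ c.objectImage O) :=
  Measure.restrict_congr_set ((ae_eq_refl _).inter (c.image_visiblePart_ae_eq h))

lemma measurableSet_pixel (i : Fin m) : MeasurableSet (c.pixel i) :=
  (c.isSquare_pixel i).isCompact.isClosed.measurableSet

lemma integrableOn_irradiance (h : 0 < O.depth) {g : E3 → ℝ} (hg : MemLp g 2 O.surfaceMeasure)
    (i : Fin m) : IntegrableOn (c.irradiance O g) (c.seen O i) := by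
  rw [IntegrableOn, c.setLIntegral_seen_eq h]
  obtain ⟨h1, h2⟩ := c.irradiance_spec h hg.aestronglyMeasurable
  have h3 : MemLp (c.irradiance O g) 2 (volume.restrict (c.objectImage O)) := by
    refine ⟨h1, ?_⟩
    rw [← ENNReal.pow_lt_top_iff (n := 2) |>.trans (or_iff_left two_ne_zero), eLpNorm_two_sq]
    exact h2.trans_lt (ENNReal.mul_lt_top ENNReal.ofReal_lt_top
      (ENNReal.pow_lt_top hg.eLpNorm_lt_top))
  have h4 := h3.mono_measure (Measure.restrict_mono_set volume
    (inter_subset_right : c.pixel i ∩ c.objectImage O ⊆ _))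
  have : IsFiniteMeasure (volume.restrict (c.pixel i ∩ c.objectImage O)) :=
    ⟨by
      rw [Measure.restrict_apply_univ]
      exact (measure_mono inter_subset_left).trans_lt (c.isSquare_pixel i).isCompact.measure_lt_top⟩
  exact h4.integrable one_le_two

lemma P_congr (h : 0 < O.depth) {g g' : E3 → ℝ} (hg : g =ᵐ[O.surfaceMeasure] g') :
    c.P O g = c.P O g' := by
  unfold P
  congr 1
  funext i
  congr 1
  rw [c.setLIntegral_seen_eq h]
  refine integral_congr_ae ?_
  exact (c.irradiance_ae_eq h hg).filter_mono
    (ae_mono (Measure.restrict_mono_set volume inter_subset_right))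

lemma β_pos : 0 < c.β := by
  have := c.gain_pos
  have := c.lens_pos
  have := c.focal_pos
  unfold β; positivity

/-- On each pixel, of area `s ^ 2`, the Cauchy-Schwarz inequality bounds the square of the integral;
as the pixels do not overlap, the bounds add up. -/
lemma norm_P_le (h : 0 < O.depth) {g : E3 → ℝ} (hg : MemLp g 2 O.surfaceMeasure) :
    ‖c.P O g‖ ≤ c.β * c.focal * c.side / O.depth * (eLpNorm g 2 O.surfaceMeasure).toReal := by
  obtain ⟨h1, h2⟩ := c.irradiance_spec h hg.aestronglyMeasurable
  set I := c.irradiance O g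
  have hf := c.focal_pos
  have hs := c.side_pos
  have hterm : ∀ i, ‖∫ z in c.seen O i, I z‖ₑ ^ 2 ≤
      ENNReal.ofReal c.side ^ 2 * ∫⁻ z in c.pixel i ∩ c.objectImage O, ‖I z‖ₑ ^ 2 := by
    intro i
    rw [c.setLIntegral_seen_eq h]
    have hm : AEStronglyMeasurable I (volume.restrict (c.pixel i ∩ c.objectImage O)) :=
      h1.mono_set inter_subset_right
    have h3 := sq_lintegral_mul_le (μ := volume.restrict (c.pixel i ∩ c.objectImage O))
      (k := fun _ => 1) (g := fun z => ‖I z‖ₑ) aemeasurable_const hm.enorm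
    simp only [one_mul, lintegral_const, Measure.restrict_apply_univ] at h3
    refine (pow_le_pow_left' (enorm_integral_le_lintegral_enorm _) 2).trans (h3.trans ?_)
    gcongr
    exact (measure_mono inter_subset_left).trans (c.isSquare_pixel i).volume.le
  have hsum : ∑ i, ‖∫ z in c.seen O i, I z‖ₑ ^ 2 ≤ ENNReal.ofReal c.side ^ 2 *
      (ENNReal.ofReal (c.focal ^ 2 / O.depth ^ 2) * eLpNorm g 2 O.surfaceMeasure ^ 2) := by
    refine (Finset.sum_le_sum fun i _ => hterm i).trans ?_
    rw [← Finset.mul_sum]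
    gcongr
    have hU := lintegral_iUnion₀ (μ := volume) (s := fun i => c.pixel i ∩ c.objectImage O)
      (fun i => ((c.measurableSet_pixel i).inter c.measurableSet_objectImage).nullMeasurableSet)
      (fun i j hij => (c.aedisjoint_pixel hij).mono inter_subset_left inter_subset_left)
      (fun z => ‖I z‖ₑ ^ 2)
    rw [tsum_fintype] at hU
    rw [← hU]
    exact (lintegral_mono_set (iUnion_subset fun i => inter_subset_right)).trans h2
  set N := (eLpNorm g 2 O.surfaceMeasure).toReal with hN
  have hreal : ∑ i, (∫ z in c.seen O i, I z) ^ 2 ≤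
      c.side ^ 2 * (c.focal ^ 2 / O.depth ^ 2 * N ^ 2) := by
    rw [← ENNReal.ofReal_toReal hg.eLpNorm_ne_top, ← hN,
      ← ENNReal.ofReal_pow ENNReal.toReal_nonneg, ← ENNReal.ofReal_mul (by positivity),
      ← ENNReal.ofReal_pow hs.le, ← ENNReal.ofReal_mul (by positivity)] at hsum
    have he : ∀ i, ‖∫ z in c.seen O i, I z‖ₑ ^ 2 =
        ENNReal.ofReal ((∫ z in c.seen O i, I z) ^ 2) := by
      intro i
      rw [Real.enorm_eq_ofReal_abs, ← ENNReal.ofReal_pow (abs_nonneg _), sq_abs]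
    simp_rw [he] at hsum
    rwa [← ENNReal.ofReal_sum_of_nonneg fun i _ => sq_nonneg _,
      ENNReal.ofReal_le_ofReal_iff (by positivity)] at hsum
  have hβ := c.β_pos
  refine le_of_sq_le_sq ?_ (by positivity)
  rw [EuclideanSpace.norm_sq_eq]
  simp only [P, Real.norm_eq_abs, sq_abs, mul_pow]
  rw [← Finset.mul_sum]
  refine (mul_le_mul_of_nonneg_left hreal (by positivity)).trans (le_of_eq ?_)
  field_simp

/-- The sensor as a bounded operator on `L²`. -/
lemma exists_P (h : 0 < O.depth) : ∃ A : Lp ℝ 2 O.surfaceMeasure →L[ℝ] EuclideanSpace ℝ (Fin m),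
    (∀ g : Lp ℝ 2 O.surfaceMeasure, A g = c.P O g) ∧ ‖A‖ ≤ c.β * c.focal * c.side / O.depth := by
  have hβ := c.β_pos
  have hf := c.focal_pos
  have hs := c.side_pos
  let A₀ : Lp ℝ 2 O.surfaceMeasure →ₗ[ℝ] EuclideanSpace ℝ (Fin m) :=
    { toFun := fun g => c.P O g
      map_add' := by
        intro g g'
        rw [c.P_congr h (Lp.coeFn_add g g')]
        ext i
        simp only [P, PiLp.add_apply]
        rw [← mul_add, ← integral_add (c.integrableOn_irradiance h (Lp.memLp g) i)
          (c.integrableOn_irradiance h (Lp.memLp g') i)]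
        congr 1
        refine integral_congr_ae (ae_of_all _ fun z => ?_)
        simp only [irradiance_eq, Pi.add_apply, add_mul]
      map_smul' := by
        intro r g
        rw [c.P_congr h (Lp.coeFn_smul r g)]
        ext i
        simp only [P, PiLp.smul_apply, RingHom.id_apply, smul_eq_mul]
        rw [mul_left_comm, ← integral_const_mul (μ := volume.restrict (c.seen O i)) r]
        congr 1
        refine integral_congr_ae (ae_of_all _ fun z => ?_)
        simp only [irradiance_eq, Pi.smul_apply, smul_eq_mul, mul_assoc] }
  refine ⟨A₀.mkContinuous (c.β * c.focal * c.side / O.depth) fun g => ?_, fun g => rfl,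
    LinearMap.mkContinuous_norm_le _ (by positivity) _⟩
  rw [Lp.norm_def]
  exact c.norm_P_le h (Lp.memLp g)

end Camera

/-! ### The imaging operator -/

/-- The defining integrals of the imaging model converge, and interreflection is a contraction. -/
theorem wellPosed {m : ℕ} (O : LambertianObject) (c : Camera m) (hdepth : 0 < O.depth)
    (hreflect : O.reflectivity < 1) : WellPosed O c where
  memLp_directPoint := O.memLp_directPoint
  integrable_direct _ hf := O.integrable_direct (integrable_of_mem_illuminations hf)
  memLp_direct _ hf := O.memLp_direct (integrable_of_mem_illuminations hf)
  integrable_kernel g := (O.interreflect_spec g (Lp.stronglyMeasurable g) (Lp.memLp g)).1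
  T_eq := O.T_apply
  norm_T_lt_one := O.norm_T_le.trans_lt hreflect
  isUnit := O.isUnit_one_sub_T hreflect
  integrableOn_irradiance _ hg := c.integrableOn_irradiance hdepth hg
  P_congr _ _ hg := c.P_congr hdepth hg

/-- The factor by which the imaging process scales up norms. -/
def imagingGain {m : ℕ} (O : LambertianObject) (c : Camera m) : ℝ :=
  c.β * c.focal * c.side / O.depth / (1 - O.reflectivity)

lemma imagingGain_nonneg {m : ℕ} {O : LambertianObject} {c : Camera m} (hdepth : 0 < O.depth)
    (hreflect : O.reflectivity < 1) : 0 ≤ imagingGain O c := by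
  have hβ := c.β_pos
  have hf := c.focal_pos
  have hs := c.side_pos
  have : 0 < 1 - O.reflectivity := by linarith
  unfold imagingGain; positivity

/-- The map from the direct reflectance to the image. It is positive. -/
lemma exists_imaging {m : ℕ} (O : LambertianObject) (c : Camera m) (hdepth : 0 < O.depth)
    (hreflect : O.reflectivity < 1) : ∃ A : O.L2 →L[ℝ] EuclideanSpace ℝ (Fin m),
      (∀ u, pointImage O c u = A (O.toL2 (O.directPoint u))) ∧
      (∀ f, image O c f = A (O.toL2 (O.direct f))) ∧
      (∀ g, ‖A g‖ ≤ imagingGain O c * ‖g‖) ∧ ∀ g, 0 ≤ g → ∀ i, 0 ≤ A g i := by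
  obtain ⟨P, hP, hPn⟩ := c.exists_P hdepth
  have hβ := c.β_pos
  have hf := c.focal_pos
  have hs := c.side_pos
  refine ⟨P ∘L Ring.inverse (1 - O.T), fun u => (hP _).symm, fun f => (hP _).symm, fun g => ?_,
    fun g hg i => ?_⟩
  · calc ‖P (Ring.inverse (1 - O.T) g)‖
        ≤ c.β * c.focal * c.side / O.depth * ‖Ring.inverse (1 - O.T) g‖ := P.le_of_opNorm_le hPn _
      _ ≤ c.β * c.focal * c.side / O.depth * (‖g‖ / (1 - O.reflectivity)) := by
          gcongr
          exact O.norm_inverse_apply_le hreflect g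
      _ = imagingGain O c * ‖g‖ := by unfold imagingGain; ring
  · have hk := O.inverse_nonneg hreflect hg
    set k := Ring.inverse (1 - O.T) g
    change 0 ≤ P k i
    rw [hP]
    simp only [Camera.P]
    refine mul_nonneg hβ.le ?_
    rw [c.setLIntegral_seen_eq hdepth]
    refine integral_nonneg_of_ae ?_
    have h1 := ae_of_ae_map (c.aemeasurable_backProj hdepth)
      ((c.map_backProj_absolutelyContinuous hdepth).ae_le ((Lp.coeFn_nonneg k).2 hk))
    have h2 := h1.filter_mono (ae_mono (Measure.restrict_mono_set volume
      (inter_subset_right : c.pixel i ∩ c.objectImage _ ⊆ _)))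
    filter_upwards [h2] with z hz
    exact mul_nonneg hz (c.cosFour_pos z).le

lemma toL2_directPoint (O : LambertianObject) (u : S2) :
    O.toL2 (O.directPoint u) = (O.memLp_directPoint u).toLp _ :=
  dif_pos (O.memLp_directPoint u)

lemma toL2_direct (O : LambertianObject) {f : S2 → ℝ} (hf : Integrable f sphereMeasure) :
    O.toL2 (O.direct f) = (O.memLp_direct hf).toLp _ :=
  dif_pos (O.memLp_direct hf)

lemma pointImage_nonneg {m : ℕ} {O : LambertianObject} {c : Camera m} (hdepth : 0 < O.depth)
    (hreflect : O.reflectivity < 1) (u : S2) (i : Fin m) : 0 ≤ pointImage O c u i := by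
  obtain ⟨A, h1, -, -, h4⟩ := exists_imaging O c hdepth hreflect
  rw [h1]
  refine h4 _ ?_ i
  rw [toL2_directPoint, ← Lp.coeFn_nonneg]
  filter_upwards [(O.memLp_directPoint u).coeFn_toLp] with x hx
  rw [hx]
  exact O.directPoint_nonneg u x

lemma norm_pointImage_sub_le {m : ℕ} {O : LambertianObject} {c : Camera m} (hdepth : 0 < O.depth)
    (hreflect : O.reflectivity < 1) (u u' : S2) :
    ‖pointImage O c u - pointImage O c u'‖ ≤ imagingGain O c *
      (eLpNorm (O.directPoint u - O.directPoint u') 2 O.surfaceMeasure).toReal := by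
  obtain ⟨A, h1, -, h3, -⟩ := exists_imaging O c hdepth hreflect
  rw [h1, h1, ← map_sub, toL2_directPoint, toL2_directPoint, ← MemLp.toLp_sub]
  refine (h3 _).trans_eq ?_
  rw [Lp.norm_toLp]

/-! ### Shadow boundaries -/

namespace TriangulatedObject

variable (O : TriangulatedObject) {i : Fin O.N} {x v : E3}

lemma lit_smul {r : ℝ} (hr : 0 < r) : O.Lit x (r • v) ↔ O.Lit x v := by
  constructor
  · intro h t ht
    have := h (t / r) (div_pos ht hr)
    rwa [smul_smul, div_mul_cancel₀ _ hr.ne'] at this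
  · intro h t ht
    rw [smul_smul]
    exact h _ (mul_pos ht hr)

/-- Nearby rays which leave a face outwards do not meet the body for a time bounded below. -/
lemma exists_no_early_hit (hx : x ∈ openTriangle (O.face i)) (hv : 0 < ⟪O.normal i, v⟫_ℝ) :
    ∃ t₀ : ℝ, 0 < t₀ ∧ ∀ᶠ p : E3 × E3 in 𝓝 (x, v), p.1 ∈ openTriangle (O.face i) →
      ∀ t : ℝ, 0 < t → t ≤ t₀ → p.1 + t • p.2 ∉ O.body := by
  obtain ⟨r, hr, hball⟩ := O.exists_ball_face hx
  have hM : 0 < ‖v‖ + 1 := by positivity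
  refine ⟨r / (2 * (‖v‖ + 1)), by positivity, ?_⟩
  have e1 : ∀ᶠ p : E3 × E3 in 𝓝 (x, v), p.1 ∈ Metric.ball x (r / 2) :=
    continuous_fst.continuousAt.eventually (Metric.ball_mem_nhds x (half_pos hr))
  have e2 : ∀ᶠ p : E3 × E3 in 𝓝 (x, v), ‖p.2‖ < ‖v‖ + 1 :=
    (isOpen_lt (by fun_prop) continuous_const).mem_nhds (by simp)
  have e3 : ∀ᶠ p : E3 × E3 in 𝓝 (x, v), 0 < ⟪O.normal i, p.2⟫_ℝ :=
    (isOpen_lt continuous_const (by fun_prop)).mem_nhds hv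
  filter_upwards [e1, e2, e3] with p h1 h2 h3 hp t ht htt
  refine (hball _ ?_).2.2.1 ?_
  · rw [Metric.mem_ball] at h1 ⊢
    have h4 : dist (p.1 + t • p.2) p.1 ≤ r / 2 := by
      rw [dist_eq_norm, add_sub_cancel_left, norm_smul, Real.norm_eq_abs, abs_of_pos ht]
      calc t * ‖p.2‖ ≤ r / (2 * (‖v‖ + 1)) * (‖v‖ + 1) := by gcongr
        _ = r / 2 := by field_simp
    calc dist (p.1 + t • p.2) x ≤ dist (p.1 + t • p.2) p.1 + dist p.1 x := dist_triangle _ _ _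
      _ < r := by linarith
  · rw [height_add_smul, ((O.mem_openTriangle_iff i p.1).1 hp).1, zero_add]
    positivity

/-- Light from a given direction on a face is an open condition, on the point and the
direction. -/
lemma eventually_lit (hx : x ∈ openTriangle (O.face i)) (h : O.Lit x v) :
    ∀ᶠ p : E3 × E3 in 𝓝 (x, v), p.1 ∈ openTriangle (O.face i) → O.Lit p.1 p.2 := by
  have hv := O.inner_pos_of_lit hx h
  obtain ⟨t₀, ht₀, e1⟩ := O.exists_no_early_hit hx hv
  obtain ⟨R, hR⟩ := O.isCompact_body.isBounded.exists_norm_le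
  -- After the time `T` the ray is above the whole body.
  set α := ⟪O.normal i, v⟫_ℝ
  set T := (R + ‖x‖ + 2) * 2 / α
  have e2 : ∀ᶠ p : E3 × E3 in 𝓝 (x, v), α / 2 < ⟪O.normal i, p.2⟫_ℝ :=
    (isOpen_lt continuous_const (by fun_prop)).mem_nhds (half_lt_self hv)
  have e3 : ∀ᶠ p : E3 × E3 in 𝓝 (x, v), ‖p.1‖ < ‖x‖ + 1 :=
    (isOpen_lt (by fun_prop) continuous_const).mem_nhds (by simp)
  have e4 : ∀ᶠ p : E3 × E3 in 𝓝 (x, v), ∀ t ∈ Icc t₀ T, p.1 + t • p.2 ∉ O.body := by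
    refine isCompact_Icc.eventually_forall_of_forall_eventually
      (P := fun (p : E3 × E3) t => p.1 + t • p.2 ∉ O.body) fun t ht => ?_
    have hc : Continuous fun z : (E3 × E3) × ℝ => z.1.1 + z.2 • z.1.2 := by fun_prop
    exact (hc.continuousAt (x := ((x, v), t))).eventually
      (O.isCompact_body.isClosed.isOpen_compl.mem_nhds (h t (ht₀.trans_le ht.1)))
  filter_upwards [e1, e2, e3, e4] with p h1 h2 h3 h4 hp t ht
  by_cases c1 : t ≤ t₀
  · exact h1 hp t ht c1
  by_cases c2 : t ≤ T
  · exact h4 t ⟨(not_le.1 c1).le, c2⟩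
  intro hmem
  have b1 : ⟪O.normal i, p.1 + t • p.2⟫_ℝ ≤ R := (real_inner_le_norm _ _).trans
    (by rw [O.norm_normal, one_mul]; exact hR _ hmem)
  have b2 := abs_le.1 ((abs_real_inner_le_norm (O.normal i) p.1).trans
    (by rw [O.norm_normal, one_mul] : _ ≤ ‖p.1‖))
  rw [inner_add_right, inner_smul_right] at b1
  have b3 : (R + ‖x‖ + 2) * 2 < t * α := (div_lt_iff₀ hv).1 (not_le.1 c2)
  nlinarith [mul_lt_mul_of_pos_left h2 ht, b2.1]

/-- The first obstacle on the way from a dark point towards the light. -/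
lemma exists_first_hit (hx : x ∈ openTriangle (O.face i)) (hv : 0 < ⟪O.normal i, v⟫_ℝ)
    (h : ¬ O.Lit x v) : ∃ t : ℝ, 0 < t ∧ x + t • v ∈ frontier O.body ∧ O.Clear x (x + t • v) := by
  obtain ⟨t₀, ht₀, e1⟩ := O.exists_no_early_hit hx hv
  have hearly := e1.self_of_nhds hx
  simp only at hearly
  have hcont : Continuous fun t : ℝ => x + t • v := by fun_prop
  set S : Set ℝ := {t | t₀ ≤ t ∧ x + t • v ∈ O.body} with hS
  have hSc : IsClosed S := isClosed_Ici.inter (O.isCompact_body.isClosed.preimage hcont)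
  have hSb : BddBelow S := ⟨t₀, fun t ht => ht.1⟩
  have hSn : S.Nonempty := by
    unfold Lit at h
    push Not at h
    obtain ⟨t, ht, hb⟩ := h
    refine ⟨t, ?_, hb⟩
    by_contra hlt
    exact hearly t ht (not_le.1 hlt).le hb
  obtain ⟨h1, h2⟩ := hSc.csInf_mem hSn hSb
  set T := sInf S
  have hT : 0 < T := ht₀.trans_le h1
  have hbefore : ∀ t, 0 < t → t < T → x + t • v ∉ O.body := by
    intro t ht htT hb
    by_cases c : t ≤ t₀
    · exact hearly t ht c hb
    · exact absurd (csInf_le hSb ⟨(not_le.1 c).le, hb⟩) (not_le.2 htT)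
  refine ⟨T, hT, ?_, ?_⟩
  · refine ⟨subset_closure h2, fun hint => ?_⟩
    have e2 : ∀ᶠ t in 𝓝[<] T, x + t • v ∈ interior O.body :=
      (hcont.continuousAt.eventually (isOpen_interior.mem_nhds hint)).filter_mono
        nhdsWithin_le_nhds
    obtain ⟨t, ht, ht'⟩ := (e2.and (Ioo_mem_nhdsLT hT)).exists
    exact hbefore t ht'.1 ht'.2 (interior_subset ht)
  · intro t ht
    have : AffineMap.lineMap x (x + T • v) t = x + (t * T) • v := by
      rw [AffineMap.lineMap_apply, vsub_eq_sub, vadd_eq_add, add_sub_cancel_left, smul_smul,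
        add_comm]
    rw [this]
    exact hbefore _ (mul_pos ht.1 hT) (by nlinarith [ht.2])

lemma notMem_of_clear {T t : ℝ} (hc : O.Clear x (x + T • v)) (ht : 0 < t) (htT : t < T) :
    x + t • v ∉ O.body := by
  have hT := ht.trans htT
  have := hc (t / T) ⟨div_pos ht hT, (div_lt_one hT).2 htT⟩
  rwa [AffineMap.lineMap_apply, vsub_eq_sub, vadd_eq_add, add_sub_cancel_left, smul_smul,
    div_mul_cancel₀ _ hT.ne', add_comm] at this

/-- The shadow retraction is the first obstacle. -/
lemma shadowRetraction_eq {T : ℝ} (hT : 0 < T) (hc : O.Clear x (x + T • v))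
    (hz : x + T • v ∈ frontier O.body) :
    (O.hitTimes x v).Nonempty ∧ O.shadowRetraction x v = x + T • v := by
  have hmem : T ∈ O.hitTimes x v := ⟨hT, hz⟩
  refine ⟨⟨T, hmem⟩, ?_⟩
  have : IsLeast (O.hitTimes x v) T := by
    refine ⟨hmem, fun t ht => ?_⟩
    by_contra hlt
    exact O.notMem_of_clear hc ht.1 (not_le.1 hlt) (O.frontier_subset_body ht.2)
  rw [shadowRetraction, this.csInf_eq]

/-- If a point that is dark for the direction `v` is lit from directions arbitrarily close to `v`,
then there are points arbitrarily close to it which are lit from the direction `v`: near each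
obstacle the body is a cone, so tilting the ray has the same effect as a parallel displacement. -/
lemma mem_closure_lit (hx : x ∈ openTriangle (O.face i)) (hv : 0 < ⟪O.normal i, v⟫_ℝ)
    (h : v ∈ closure {v' | O.Lit x v'}) :
    x ∈ closure {y | y ∈ openTriangle (O.face i) ∧ O.Lit y v} := by
  by_contra hcon
  rw [mem_closure_iff_seq_limit] at h
  obtain ⟨vs, hlit, hlim⟩ := h
  set α := ⟪O.normal i, v⟫_ℝ
  set w : ℕ → E3 := fun k => vs k - v with hw
  have hw0 : Tendsto w atTop (𝓝 0) := by
    have := hlim.sub_const v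
    rwa [sub_self] at this
  -- The tilt `w k` of the ray, projected along `v` to the plane of the face, is the displacement
  -- of the points `y k` of the face.
  set a : ℕ → ℝ := fun k => ⟪O.normal i, w k⟫_ℝ / α with ha
  have ha0 : Tendsto a atTop (𝓝 0) := by
    have h1 : Continuous fun y : E3 => ⟪O.normal i, y⟫_ℝ / α := by fun_prop
    have := (h1.tendsto 0).comp hw0
    rwa [inner_zero_right, zero_div] at this
  set y : ℕ → E3 := fun k => x + (w k - a k • v) with hy
  have hyx : Tendsto y atTop (𝓝 x) := by
    have := (hw0.sub (ha0.smul_const v)).const_add x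
    simpa using this
  obtain ⟨r, hr, hball⟩ := O.exists_ball_face hx
  have hyo : ∀ᶠ k in atTop, y k ∈ openTriangle (O.face i) := by
    filter_upwards [hyx.eventually (Metric.ball_mem_nhds x hr)] with k hk
    refine (hball _ hk).1 ?_
    have h1 := O.height_add_smul i x (w k - a k • v) 1
    rw [one_smul, ((O.mem_openTriangle_iff i x).1 hx).1, inner_sub_right, inner_smul_right] at h1
    rw [hy]
    simp only
    rw [h1, ha]
    simp only
    rw [div_mul_cancel₀ _ hv.ne']
    ring
  obtain ⟨t₀, ht₀, e1⟩ := O.exists_no_early_hit hx hv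
  -- If `x` is not a limit of lit points, the points `y k` are dark. Their obstacles accumulate at a
  -- point `x + T v` of the body.
  have hdark : ∀ᶠ k in atTop, ∃ t, t₀ < t ∧ y k + t • v ∈ O.body := by
    have h1 : ∀ᶠ k in atTop, y k ∉ {y | y ∈ openTriangle (O.face i) ∧ O.Lit y v} :=
      hyx.eventually ((isClosed_closure.isOpen_compl.mem_nhds hcon)) |>.mono
        fun k hk hk' => hk (subset_closure hk')
    have h2 := (hyx.prodMk_nhds (tendsto_const_nhds (x := v))).eventually e1
    filter_upwards [h1, h2, hyo] with k hk1 hk2 hk3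
    have hnl : ¬ O.Lit (y k) v := fun hl => hk1 ⟨hk3, hl⟩
    unfold Lit at hnl
    push Not at hnl
    obtain ⟨t, ht, hb⟩ := hnl
    refine ⟨t, ?_, hb⟩
    by_contra hle
    exact hk2 hk3 t ht (not_lt.1 hle) hb
  obtain ⟨k₀, hk₀⟩ := eventually_atTop.1 (hdark.and ((hyx.eventually
    (Metric.ball_mem_nhds x one_pos))))
  have hk₀' : ∀ k, ∃ t, t₀ < t ∧ y (k + k₀) + t • v ∈ O.body := fun k => (hk₀ _ (by omega)).1
  choose t ht0 htb using hk₀'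
  obtain ⟨R, hR⟩ := O.isCompact_body.isBounded.exists_norm_le
  have htbd : ∀ k, t k ∈ Icc t₀ ((R + ‖x‖ + 1) / α) := by
    intro k
    refine ⟨(ht0 k).le, ?_⟩
    rw [le_div_iff₀ hv]
    have h1 : ⟪O.normal i, y (k + k₀) + t k • v⟫_ℝ ≤ R := (real_inner_le_norm _ _).trans
      (by rw [O.norm_normal, one_mul]; exact hR _ (htb k))
    have h2 : ‖y (k + k₀)‖ ≤ ‖x‖ + 1 := by
      have h3 := (hk₀ (k + k₀) (by omega)).2
      rw [dist_eq_norm] at h3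
      have := norm_le_norm_add_norm_sub' (y (k + k₀)) x
      linarith [norm_sub_rev x (y (k + k₀))]
    have h4 := abs_le.1 ((abs_real_inner_le_norm (O.normal i) (y (k + k₀))).trans
      (by rw [O.norm_normal, one_mul] : _ ≤ ‖y (k + k₀)‖))
    rw [inner_add_right, inner_smul_right] at h1
    linarith [h4.1]
  obtain ⟨T, hT, φ, hφ, hlimT⟩ := isCompact_Icc.tendsto_subseq htbd
  have hTpos : 0 < T := ht₀.trans_le hT.1
  -- The obstacles of `y k` in terms of `x` and the tilted direction.
  set σ : ℕ → ℕ := fun k => φ k + k₀ with hσ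
  have hσt : Tendsto σ atTop atTop :=
    tendsto_atTop_mono (fun k => Nat.le_add_right _ _) hφ.tendsto_atTop
  set s : ℕ → ℝ := fun k => t (φ k) - a (σ k) with hs
  have hsT : Tendsto s atTop (𝓝 T) := by
    have := hlimT.sub (ha0.comp hσt)
    simpa using this
  have hp : ∀ k, x + w (σ k) + s k • v ∈ O.body := by
    intro k
    have := htb (φ k)
    have he : y (φ k + k₀) + t (φ k) • v = x + w (σ k) + s k • v := by
      simp only [hy, hs, hσ]; module
    rwa [he] at this
  have hplim : Tendsto (fun k => x + w (σ k) + s k • v) atTop (𝓝 (x + T • v)) := by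
    have := ((hw0.comp hσt).const_add x).add (hsT.smul_const v)
    simpa using this
  have hz : x + T • v ∈ O.body :=
    O.isCompact_body.isClosed.mem_of_tendsto hplim (Eventually.of_forall hp)
  obtain ⟨ρ, hρ, hcone⟩ := O.body_locally_conic hz
  -- The body is a cone at `x + T v`. The line from this point to the obstacle meets the ray from
  -- `x` in direction `vs k`, close to the apex; there the body would obstruct the light.
  set l : ℕ → ℝ := fun k => T / (1 + T - s k) with hl
  have hden : Tendsto (fun k => 1 + T - s k) atTop (𝓝 1) := by
    have := hsT.const_sub (1 + T)
    simpa using this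
  have hlT : Tendsto l atTop (𝓝 T) := by
    have := (tendsto_const_nhds (x := T)).div hden one_ne_zero
    rwa [div_one] at this
  have hline : ∀ k, 0 < 1 + T - s k → AffineMap.lineMap (x + T • v) (x + w (σ k) + s k • v) (l k) =
      x + l k • vs (σ k) := by
    intro k hk
    have h1 : T + l k * (s k - T) = l k := by
      simp only [hl]; field_simp; ring
    have h2 : vs (σ k) = v + w (σ k) := by simp [hw]
    rw [h2, AffineMap.lineMap_apply, vsub_eq_sub, vadd_eq_add]
    have h3 : x + l k • (v + w (σ k)) = x + (T + l k * (s k - T)) • v + l k • w (σ k) := by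
      rw [h1]; module
    rw [h3]
    module
  have hqlim : Tendsto (fun k => x + l k • vs (σ k)) atTop (𝓝 (x + T • v)) :=
    (hlT.smul (hlim.comp hσt)).const_add x
  obtain ⟨k, h1, h2, h3⟩ := ((hplim.eventually (Metric.ball_mem_nhds _ hρ)).and
    ((hqlim.eventually (Metric.ball_mem_nhds _ hρ)).and
      (hden.eventually (lt_mem_nhds one_pos)))).exists
  have hl0 : 0 < l k := div_pos hTpos h3
  have h4 := hcone _ h1 (hp k) (l k) hl0.le (by rw [hline k h3]; exact h2)
  rw [hline k h3] at h4
  exact hlit (σ k) (l k) hl0 h4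

/-- A shadow boundary is cast by the edges. -/
lemma exists_mem_edge {T : ℝ} (hT : 0 < T)
    (hx : x ∈ closure {y | O.Lit y v}) (hc : O.Clear x (x + T • v))
    (hz : x + T • v ∈ frontier O.body) : ∃ j k, x + T • v ∈ O.edge j k := by
  refine O.mem_edge_of_mem_frontier hz fun hΦ => ?_
  obtain ⟨j, hj⟩ := O.mem_Φ.1 hΦ
  set z := x + T • v with hzdef
  obtain ⟨r, hr, hball⟩ := O.exists_ball_face hj
  have hz0 := ((O.mem_openTriangle_iff j z).1 hj).1
  have hback : ∀ᶠ s in 𝓝[>] (0 : ℝ), z + s • (-v) ∉ O.body := by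
    filter_upwards [Ioo_mem_nhdsGT hT] with s hs
    have : z + s • (-v) = x + (T - s) • v := by rw [hzdef]; module
    rw [this]
    exact O.notMem_of_clear hc (by linarith [hs.2]) (by linarith [hs.1])
  obtain ⟨s, hs1, hs2, hs3⟩ := (hback.and ((eventually_ball z (-v) hr).and
    self_mem_nhdsWithin)).exists
  have hs0 : 0 < s := hs3
  have hh : O.height j (z + s • (-v)) = -(s * ⟪O.normal j, v⟫_ℝ) := by
    rw [height_add_smul, hz0, inner_neg_right]; ring
  rcases lt_trichotomy ⟪O.normal j, v⟫_ℝ 0 with hneg | h0 | hpos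
  -- If the ray enters the body through the open face, so do the rays from nearby points; if it is
  -- tangent to the face or comes from below, it runs in the body before.
  · obtain ⟨q, hq1, hq2⟩ := ((eventually_ball z v hr).and self_mem_nhdsWithin).exists
    have hq0 : 0 < q := hq2
    have hcont : Continuous fun y : E3 => y + (T + q) • v := by fun_prop
    have hx' : x + (T + q) • v = z + q • v := by rw [hzdef]; module
    have hopen : ∀ᶠ y in 𝓝 x, y + (T + q) • v ∈ Metric.ball z r ∧
        O.height j (y + (T + q) • v) < 0 := by
      refine (hcont.continuousAt.eventually (Metric.isOpen_ball.mem_nhds ?_)).and ?_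
      · simp only [hx']; exact hq1
      · refine ((O.continuous_height j).comp hcont).continuousAt.eventually (gt_mem_nhds ?_)
        simp only [Function.comp]
        rw [hx', height_add_smul, hz0]
        nlinarith
    obtain ⟨y, hy1, hy2⟩ := (mem_closure_iff_nhds.1 hx _ hopen)
    exact hy2 (T + q) (by linarith) ((hball _ hy1.1).2.2.2 hy1.2)
  · exact hs1 (O.mem_body_of_mem_openTriangle ((hball _ hs2).1 (by rw [hh, h0]; ring)))
  · exact hs1 ((hball _ hs2).2.2.2 (by rw [hh]; nlinarith))

end TriangulatedObject

namespace LambertianObject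

open TriangulatedObject

variable (O : LambertianObject) {i : Fin O.N} {x : E3}

lemma directPoint_pos {u : S2} (hx : x ∈ openTriangle (O.face i)) (h : O.Lit x u) :
    0 < O.directPoint u x := by
  have hn := O.inner_pos_of_lit hx h
  rw [O.directPoint_eq (sphere_ne_zero u), litCos, O.normalAt_eq hx, if_pos h, mul_one,
    max_eq_left hn.le]
  exact mul_pos (O.albedo_pos x (O.openTriangle_subset_frontier i hx)) hn

lemma directPoint_eq_zero {u : S2} (h : ¬ O.Lit x u) : O.directPoint u x = 0 := by
  rw [O.directPoint_eq (sphere_ne_zero u), litCos, if_neg h, mul_zero, mul_zero]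

/-- The shadow boundary within a face: the dark points that are limits of lit points. The lit
points are open in the face, so that the lit side contributes none. -/
lemma mem_shadowBoundary_iff {u : S2} (hx : x ∈ openTriangle (O.face i)) :
    x ∈ O.shadowBoundary u ↔
      ¬ O.Lit x u ∧ x ∈ closure {y | y ∈ openTriangle (O.face i) ∧ O.Lit y u} := by
  have hxf := O.openTriangle_subset_frontier i hx
  have himg : x ∈ O.shadowBoundary u ↔
      (⟨x, hxf⟩ : frontier O.body) ∈
        frontier ((Subtype.val : frontier O.body → E3) ⁻¹' O.shadow u) := by
    constructor
    · rintro ⟨y, hy, hyx⟩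
      have : y = ⟨x, hxf⟩ := Subtype.ext hyx
      rwa [← this]
    · exact fun h => ⟨_, h, rfl⟩
  rw [himg]
  obtain ⟨r, hr, hball⟩ := O.exists_ball_face hx
  constructor
  · rintro ⟨hcl, hni⟩
    have hnl : ¬ O.Lit x u := by
      intro hl
      have e : ∀ᶠ y in 𝓝 x, y ∈ openTriangle (O.face i) → O.Lit y u := by
        have h1 := O.eventually_lit hx hl
        have h2 : Tendsto (fun y : E3 => (y, (u : E3))) (𝓝 x) (𝓝 (x, (u : E3))) :=
          (continuous_id.prodMk continuous_const).tendsto x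
        exact h2.eventually h1
      have e' : ∀ᶠ y : frontier O.body in 𝓝 ⟨x, hxf⟩,
          ((y : E3) ∈ openTriangle (O.face i) → O.Lit y u) ∧ (y : E3) ∈ Metric.ball x r :=
        (continuous_subtype_val.tendsto (⟨x, hxf⟩ : frontier O.body)).eventually
          (e.and (Metric.ball_mem_nhds x hr))
      obtain ⟨y, ⟨hy1, hy2⟩, hy3⟩ := mem_closure_iff_nhds.1 hcl _ e'
      have hyo := (hball _ hy2).1 ((hball _ hy2).2.1 y.2)
      exact (O.directPoint_pos hyo (hy1 hyo)).ne' hy3.2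
    refine ⟨hnl, mem_closure_iff_nhds.2 fun U hU => ?_⟩
    by_contra hemp
    rw [not_nonempty_iff_eq_empty] at hemp
    refine hni ?_
    rw [mem_interior_iff_mem_nhds]
    have : ∀ᶠ y : frontier O.body in 𝓝 ⟨x, hxf⟩, (y : E3) ∈ U ∧ (y : E3) ∈ Metric.ball x r :=
      (continuous_subtype_val.tendsto (⟨x, hxf⟩ : frontier O.body)).eventually
        (Filter.Eventually.and hU (Metric.ball_mem_nhds x hr))
    filter_upwards [this] with y hy
    refine ⟨y.2, O.directPoint_eq_zero fun hl => ?_⟩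
    have hyo := (hball _ hy.2).1 ((hball _ hy.2).2.1 y.2)
    have : (y : E3) ∈ U ∩ {y | y ∈ openTriangle (O.face i) ∧ O.Lit y u} := ⟨hy.1, hyo, hl⟩
    rw [hemp] at this
    exact this
  · rintro ⟨hnl, hcl⟩
    refine ⟨subset_closure ⟨hxf, O.directPoint_eq_zero hnl⟩, fun hint => ?_⟩
    rw [mem_interior_iff_mem_nhds, nhds_induced] at hint
    obtain ⟨U, hU, hUS⟩ := hint
    obtain ⟨y, hyU, hyo, hyl⟩ := mem_closure_iff_nhds.1 hcl U hU
    have := @hUS ⟨y, O.openTriangle_subset_frontier i hyo⟩ hyU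
    exact (O.directPoint_pos hyo hyl).ne' this.2

lemma mem_shadowingEdges {u : S2} {v : E3} {r T : ℝ} (hr : 0 < r) (hv : v = r • (u : E3))
    (hx : x ∈ openTriangle (O.face i))
    (hcl : x ∈ closure {y | y ∈ openTriangle (O.face i) ∧ O.Lit y v}) (hT : 0 < T)
    (hc : O.Clear x (x + T • v)) (hz : x + T • v ∈ frontier O.body) :
    x + T • v ∈ O.shadowingEdges u := by
  have e : x + T • v = x + (T * r) • (u : E3) := by rw [hv, smul_smul]
  rw [e] at hc hz ⊢
  have hTr := mul_pos hT hr
  obtain ⟨h1, h2⟩ := O.shadowRetraction_eq hTr hc hz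
  refine ⟨x, ⟨(O.mem_shadowBoundary_iff hx).2 ⟨fun hl => ?_, ?_⟩, O.mem_Φ.2 ⟨i, hx⟩⟩, h1, h2.symm⟩
  · exact hl _ hTr (O.frontier_subset_body hz)
  · simpa only [hv, O.lit_smul hr] using hcl

lemma shadowingEdges_subset (u : S2) : O.shadowingEdges u ⊆ ⋃ j, ⋃ k, O.edge j k := by
  rintro z ⟨x, ⟨hx, hxΦ⟩, -, rfl⟩
  obtain ⟨i, hi⟩ := O.mem_Φ.1 hxΦ
  obtain ⟨hnl, hcl⟩ := (O.mem_shadowBoundary_iff hi).1 hx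
  have hn : 0 < ⟪O.normal i, (u : E3)⟫_ℝ := by
    obtain ⟨y, hy⟩ := closure_nonempty_iff.1 ⟨x, hcl⟩
    exact O.inner_pos_of_lit hy.1 hy.2
  obtain ⟨T, hT, hz, hc⟩ := O.exists_first_hit hi hn hnl
  rw [(O.shadowRetraction_eq hT hc hz).2]
  obtain ⟨j, k, h⟩ := O.exists_mem_edge hT (closure_mono (fun y hy => hy.2) hcl) hc hz
  exact mem_iUnion₂.2 ⟨j, k, h⟩

lemma hausdorffMeasure_edges_lt_top :
    Measure.hausdorffMeasure 1 (⋃ j, ⋃ k, O.edge j k) < (⊤ : ℝ≥0∞) := by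
  refine (measure_iUnion_le _).trans_lt ?_
  rw [tsum_fintype]
  refine ENNReal.sum_lt_top.2 fun j _ => (measure_iUnion_le _).trans_lt ?_
  rw [tsum_fintype]
  refine ENNReal.sum_lt_top.2 fun k _ => ?_
  rw [edge, hausdorffMeasure_segment]
  exact edist_lt_top _ _

/-- The supremum in the definition of `χ⋆` is finite, as all shadows are cast by the edges. Hence
its conversion to a real number loses nothing. -/
lemma hausdorffMeasure_shadowingEdges_le (u : S2) :
    Measure.hausdorffMeasure 1 (O.shadowingEdges u) ≤ ENNReal.ofReal O.maxShadowingLength := by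
  rw [maxShadowingLength, ENNReal.ofReal_toReal]
  · exact le_iSup (fun u : S2 => Measure.hausdorffMeasure 1 (O.shadowingEdges u)) u
  · refine ne_top_of_le_ne_top O.hausdorffMeasure_edges_lt_top.ne (iSup_le fun u => ?_)
    exact measure_mono (O.shadowingEdges_subset u)

lemma maxShadowingLength_nonneg : 0 ≤ O.maxShadowingLength := ENNReal.toReal_nonneg

end LambertianObject

/-! ### The area swept by a shadow -/

/-- The derivative of a coordinate of the shadow `z - (height / slope) v` in the parameters of the
shadow-casting point and of the direction of the light. -/
lemma hasFDerivAt_centralProjection (z e H h A a V w : ℝ) {p : ℝ × ℝ} (hA : A + p.2 * a ≠ 0) :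
    HasFDerivAt (fun q : ℝ × ℝ => z + q.1 * e - (H + q.1 * h) / (A + q.2 * a) * (V + q.2 * w))
      ((e - h / (A + p.2 * a) * (V + p.2 * w)) • ContinuousLinearMap.fst ℝ ℝ ℝ +
        ((H + p.1 * h) * a / (A + p.2 * a) ^ 2 * (V + p.2 * w) -
          (H + p.1 * h) / (A + p.2 * a) * w) • ContinuousLinearMap.snd ℝ ℝ ℝ) p := by
  have hf := hasFDerivAt_fst (𝕜 := ℝ) (E := ℝ) (F := ℝ) (p := p)
  have hs := hasFDerivAt_snd (𝕜 := ℝ) (E := ℝ) (F := ℝ) (p := p)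
  have h1 := (hf.mul_const e).const_add z
  have h2 := (hf.mul_const h).const_add H
  have h3 := (hs.mul_const a).const_add A
  have h4 := (hs.mul_const w).const_add V
  have h5 := h1.sub ((h2.mul ((hasDerivAt_inv hA).comp_hasFDerivAt p h3)).mul h4)
  convert! h5 using 1
  ext
  · simp; field_simp
  · simp; field_simp; ring

/-- Hadamard's inequality for three vectors in space. -/
lemma sq_det_le (e₀ e₁ e₂ v₀ v₁ v₂ w₀ w₁ w₂ : ℝ) :
    (e₀ * (v₁ * w₂ - v₂ * w₁) - e₁ * (v₀ * w₂ - v₂ * w₀) + e₂ * (v₀ * w₁ - v₁ * w₀)) ^ 2 ≤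
      (e₀ ^ 2 + e₁ ^ 2 + e₂ ^ 2) * (v₀ ^ 2 + v₁ ^ 2 + v₂ ^ 2) * (w₀ ^ 2 + w₁ ^ 2 + w₂ ^ 2) := by
  set c₀ := v₁ * w₂ - v₂ * w₁
  set c₁ := v₂ * w₀ - v₀ * w₂
  set c₂ := v₀ * w₁ - v₁ * w₀
  have h1 : (e₀ * c₀ + e₁ * c₁ + e₂ * c₂) ^ 2 ≤
      (e₀ ^ 2 + e₁ ^ 2 + e₂ ^ 2) * (c₀ ^ 2 + c₁ ^ 2 + c₂ ^ 2) := by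
    nlinarith [sq_nonneg (e₀ * c₁ - e₁ * c₀), sq_nonneg (e₀ * c₂ - e₂ * c₀),
      sq_nonneg (e₁ * c₂ - e₂ * c₁)]
  have h2 : c₀ ^ 2 + c₁ ^ 2 + c₂ ^ 2 ≤
      (v₀ ^ 2 + v₁ ^ 2 + v₂ ^ 2) * (w₀ ^ 2 + w₁ ^ 2 + w₂ ^ 2) := by
    have : (v₀ ^ 2 + v₁ ^ 2 + v₂ ^ 2) * (w₀ ^ 2 + w₁ ^ 2 + w₂ ^ 2) =
        c₀ ^ 2 + c₁ ^ 2 + c₂ ^ 2 + (v₀ * w₀ + v₁ * w₁ + v₂ * w₂) ^ 2 := by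
      simp only [c₀, c₁, c₂]; ring
    nlinarith [sq_nonneg (v₀ * w₀ + v₁ * w₁ + v₂ * w₂)]
  calc _ = (e₀ * c₀ + e₁ * c₁ + e₂ * c₂) ^ 2 := by simp only [c₁]; ring
    _ ≤ _ := h1
    _ ≤ (e₀ ^ 2 + e₁ ^ 2 + e₂ ^ 2) *
        ((v₀ ^ 2 + v₁ ^ 2 + v₂ ^ 2) * (w₀ ^ 2 + w₁ ^ 2 + w₂ ^ 2)) := by gcongr
    _ = _ := by ring

lemma norm_sq_eq_sum (b : OrthonormalBasis (Fin 3) ℝ E3) (x : E3) :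
    ‖x‖ ^ 2 = ⟪b 0, x⟫_ℝ ^ 2 + ⟪b 1, x⟫_ℝ ^ 2 + ⟪b 2, x⟫_ℝ ^ 2 := by
  rw [← b.sum_sq_inner_right, Fin.sum_univ_three]

namespace TriangulatedObject

variable (O : TriangulatedObject)

/-- The coordinates of a point in the plane of the face `i`. -/
def faceCoord (i : Fin O.N) (x : E3) : ℝ × ℝ :=
  (⟪O.frame i 0, x - (O.face i).points 0⟫_ℝ, ⟪O.frame i 1, x - (O.face i).points 0⟫_ℝ)

lemma faceCoord_facePoint (i : Fin O.N) (w : ℝ × ℝ) : O.faceCoord i (O.facePoint i w) = w := by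
  rw [faceCoord, facePoint_sub]
  have h01 : ¬ (0 : Fin 3) = 1 := by decide
  have h10 : ¬ (1 : Fin 3) = 0 := by decide
  have h02 : ¬ (0 : Fin 3) = 2 := by decide
  have h12 : ¬ (1 : Fin 3) = 2 := by decide
  ext <;> simp [spaceParam, inner_add_right, inner_smul_right, (O.frame i).inner_eq_ite]

/-- The point of the plane of the face `i` on which the point `z` casts its shadow, if the light
comes from the direction `v`. -/
def shadowPoint (i : Fin O.N) (z v : E3) : E3 := z - (O.height i z / ⟪O.normal i, v⟫_ℝ) • v

/-- As the direction of the light and the shadow-casting point of a line vary, the area swept by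
the shadow is controlled by the area of the parameter domain. -/
lemma volume_shadow_le (i : Fin O.N) (p e v w : E3) (he : ‖e‖ = 1) {A : Set (ℝ × ℝ)}
    (hA : MeasurableSet A) {D a : ℝ} (ha : 0 < a)
    (h1 : ∀ q ∈ A, a ≤ ⟪O.normal i, v + q.2 • w⟫_ℝ)
    (h2 : ∀ q ∈ A, ‖p + q.1 • e - O.shadowPoint i (p + q.1 • e) (v + q.2 • w)‖ ≤ D) :
    volume ((fun q : ℝ × ℝ => O.faceCoord i (O.shadowPoint i (p + q.1 • e) (v + q.2 • w))) '' A) ≤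
      ENNReal.ofReal (D * ‖w‖ / a) * volume A := by
  set b := O.frame i with hb
  have hb2 : ∀ y, ⟪b 2, y⟫_ℝ = ⟪O.normal i, y⟫_ℝ := fun y => by rw [hb, O.frame_two]
  set p₀ := (O.face i).points 0
  set H := O.height i p
  set f : Fin 3 → (ℝ × ℝ) → ℝ := fun k q => ⟪b k, p - p₀⟫_ℝ + q.1 * ⟪b k, e⟫_ℝ -
    (H + q.1 * ⟪b 2, e⟫_ℝ) / (⟪b 2, v⟫_ℝ + q.2 * ⟪b 2, w⟫_ℝ) * (⟪b k, v⟫_ℝ + q.2 * ⟪b k, w⟫_ℝ)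
    with hf
  have hfun : (fun q : ℝ × ℝ =>
      O.faceCoord i (O.shadowPoint i (p + q.1 • e) (v + q.2 • w))) = fun q => (f 0 q, f 1 q) := by
    funext q
    simp only [faceCoord, shadowPoint, f, H, height_add_smul, hb2]
    ext <;> simp only [inner_sub_right, inner_add_right, inner_smul_right] <;> ring
  rw [hfun]
  set M : (ℝ × ℝ) → Fin 3 → Fin 2 → ℝ := fun q k => ![⟪b k, e⟫_ℝ - ⟪b 2, e⟫_ℝ /
      (⟪b 2, v⟫_ℝ + q.2 * ⟪b 2, w⟫_ℝ) * (⟪b k, v⟫_ℝ + q.2 * ⟪b k, w⟫_ℝ),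
    (H + q.1 * ⟪b 2, e⟫_ℝ) * ⟪b 2, w⟫_ℝ / (⟪b 2, v⟫_ℝ + q.2 * ⟪b 2, w⟫_ℝ) ^ 2 *
      (⟪b k, v⟫_ℝ + q.2 * ⟪b k, w⟫_ℝ) -
      (H + q.1 * ⟪b 2, e⟫_ℝ) / (⟪b 2, v⟫_ℝ + q.2 * ⟪b 2, w⟫_ℝ) * ⟪b k, w⟫_ℝ] with hM
  set f' : (ℝ × ℝ) → (ℝ × ℝ →L[ℝ] ℝ × ℝ) := fun q =>
    (Matrix.toLin (.finTwoProd ℝ) (.finTwoProd ℝ)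
      !![M q 0 0, M q 0 1; M q 1 0, M q 1 1]).toContinuousLinearMap with hf'
  have hα : ∀ q ∈ A, a ≤ ⟪b 2, v⟫_ℝ + q.2 * ⟪b 2, w⟫_ℝ := by
    intro q hq
    have := h1 q hq
    rwa [inner_add_right, inner_smul_right, ← hb2, ← hb2] at this
  have hderiv : ∀ q ∈ A, HasFDerivWithinAt (fun q => (f 0 q, f 1 q)) (f' q) A q := by
    intro q hq
    have hne : ⟪b 2, v⟫_ℝ + q.2 * ⟪b 2, w⟫_ℝ ≠ 0 := (ha.trans_le (hα q hq)).ne'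
    rw [hf']
    simp only
    rw [Matrix.toLin_finTwoProd_toContinuousLinearMap]
    exact ((hasFDerivAt_centralProjection _ _ _ _ _ _ _ _ hne).prodMk
      (hasFDerivAt_centralProjection _ _ _ _ _ _ _ _ hne)).hasFDerivWithinAt
  refine (addHaar_image_le_lintegral_abs_det_fderiv volume hA hderiv).trans ?_
  rw [← setLIntegral_const]
  refine setLIntegral_mono measurable_const fun q hq => ENNReal.ofReal_le_ofReal ?_
  have hdet : (f' q).det = M q 0 0 * M q 1 1 - M q 0 1 * M q 1 0 := by
    simp only [hf', LinearMap.det_toContinuousLinearMap, LinearMap.det_toLin,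
      Matrix.det_fin_two_of]
  set α := ⟪b 2, v⟫_ℝ + q.2 * ⟪b 2, w⟫_ℝ with hαdef
  have hαa := hα q hq
  have hαpos : 0 < α := ha.trans_le hαa
  set V := v + q.2 • w with hV
  have hVk : ∀ k, ⟪b k, V⟫_ℝ = ⟪b k, v⟫_ℝ + q.2 * ⟪b k, w⟫_ℝ := fun k => by
    rw [hV, inner_add_right, inner_smul_right]
  set Hq := H + q.1 * ⟪b 2, e⟫_ℝ with hHq
  set Δ := ⟪b 0, e⟫_ℝ * (⟪b 1, V⟫_ℝ * ⟪b 2, w⟫_ℝ - ⟪b 2, V⟫_ℝ * ⟪b 1, w⟫_ℝ) -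
    ⟪b 1, e⟫_ℝ * (⟪b 0, V⟫_ℝ * ⟪b 2, w⟫_ℝ - ⟪b 2, V⟫_ℝ * ⟪b 0, w⟫_ℝ) +
    ⟪b 2, e⟫_ℝ * (⟪b 0, V⟫_ℝ * ⟪b 1, w⟫_ℝ - ⟪b 1, V⟫_ℝ * ⟪b 0, w⟫_ℝ) with hΔ
  -- The Jacobian is the determinant `Δ` of `e`, `V` and `w`, up to a scalar.
  have hdet' : (f' q).det = Hq / α ^ 2 * Δ := by
    rw [hdet, hΔ, hVk, hVk, hVk, ← hαdef]
    simp only [hM, Matrix.cons_val_zero, Matrix.cons_val_one]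
    rw [← hαdef, ← hHq]
    field_simp
    ring
  have hΔle : |Δ| ≤ ‖V‖ * ‖w‖ := by
    refine abs_le_of_sq_le_sq ?_ (by positivity)
    have := sq_det_le ⟪b 0, e⟫_ℝ ⟪b 1, e⟫_ℝ ⟪b 2, e⟫_ℝ ⟪b 0, V⟫_ℝ ⟪b 1, V⟫_ℝ ⟪b 2, V⟫_ℝ
      ⟪b 0, w⟫_ℝ ⟪b 1, w⟫_ℝ ⟪b 2, w⟫_ℝ
    rw [← norm_sq_eq_sum, ← norm_sq_eq_sum, ← norm_sq_eq_sum, he] at this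
    rw [hΔ]
    linarith [mul_pow ‖V‖ ‖w‖ 2]
  have hD : |Hq| / α * ‖V‖ ≤ D := by
    have := h2 q hq
    rw [shadowPoint, sub_sub_cancel, norm_smul, Real.norm_eq_abs, abs_div, height_add_smul] at this
    rwa [← hb2, ← hb2, hVk, ← hαdef, abs_of_pos hαpos] at this
  rw [hdet', abs_mul, abs_div, abs_of_pos (pow_pos hαpos 2)]
  calc |Hq| / α ^ 2 * |Δ| ≤ |Hq| / α ^ 2 * (‖V‖ * ‖w‖) := by gcongr
    _ = (|Hq| / α * ‖V‖) * ‖w‖ / α := by field_simp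
    _ ≤ D * ‖w‖ / a := by
      have : 0 ≤ D := le_trans (by positivity) hD
      gcongr

end TriangulatedObject

namespace TriangulatedObject

variable (O : TriangulatedObject)

/-- The unit vector along an edge. -/
def edgeDir (e : Fin O.N × Fin 3) : E3 :=
  ‖(O.face e.1).points (e.2 + 2) - (O.face e.1).points (e.2 + 1)‖⁻¹ •
    ((O.face e.1).points (e.2 + 2) - (O.face e.1).points (e.2 + 1))

/-- The line of an edge, parametrized by arc length. -/
def edgePoint (e : Fin O.N × Fin 3) (s : ℝ) : E3 := (O.face e.1).points (e.2 + 1) + s • O.edgeDir e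

lemma edge_length_pos (e : Fin O.N × Fin 3) :
    0 < ‖(O.face e.1).points (e.2 + 2) - (O.face e.1).points (e.2 + 1)‖ := by
  rw [norm_pos_iff, sub_ne_zero]
  intro h
  have := (O.face e.1).independent.injective h
  simp at this

lemma norm_edgeDir (e : Fin O.N × Fin 3) : ‖O.edgeDir e‖ = 1 := by
  rw [edgeDir, norm_smul, norm_inv, norm_norm, inv_mul_cancel₀ (O.edge_length_pos e).ne']

lemma isometry_edgePoint (e : Fin O.N × Fin 3) : Isometry (O.edgePoint e) := by
  refine Isometry.of_dist_eq fun s t => ?_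
  rw [edgePoint, edgePoint, dist_add_left, dist_eq_norm, ← sub_smul, norm_smul, norm_edgeDir,
    mul_one, Real.dist_eq, Real.norm_eq_abs]

lemma exists_edgePoint {e : Fin O.N × Fin 3} {z : E3} (hz : z ∈ O.edge e.1 e.2) :
    ∃ s, O.edgePoint e s = z := by
  rw [edge, segment_eq_image'] at hz
  obtain ⟨t, -, rfl⟩ := hz
  refine ⟨t * ‖(O.face e.1).points (e.2 + 2) - (O.face e.1).points (e.2 + 1)‖, ?_⟩
  rw [edgePoint, edgeDir, smul_smul, mul_assoc, mul_inv_cancel₀ (O.edge_length_pos e).ne', mul_one]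

/-- Part of an edge; every point of the union of the edges is in exactly one of these parts. -/
def edgePiece (e : Fin O.N × Fin 3) : Set E3 :=
  {z | z ∈ O.edge e.1 e.2 ∧
    ∀ e', Fintype.equivFin _ e' < Fintype.equivFin _ e → z ∉ O.edge e'.1 e'.2}

lemma measurableSet_edgePiece (e : Fin O.N × Fin 3) : MeasurableSet (O.edgePiece e) := by
  have h : ∀ e : Fin O.N × Fin 3, MeasurableSet (O.edge e.1 e.2) := fun e => by
    rw [edge, segment_eq_image_lineMap]
    exact (isCompact_Icc.image AffineMap.lineMap_continuous).isClosed.measurableSet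
  have hset : {z : E3 | ∀ e', Fintype.equivFin _ e' < Fintype.equivFin _ e → z ∉ O.edge e'.1 e'.2} =
      ⋂ e', ⋂ (_ : Fintype.equivFin _ e' < Fintype.equivFin _ e), (O.edge e'.1 e'.2)ᶜ := by
    ext z; simp
  have hm := MeasurableSet.iInter fun e' => MeasurableSet.iInter
    fun _ : Fintype.equivFin _ e' < Fintype.equivFin _ e => (h e').compl
  rw [← hset] at hm
  exact (h e).inter hm

lemma exists_mem_edgePiece {z : E3} (hz : ∃ j k, z ∈ O.edge j k) : ∃ e, z ∈ O.edgePiece e := by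
  classical
  obtain ⟨j, k, hjk⟩ := hz
  obtain ⟨e, he, hmin⟩ := Finset.exists_min_image
    (Finset.univ.filter fun e : Fin O.N × Fin 3 => z ∈ O.edge e.1 e.2)
    (fun e => Fintype.equivFin _ e) ⟨(j, k), by simpa using hjk⟩
  refine ⟨e, (Finset.mem_filter.1 he).2, fun e' hlt hmem => ?_⟩
  exact absurd (hmin e' (by simpa using hmem)) (not_le.2 hlt)

lemma eq_of_mem_edgePiece {e e' : Fin O.N × Fin 3} {z : E3} (h : z ∈ O.edgePiece e)
    (h' : z ∈ O.edgePiece e') : e = e' := by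
  refine (Fintype.equivFin (Fin O.N × Fin 3)).injective (le_antisymm ?_ ?_)
  · exact not_lt.1 fun hlt => h.2 e' hlt h'.1
  · exact not_lt.1 fun hlt => h'.2 e hlt h.1

/-- The lit part of a face is open in the face, so that nearness to it may be tested on a countable
dense set of points. -/
lemma measurableSet_mem_closure_lit (i : Fin O.N) : MeasurableSet {p : E3 × E3 |
    p.1 ∈ closure {y | y ∈ openTriangle (O.face i) ∧ O.Lit y p.2}} := by
  obtain ⟨s, hsc, hsd⟩ := TopologicalSpace.exists_countable_dense (openTriangle (O.face i))
  have h : {p : E3 × E3 | p.1 ∈ closure {y | y ∈ openTriangle (O.face i) ∧ O.Lit y p.2}} =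
      ⋂ n : ℕ, ⋃ y ∈ s, {p : E3 × E3 | dist (y : E3) p.1 < 1 / ((n : ℝ) + 1) ∧ O.Lit y p.2} := by
    ext ⟨x, v⟩
    simp only [mem_ofPred_eq, mem_iInter, mem_iUnion, exists_prop]
    constructor
    · intro hx n
      obtain ⟨y, hy, hd⟩ := Metric.mem_closure_iff.1 hx (1 / ((n : ℝ) + 1)) (by positivity)
      have e1 : ∀ᶠ y' in 𝓝 y, (y' ∈ openTriangle (O.face i) → O.Lit y' v) ∧
          dist y' x < 1 / ((n : ℝ) + 1) := by
        have h1 := O.eventually_lit hy.1 hy.2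
        have h2 : Tendsto (fun y' : E3 => (y', v)) (𝓝 y) (𝓝 (y, v)) :=
          (continuous_id.prodMk continuous_const).tendsto y
        refine (h2.eventually h1).and ?_
        refine (isOpen_lt (by fun_prop) continuous_const).mem_nhds ?_
        rw [mem_ofPred_eq, dist_comm]; exact hd
      have e2 : ∀ᶠ y' : openTriangle (O.face i) in 𝓝 ⟨y, hy.1⟩,
          ((y' : E3) ∈ openTriangle (O.face i) → O.Lit y' v) ∧
            dist (y' : E3) x < 1 / ((n : ℝ) + 1) :=
        (continuous_subtype_val.tendsto (⟨y, hy.1⟩ : openTriangle (O.face i))).eventually e1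
      obtain ⟨y', hy', hys⟩ := mem_closure_iff_nhds.1 (hsd ⟨y, hy.1⟩) _ e2
      exact ⟨y', hys, hy'.2, hy'.1 y'.2⟩
    · intro hx
      rw [Metric.mem_closure_iff]
      intro ε hε
      obtain ⟨n, hn⟩ := exists_nat_one_div_lt hε
      obtain ⟨y, -, hd, hl⟩ := hx n
      exact ⟨y, ⟨y.2, hl⟩, by rw [dist_comm]; exact hd.trans hn⟩
  rw [h]
  refine MeasurableSet.iInter fun n => MeasurableSet.biUnion hsc fun y _ =>
    MeasurableSet.inter ?_ ?_
  · have hd : Measurable fun p : E3 × E3 => dist (y : E3) p.1 := by fun_prop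
    exact measurableSet_lt hd measurable_const
  · exact (measurable_const.prodMk measurable_snd : Measurable fun p : E3 × E3 => ((y : E3), p.2))
      O.measurableSet_lit

/-- The parameters `(s, τ)` for which the point at arc length `s` on the edge `e` casts a shadow
boundary on the face `i` under light from the direction `v + τ w`. -/
def sweepSet (v w : E3) (i : Fin O.N) (e : Fin O.N × Fin 3) : Set (ℝ × ℝ) :=
  {q | q.2 ∈ Icc (0 : ℝ) 1 ∧ 0 < ⟪O.normal i, v + q.2 • w⟫_ℝ ∧
    0 < O.height i (O.edgePoint e q.1) ∧ O.edgePoint e q.1 ∈ O.edgePiece e ∧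
    O.shadowPoint i (O.edgePoint e q.1) (v + q.2 • w) ∈ openTriangle (O.face i) ∧
    O.Clear (O.shadowPoint i (O.edgePoint e q.1) (v + q.2 • w)) (O.edgePoint e q.1) ∧
    O.shadowPoint i (O.edgePoint e q.1) (v + q.2 • w) ∈
      closure {y | y ∈ openTriangle (O.face i) ∧ O.Lit y (v + q.2 • w)}}

lemma measurableSet_sweepSet (v w : E3) (i : Fin O.N) (e : Fin O.N × Fin 3) :
    MeasurableSet (O.sweepSet v w i e) := by
  have hz : Measurable fun q : ℝ × ℝ => O.edgePoint e q.1 := by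
    unfold edgePoint; fun_prop
  have hv : Measurable fun q : ℝ × ℝ => v + q.2 • w := by fun_prop
  have hh : Measurable fun q : ℝ × ℝ => O.height i (O.edgePoint e q.1) :=
    (O.continuous_height i).measurable.comp hz
  have hn : Measurable fun q : ℝ × ℝ => ⟪O.normal i, v + q.2 • w⟫_ℝ := by fun_prop
  have hx : Measurable fun q : ℝ × ℝ => O.shadowPoint i (O.edgePoint e q.1) (v + q.2 • w) :=
    hz.sub ((hh.div hn).smul hv)
  refine MeasurableSet.inter (measurable_snd measurableSet_Icc) ?_
  refine MeasurableSet.inter (measurableSet_lt measurable_const hn) ?_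
  refine MeasurableSet.inter (measurableSet_lt measurable_const hh) ?_
  refine MeasurableSet.inter (hz (O.measurableSet_edgePiece e)) ?_
  refine MeasurableSet.inter (hx (O.measurableSet_openTriangle i)) ?_
  refine MeasurableSet.inter ((hx.prodMk hz) O.measurableSet_clear) ?_
  exact (hx.prodMk hv) (O.measurableSet_mem_closure_lit i)

lemma shadowPoint_add (i : Fin O.N) (z v : E3) :
    O.shadowPoint i z v + (O.height i z / ⟪O.normal i, v⟫_ℝ) • v = z := by
  rw [shadowPoint, sub_add_cancel]

lemma edge_subset_frontier (j : Fin O.N) (k : Fin 3) : O.edge j k ⊆ frontier O.body := by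
  refine Subset.trans ?_ (O.closedTriangle_subset_frontier j)
  exact (convex_convexHull ℝ _).segment_subset (subset_convexHull ℝ _ (mem_range_self _))
    (subset_convexHull ℝ _ (mem_range_self _))

/-- A point which the light from exactly one of two directions reaches is swept over by a shadow
boundary, as the direction of the light moves from the one to the other. -/
lemma exists_mem_sweepSet {v w x : E3} {i : Fin O.N} (hx : x ∈ openTriangle (O.face i))
    (h0 : 0 < ⟪O.normal i, v⟫_ℝ) (h1 : 0 < ⟪O.normal i, v + w⟫_ℝ)
    (hl : ¬ (O.Lit x v ↔ O.Lit x (v + w))) :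
    ∃ e, ∃ q ∈ O.sweepSet v w i e, O.shadowPoint i (O.edgePoint e q.1) (v + q.2 • w) = x := by
  have hcont : Continuous fun τ : ℝ => v + τ • w := by fun_prop
  have hm0 : (0 : ℝ) ∈ Icc (0 : ℝ) 1 := by simp
  have hm1 : (1 : ℝ) ∈ Icc (0 : ℝ) 1 := by simp
  -- At the frontier of the lit times the point is dark, and a limit of lit points.
  obtain ⟨τ, hτ, hfr⟩ : (Icc (0 : ℝ) 1 ∩ frontier {τ : ℝ | O.Lit x (v + τ • w)}).Nonempty := by
    by_cases hv : O.Lit x v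
    · have hvw : ¬ O.Lit x (v + w) := fun h => hl ⟨fun _ => h, fun _ => hv⟩
      exact inter_frontier_nonempty_of_isPreconnected isPreconnected_Icc
        ⟨0, hm0, by simpa using hv⟩ ⟨1, hm1, by simpa using hvw⟩
    · have hvw : O.Lit x (v + w) := by
        by_contra h; exact hl ⟨fun h' => absurd h' hv, fun h' => absurd h' h⟩
      exact inter_frontier_nonempty_of_isPreconnected isPreconnected_Icc
        ⟨1, hm1, by simpa using hvw⟩ ⟨0, hm0, by simpa using hv⟩
  have hn : 0 < ⟪O.normal i, v + τ • w⟫_ℝ := by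
    rw [inner_add_right] at h1 ⊢
    rw [inner_smul_right]
    rcases hτ.2.eq_or_lt with h | h
    · rwa [h, one_mul]
    · nlinarith [hτ.1, mul_pos (sub_pos.2 h) h0, mul_nonneg hτ.1 h1.le]
  have hdark : ¬ O.Lit x (v + τ • w) := by
    intro hlit
    refine hfr.2 (mem_interior_iff_mem_nhds.2 ?_)
    have h2 := O.eventually_lit hx hlit
    have h3 : Tendsto (fun τ : ℝ => (x, v + τ • w)) (𝓝 τ) (𝓝 (x, v + τ • w)) :=
      (continuous_const.prodMk hcont).tendsto τ
    filter_upwards [h3.eventually h2] with τ' hτ'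
    exact hτ' hx
  have hcl : x ∈ closure {y | y ∈ openTriangle (O.face i) ∧ O.Lit y (v + τ • w)} := by
    refine O.mem_closure_lit hx hn ?_
    exact map_mem_closure (f := fun τ : ℝ => v + τ • w) hcont hfr.1 fun τ' hτ' => hτ'
  obtain ⟨T, hT, hz, hc⟩ := O.exists_first_hit hx hn hdark
  obtain ⟨e, he⟩ := O.exists_mem_edgePiece
    (O.exists_mem_edge hT (closure_mono (fun y hy => hy.2) hcl) hc hz)
  obtain ⟨s, hs⟩ := O.exists_edgePoint he.1
  have hh : O.height i (x + T • (v + τ • w)) = T * ⟪O.normal i, v + τ • w⟫_ℝ := by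
    rw [height_add_smul, ((O.mem_openTriangle_iff i x).1 hx).1, zero_add]
  have hsp : O.shadowPoint i (x + T • (v + τ • w)) (v + τ • w) = x := by
    rw [shadowPoint, hh, mul_div_assoc, div_self hn.ne', mul_one, add_sub_cancel_right]
  refine ⟨e, (s, τ), ?_, ?_⟩
  · simp only [sweepSet, mem_ofPred_eq, hs, hsp, hh]
    exact ⟨hτ, hn, mul_pos hT hn, he, hx, hc, hcl⟩
  · simp only [hs, hsp]

end TriangulatedObject

namespace LambertianObject

open TriangulatedObject

variable (O : LambertianObject)

/-- For each direction of the light, the points that cast shadow boundaries on the different faces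
are different points of `χ`. -/
lemma sum_volume_section_le {v w : E3} {τ : ℝ} (hτ : v + τ • w ≠ 0) :
    ∑ p : Fin O.N × (Fin O.N × Fin 3), volume {s | (s, τ) ∈ O.sweepSet v w p.1 p.2} ≤
      ENNReal.ofReal O.maxShadowingLength := by
  set V := v + τ • w with hV
  have hVn : 0 < ‖V‖ := norm_pos_iff.2 hτ
  set u : S2 := ⟨‖V‖⁻¹ • V, by
    rw [mem_sphere_zero_iff_norm, norm_smul, norm_inv, norm_norm, inv_mul_cancel₀ hVn.ne']⟩ with hu
  have hVu : V = ‖V‖ • (u : E3) := by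
    rw [hu, smul_smul, mul_inv_cancel₀ hVn.ne', one_smul]
  set Z : Fin O.N × (Fin O.N × Fin 3) → Set E3 := fun p =>
    O.edgePoint p.2 '' {s | (s, τ) ∈ O.sweepSet v w p.1 p.2} with hZ
  have hmeas : ∀ p : Fin O.N × (Fin O.N × Fin 3),
      MeasurableSet {s | (s, τ) ∈ O.sweepSet v w p.1 p.2} := fun p =>
    (measurable_prodMk_right : Measurable fun s : ℝ => (s, τ))
      (O.measurableSet_sweepSet v w p.1 p.2)
  have hvol : ∀ p, volume {s | (s, τ) ∈ O.sweepSet v w p.1 p.2} =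
      Measure.hausdorffMeasure 1 (Z p) := by
    intro p
    rw [hZ, (O.isometry_edgePoint p.2).hausdorffMeasure_image (Or.inl zero_le_one),
      hausdorffMeasure_real]
  have hZm : ∀ p, MeasurableSet (Z p) := fun p =>
    (O.isometry_edgePoint p.2).isClosedEmbedding.measurableEmbedding.measurableSet_image.2 (hmeas p)
  have hdisj : Pairwise (Function.onFun Disjoint Z) := by
    rintro ⟨i, e⟩ ⟨i', e'⟩ hne
    rw [Function.onFun, disjoint_left]
    rintro _ ⟨s, hs, rfl⟩ ⟨s', hs', hss⟩
    obtain ⟨-, a1, a2, a3, a4, a5, -⟩ := hs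
    obtain ⟨-, b1, b2, b3, b4, b5, -⟩ := hs'
    simp only at a1 a2 a3 a4 a5 b1 b2 b3 b4 b5 hss
    rw [hss] at b2 b3 b4 b5
    have hee := O.eq_of_mem_edgePiece a3 b3
    rw [← hV] at a1 a4 a5 b1 b4 b5
    set z := O.edgePoint e s
    -- Two points on the same ray cannot both have `z` as their first obstacle.
    have key : ∀ t t' : ℝ, 0 < t → t < t' → z - t • V ∈ O.body →
        O.Clear (z - t' • V) z → False := by
      intro t t' ht htt hb hc
      have hc' : O.Clear (z - t' • V) (z - t' • V + t' • V) := by rwa [sub_add_cancel]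
      have := O.notMem_of_clear hc' (t := t' - t) (by linarith) (by linarith)
      have he : z - t' • V + (t' - t) • V = z - t • V := by module
      rw [he] at this
      exact this hb
    have ht1 := div_pos a2 a1
    have ht2 := div_pos b2 b1
    have htt : O.height i z / ⟪O.normal i, V⟫_ℝ = O.height i' z / ⟪O.normal i', V⟫_ℝ := by
      rcases lt_trichotomy (O.height i z / ⟪O.normal i, V⟫_ℝ)
        (O.height i' z / ⟪O.normal i', V⟫_ℝ) with h | h | h
      · exact (key _ _ ht1 h (O.mem_body_of_mem_openTriangle a4) b5).elim
      · exact h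
      · exact (key _ _ ht2 h (O.mem_body_of_mem_openTriangle b4) a5).elim
    have hii : i = i' := by
      refine O.eq_of_mem_openTriangle a4 ?_
      rw [shadowPoint, htt]
      exact b4
    exact hne (Prod.ext hii hee)
  simp_rw [hvol]
  rw [← tsum_fintype (L := .unconditional _), ← measure_iUnion hdisj hZm]
  refine (measure_mono ?_).trans (O.hausdorffMeasure_shadowingEdges_le u)
  refine iUnion_subset ?_
  rintro ⟨i, e⟩ _ ⟨s, hs, rfl⟩
  obtain ⟨-, a1, a2, a3, a4, a5, a6⟩ := hs
  simp only at a1 a2 a3 a4 a5 a6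
  rw [← hV] at a1 a4 a5 a6
  have hz := O.shadowPoint_add i (O.edgePoint e s) V
  have := O.mem_shadowingEdges hVn hVu a4 a6 (div_pos a2 a1)
    (by rw [hz]; exact a5) (by rw [hz]; exact O.edge_subset_frontier _ _ a3.1)
  rwa [hz] at this

/-- The set of all sweeping parameters, integrated over the direction of the light, has measure at
most `χ⋆`. -/
lemma sum_volume_sweepSet_le {v w : E3} (h : ∀ τ ∈ Icc (0 : ℝ) 1, v + τ • w ≠ 0) :
    ∑ p : Fin O.N × (Fin O.N × Fin 3), volume (O.sweepSet v w p.1 p.2) ≤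
      ENNReal.ofReal O.maxShadowingLength := by
  have hvol : ∀ p : Fin O.N × (Fin O.N × Fin 3), volume (O.sweepSet v w p.1 p.2) =
      ∫⁻ τ in Icc (0 : ℝ) 1, volume {s | (s, τ) ∈ O.sweepSet v w p.1 p.2} := by
    intro p
    rw [Measure.volume_eq_prod ℝ ℝ, Measure.prod_apply_symm (O.measurableSet_sweepSet v w p.1 p.2),
      ← lintegral_indicator measurableSet_Icc]
    refine lintegral_congr fun τ => ?_
    by_cases hτ : τ ∈ Icc (0 : ℝ) 1
    · rw [indicator_of_mem hτ]; rfl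
    · rw [indicator_of_notMem hτ]
      refine measure_mono_null (t := ∅) (fun s hs => ?_) measure_empty
      exact hτ hs.1
  have hm : ∀ p : Fin O.N × (Fin O.N × Fin 3),
      Measurable fun τ => volume {s | (s, τ) ∈ O.sweepSet v w p.1 p.2} := fun p =>
    measurable_measure_prodMk_right (O.measurableSet_sweepSet v w p.1 p.2)
  simp_rw [hvol]
  rw [← lintegral_finsetSum _ fun p _ => hm p]
  refine (setLIntegral_mono measurable_const fun τ hτ => O.sum_volume_section_le (h τ hτ)).trans ?_
  simp

end LambertianObject

/-! ### Hölder continuity of the images -/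

lemma sq_norm_sphere_sub (u u' : S2) :
    2 * ⟪(u : E3), (u' : E3) - u⟫_ℝ = -‖(u' : E3) - u‖ ^ 2 := by
  have h := norm_add_sq_real (u : E3) ((u' : E3) - u)
  rw [add_sub_cancel, norm_eq_of_mem_sphere, norm_eq_of_mem_sphere] at h
  linarith

/-- The chord between two directions at distance at most `√2` avoids the origin, so that it may
serve as a path of directions. -/
lemma chord_ne_zero {u u' : S2} (h : ‖(u' : E3) - u‖ ≤ Real.sqrt 2) (τ : ℝ) :
    (u : E3) + τ • ((u' : E3) - u) ≠ 0 := by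
  intro h0
  have h1 := norm_add_sq_real (u : E3) (τ • ((u' : E3) - u))
  rw [h0, norm_zero, norm_eq_of_mem_sphere, inner_smul_right, norm_smul, Real.norm_eq_abs, mul_pow,
    sq_abs] at h1
  have h2 := sq_norm_sphere_sub u u'
  have h3 : ‖(u' : E3) - u‖ ^ 2 ≤ 2 := by
    calc _ ≤ Real.sqrt 2 ^ 2 := by gcongr
      _ = 2 := Real.sq_sqrt zero_le_two
  nlinarith [sq_nonneg (τ - 1 / 2)]

namespace TriangulatedObject

variable (O : TriangulatedObject)

lemma surfaceMeasure_of_subset {i : Fin O.N} {B : Set E3} (hB : B ⊆ openTriangle (O.face i))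
    (hm : MeasurableSet B) : O.surfaceMeasure B = volume (O.facePoint i ⁻¹' B) := by
  rw [← lintegral_indicator_one hm, O.lintegral_surfaceMeasure (measurable_one.indicator hm),
    Finset.sum_eq_single i]
  · rw [← lintegral_indicator_one ((O.continuous_facePoint i).measurable hm)]
    refine lintegral_congr fun w => ?_
    by_cases hw : O.facePoint i w ∈ B
    · rw [indicator_of_mem (hB hw), indicator_of_mem hw, indicator_of_mem (show w ∈ _ from hw)]
      rfl
    · rw [indicator_of_notMem (show w ∉ O.facePoint i ⁻¹' B from hw)]
      by_cases hw' : O.facePoint i w ∈ openTriangle (O.face i)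
      · rw [indicator_of_mem hw', indicator_of_notMem hw]
      · rw [indicator_of_notMem hw']
  · intro j _ hj
    refine (lintegral_congr fun w => ?_).trans lintegral_zero
    by_cases hw : O.facePoint j w ∈ openTriangle (O.face j)
    · rw [indicator_of_mem hw, indicator_of_notMem]
      exact fun h => hj (O.eq_of_mem_openTriangle hw (hB h))
    · rw [indicator_of_notMem hw]
  · simp

/-- The points of the face `i` which the light reaches from exactly one of the directions `u` and
`u'`, if both directions are far from grazing. -/
def unsteady (u u' : S2) (i : Fin O.N) : Set E3 :=
  {x | x ∈ openTriangle (O.face i) ∧ (0 < ⟪O.normal i, (u : E3)⟫_ℝ ∧ 0 < ⟪O.normal i, (u' : E3)⟫_ℝ ∧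
    Real.sqrt 2 * ‖(u' : E3) - u‖ < max ⟪O.normal i, (u : E3)⟫_ℝ ⟪O.normal i, (u' : E3)⟫_ℝ) ∧
    ¬ (O.Lit x u ↔ O.Lit x u')}

lemma measurableSet_unsteady (u u' : S2) (i : Fin O.N) : MeasurableSet (O.unsteady u u' i) := by
  have h : ∀ u : S2, MeasurableSet {x | O.Lit x u} := fun u =>
    (measurable_prodMk_right : Measurable fun x : E3 => (x, (u : E3))) O.measurableSet_lit
  refine (O.measurableSet_openTriangle i).inter ((MeasurableSet.const _).inter ?_)
  exact ((h u).iff (h u')).compl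

lemma abs_inner_normal_sub_le (u u' : E3) (i : Fin O.N) :
    |⟪O.normal i, u⟫_ℝ - ⟪O.normal i, u'⟫_ℝ| ≤ ‖u' - u‖ := by
  have h := abs_real_inner_le_norm (O.normal i) (u - u')
  rwa [O.norm_normal, one_mul, inner_sub_right, norm_sub_rev] at h

lemma inner_normal_le_one (u : S2) (i : Fin O.N) : ⟪O.normal i, (u : E3)⟫_ℝ ≤ 1 := by
  have h := real_inner_le_norm (O.normal i) (u : E3)
  rwa [O.norm_normal, one_mul, norm_eq_of_mem_sphere] at h

/-- The area of the face which changes between light and shadow, weighted with the square of the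
cosine. The weight compensates the growth of the swept area near grazing light. -/
lemma measure_unsteady_le (u u' : S2) (i : Fin O.N) :
    ENNReal.ofReal (max ⟪O.normal i, (u : E3)⟫_ℝ ⟪O.normal i, (u' : E3)⟫_ℝ ^ 2) *
        O.surfaceMeasure (O.unsteady u u' i) ≤
      ENNReal.ofReal (4 * Metric.diam O.body * ‖(u' : E3) - u‖) *
        ∑ e, volume (O.sweepSet u ((u' : E3) - u) i e) := by
  set w := (u' : E3) - u with hw
  set d := ‖w‖
  set a := ⟪O.normal i, (u : E3)⟫_ℝ
  set a' := ⟪O.normal i, (u' : E3)⟫_ℝ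
  set m := max a a' with hm
  set D := Metric.diam O.body
  have hD : 0 ≤ D := Metric.diam_nonneg
  have hd : 0 ≤ d := norm_nonneg _
  by_cases hc : 0 < a ∧ 0 < a' ∧ Real.sqrt 2 * d < m
  swap
  · have : O.unsteady u u' i = ∅ := by
      refine eq_empty_of_forall_notMem fun x hx => hc hx.2.1
    rw [this, measure_empty, mul_zero]
    exact zero_le
  obtain ⟨ha, ha', hmd⟩ := hc
  have had := abs_le.1 (O.abs_inner_normal_sub_le (u : E3) (u' : E3) i)
  -- Far from grazing, `m ^ 2 / (m - d) ≤ 4`.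
  have h43 : 4 / 3 * d ≤ m := by
    have : (4 / 3 : ℝ) ≤ Real.sqrt 2 := Real.le_sqrt_of_sq_le (by norm_num)
    nlinarith
  have hm0 : 0 < m := lt_max_of_lt_left ha
  have hm1 : m ≤ 1 := max_le (O.inner_normal_le_one u i) (O.inner_normal_le_one u' i)
  have hmd0 : 0 < m - d := by linarith
  have hlow : a ≥ m - d ∧ a' ≥ m - d := by
    rcases max_cases a a' with ⟨h1, h2⟩ | ⟨h1, h2⟩
    · rw [hm, h1]; constructor <;> linarith [had.1, had.2]
    · rw [hm, h1]; constructor <;> linarith [had.1, had.2]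
  have hsub : O.facePoint i ⁻¹' O.unsteady u u' i ⊆ ⋃ e, (fun q : ℝ × ℝ =>
      O.faceCoord i (O.shadowPoint i ((O.face e.1).points (e.2 + 1) + q.1 • O.edgeDir e)
        ((u : E3) + q.2 • w))) '' O.sweepSet u w i e := by
    intro y hy
    obtain ⟨hx, -, hl⟩ := hy
    have e1 : (u' : E3) = u + w := by rw [hw, add_sub_cancel]
    have hl' : ¬ (O.Lit (O.facePoint i y) u ↔ O.Lit (O.facePoint i y) ((u : E3) + w)) := by
      rwa [← e1]
    obtain ⟨e, q, hq, hqx⟩ := O.exists_mem_sweepSet hx ha (by rw [← e1]; exact ha') hl'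
    refine mem_iUnion.2 ⟨e, q, hq, ?_⟩
    have := congrArg (O.faceCoord i) hqx
    rwa [O.faceCoord_facePoint] at this
  have hvol : ∀ e, volume ((fun q : ℝ × ℝ =>
      O.faceCoord i (O.shadowPoint i ((O.face e.1).points (e.2 + 1) + q.1 • O.edgeDir e)
        ((u : E3) + q.2 • w))) '' O.sweepSet u w i e) ≤
      ENNReal.ofReal (D * d / (m - d)) * volume (O.sweepSet u w i e) := by
    intro e
    refine O.volume_shadow_le i _ _ _ _ (O.norm_edgeDir e) (O.measurableSet_sweepSet u w i e)
      hmd0 ?_ ?_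
    · rintro q ⟨hq, -⟩
      have e2 : ⟪O.normal i, (u : E3) + q.2 • w⟫_ℝ = (1 - q.2) * a + q.2 * a' := by
        rw [hw, inner_add_right, inner_smul_right, inner_sub_right]; ring
      rw [e2]
      nlinarith [hq.1, hq.2, mul_nonneg hq.1 (sub_nonneg.2 hlow.2),
        mul_nonneg (sub_nonneg.2 hq.2) (sub_nonneg.2 hlow.1)]
    · rintro q ⟨-, -, -, hz, hx, -⟩
      rw [← dist_eq_norm]
      exact Metric.dist_le_diam_of_mem O.isCompact_body.isBounded
        (O.frontier_subset_body (O.edge_subset_frontier _ _ hz.1))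
        (O.mem_body_of_mem_openTriangle hx)
  rw [O.surfaceMeasure_of_subset (fun x hx => hx.1) (O.measurableSet_unsteady u u' i)]
  calc ENNReal.ofReal (m ^ 2) * volume (O.facePoint i ⁻¹' O.unsteady u u' i)
      ≤ ENNReal.ofReal (m ^ 2) *
          ∑ e, ENNReal.ofReal (D * d / (m - d)) * volume (O.sweepSet u w i e) := by
        gcongr
        refine (measure_mono hsub).trans ((measure_iUnion_le _).trans ?_)
        rw [tsum_fintype]
        exact Finset.sum_le_sum fun e _ => hvol e
    _ = ENNReal.ofReal (m ^ 2 * (D * d / (m - d))) * ∑ e, volume (O.sweepSet u w i e) := by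
        rw [← Finset.mul_sum, ← mul_assoc, ← ENNReal.ofReal_mul (sq_nonneg m)]
    _ ≤ _ := by
        refine mul_le_mul_left (ENNReal.ofReal_le_ofReal ?_) _
        rw [← mul_div_assoc, div_le_iff₀ hmd0]
        have h5 : m ^ 2 ≤ 4 * (m - d) := by nlinarith
        nlinarith [mul_nonneg hD hd]

/-- If one of two close cosines is positive, it is small or both are far from grazing. -/
lemma sq_le_or_not_grazing {a a' d : ℝ} (ha : 0 < a) (h : |a - a'| ≤ d) :
    a ^ 2 ≤ 2 * d ^ 2 ∨ (0 < a' ∧ Real.sqrt 2 * d < max a a') := by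
  have hd : 0 ≤ d := (abs_nonneg _).trans h
  have h' := abs_le.1 h
  by_cases ha' : 0 < a'
  · by_cases hm : Real.sqrt 2 * d < max a a'
    · exact Or.inr ⟨ha', hm⟩
    · left
      have h1 : a ≤ Real.sqrt 2 * d := (le_max_left _ _).trans (not_lt.1 hm)
      calc a ^ 2 ≤ (Real.sqrt 2 * d) ^ 2 := by gcongr
        _ = 2 * d ^ 2 := by rw [mul_pow, Real.sq_sqrt zero_le_two]
  · left
    nlinarith [h'.2, not_lt.1 ha']

open Classical in
/-- Where the light condition does not change, the cosine changes at most by the distance of the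
directions; where it changes at a grazing angle, the cosine itself is small. -/
lemma sq_litCos_sub_le (u u' : S2) {i : Fin O.N} {x : E3} (hx : x ∈ openTriangle (O.face i)) :
    (O.litCos x u - O.litCos x u') ^ 2 ≤ 2 * ‖(u' : E3) - u‖ ^ 2 +
      if x ∈ O.unsteady u u' i then max ⟪O.normal i, (u : E3)⟫_ℝ ⟪O.normal i, (u' : E3)⟫_ℝ ^ 2
      else 0 := by
  have hd := O.abs_inner_normal_sub_le (u : E3) (u' : E3) i
  have hd' : |⟪O.normal i, (u' : E3)⟫_ℝ - ⟪O.normal i, (u : E3)⟫_ℝ| ≤ ‖(u' : E3) - u‖ := by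
    rwa [abs_sub_comm]
  have hif : (0 : ℝ) ≤ if x ∈ O.unsteady u u' i then
      max ⟪O.normal i, (u : E3)⟫_ℝ ⟪O.normal i, (u' : E3)⟫_ℝ ^ 2 else 0 := by
    split_ifs <;> positivity
  set d := ‖(u' : E3) - u‖
  have hd0 : 0 ≤ d := norm_nonneg _
  unfold litCos
  rw [O.normalAt_eq hx]
  by_cases h1 : O.Lit x u <;> by_cases h2 : O.Lit x u'
  · rw [if_pos h1, if_pos h2, mul_one, mul_one, max_eq_left (O.inner_pos_of_lit hx h1).le,
      max_eq_left (O.inner_pos_of_lit hx h2).le]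
    have := sq_le_sq' (neg_le_of_abs_le hd) (le_of_abs_le hd)
    nlinarith
  · have hp := O.inner_pos_of_lit hx h1
    rw [if_pos h1, if_neg h2, mul_one, mul_zero, sub_zero, max_eq_left hp.le]
    rcases sq_le_or_not_grazing hp hd with h | h
    · linarith
    · rw [if_pos ⟨hx, ⟨hp, h⟩, by tauto⟩]
      have := pow_le_pow_left₀ hp.le
        (le_max_left ⟪O.normal i, (u : E3)⟫_ℝ ⟪O.normal i, (u' : E3)⟫_ℝ) 2
      nlinarith
  · have hp := O.inner_pos_of_lit hx h2
    rw [if_neg h1, if_pos h2, mul_one, mul_zero, zero_sub, neg_sq, max_eq_left hp.le]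
    rcases sq_le_or_not_grazing hp hd' with h | ⟨h, h'⟩
    · linarith
    · rw [max_comm] at h'
      rw [if_pos ⟨hx, ⟨h, hp, h'⟩, by tauto⟩]
      have := pow_le_pow_left₀ hp.le
        (le_max_right ⟪O.normal i, (u : E3)⟫_ℝ ⟪O.normal i, (u' : E3)⟫_ℝ) 2
      nlinarith
  · rw [if_neg h1, if_neg h2, mul_zero, mul_zero, sub_zero]
    nlinarith

end TriangulatedObject

namespace LambertianObject

open TriangulatedObject

variable (O : LambertianObject)

/-- The direct reflectance depends on the direction of the light in a Hölder continuous way, in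
the mean square. -/
lemma eLpNorm_directPoint_sub_le {u u' : S2} (h : ‖(u : E3) - u'‖ ≤ Real.sqrt 2) :
    (eLpNorm (O.directPoint u - O.directPoint u') 2 O.surfaceMeasure).toReal ≤
      O.maxAlbedo * Real.sqrt (2 * O.area * ‖(u : E3) - u'‖ ^ 2 +
        4 * Metric.diam O.body * O.maxShadowingLength * ‖(u : E3) - u'‖) := by
  classical
  rw [norm_sub_rev] at h ⊢
  set d := ‖(u' : E3) - u‖ with hd
  set m : Fin O.N → ℝ := fun i => max ⟪O.normal i, (u : E3)⟫_ℝ ⟪O.normal i, (u' : E3)⟫_ℝ with hm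
  have hρ := O.maxAlbedo_nonneg
  have hχ := O.maxShadowingLength_nonneg
  have hD : 0 ≤ Metric.diam O.body := Metric.diam_nonneg
  have harea : 0 ≤ O.area := ENNReal.toReal_nonneg
  have hpt : ∀ x ∈ O.Φ, ‖(O.directPoint u - O.directPoint u') x‖ₑ ^ 2 ≤
      ENNReal.ofReal (O.maxAlbedo ^ 2) * (ENNReal.ofReal (2 * d ^ 2) +
        ∑ i, (O.unsteady u u' i).indicator (fun _ => ENNReal.ofReal (m i ^ 2)) x) := by
    intro x hx
    obtain ⟨i, hi⟩ := O.mem_Φ.1 hx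
    have hxf := O.openTriangle_subset_frontier i hi
    have h1 := O.sq_litCos_sub_le u u' hi
    calc ‖(O.directPoint u - O.directPoint u') x‖ₑ ^ 2
        = ENNReal.ofReal (O.albedo x ^ 2 * (O.litCos x u - O.litCos x u') ^ 2) := by
          rw [Real.enorm_eq_ofReal_abs, ← ENNReal.ofReal_pow (abs_nonneg _), sq_abs, Pi.sub_apply,
            O.directPoint_eq (sphere_ne_zero u), O.directPoint_eq (sphere_ne_zero u'), ← mul_sub,
            mul_pow]
      _ ≤ ENNReal.ofReal (O.maxAlbedo ^ 2 *
            (2 * d ^ 2 + if x ∈ O.unsteady u u' i then m i ^ 2 else 0)) := by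
          refine ENNReal.ofReal_le_ofReal ?_
          have h2 := (O.albedo_pos x hxf).le
          have h3 := O.albedo_le_maxAlbedo hxf
          gcongr
      _ ≤ _ := by
          rw [ENNReal.ofReal_mul (sq_nonneg _), ENNReal.ofReal_add (by positivity)
            (by split_ifs <;> positivity)]
          gcongr
          refine le_trans (le_of_eq ?_) (Finset.single_le_sum (f := fun i =>
            (O.unsteady u u' i).indicator (fun _ => ENNReal.ofReal (m i ^ 2)) x)
            (fun _ _ => zero_le) (Finset.mem_univ i))
          simp only [indicator]
          split_ifs <;> simp
  have hmain : eLpNorm (O.directPoint u - O.directPoint u') 2 O.surfaceMeasure ^ 2 ≤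
      ENNReal.ofReal (O.maxAlbedo ^ 2 *
        (2 * O.area * d ^ 2 + 4 * Metric.diam O.body * O.maxShadowingLength * d)) := by
    rw [eLpNorm_two_sq]
    refine (lintegral_mono_ae (O.ae_mem_Φ.mono hpt)).trans ?_
    have hmeas : ∀ i, Measurable fun x =>
        (O.unsteady u u' i).indicator (fun _ => ENNReal.ofReal (m i ^ 2)) x := fun i =>
      measurable_const.indicator (O.measurableSet_unsteady u u' i)
    have hsum : Measurable fun x => ENNReal.ofReal (2 * d ^ 2) +
        ∑ i, (O.unsteady u u' i).indicator (fun _ => ENNReal.ofReal (m i ^ 2)) x :=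
      measurable_const.add (Finset.measurable_sum _ fun i _ => hmeas i)
    rw [lintegral_const_mul _ hsum,
      lintegral_add_left measurable_const, lintegral_const,
      lintegral_finsetSum _ fun i _ => hmeas i, ENNReal.ofReal_mul (sq_nonneg _)]
    gcongr
    rw [ENNReal.ofReal_add (by positivity) (by positivity)]
    refine add_le_add (le_of_eq ?_) ?_
    · have : O.surfaceMeasure univ = ENNReal.ofReal O.area := by
        rw [area, measureReal_def, ENNReal.ofReal_toReal (measure_ne_top _ _)]
      rw [this, ← ENNReal.ofReal_mul (by positivity)]
      congr 1; ring
    · have hne : ∀ τ ∈ Icc (0 : ℝ) 1, (u : E3) + τ • ((u' : E3) - u) ≠ 0 :=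
        fun τ _ => chord_ne_zero h τ
      have hs := O.sum_volume_sweepSet_le hne
      rw [Fintype.sum_prod_type] at hs
      calc ∑ i, ∫⁻ x, (O.unsteady u u' i).indicator (fun _ => ENNReal.ofReal (m i ^ 2)) x
            ∂O.surfaceMeasure
          ≤ ∑ i, ENNReal.ofReal (4 * Metric.diam O.body * d) *
              ∑ e, volume (O.sweepSet u ((u' : E3) - u) i e) := by
            refine Finset.sum_le_sum fun i _ => ?_
            rw [lintegral_indicator_const (O.measurableSet_unsteady u u' i)]
            exact O.measure_unsteady_le u u' i
        _ ≤ ENNReal.ofReal (4 * Metric.diam O.body * d) * ENNReal.ofReal O.maxShadowingLength := by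
            rw [← Finset.mul_sum]
            gcongr
        _ = _ := by
            rw [← ENNReal.ofReal_mul (by positivity)]
            congr 1; ring
  have hfin := ((O.memLp_directPoint u).sub (O.memLp_directPoint u')).eLpNorm_ne_top
  rw [← ENNReal.ofReal_toReal hfin, ← ENNReal.ofReal_pow ENNReal.toReal_nonneg,
    ENNReal.ofReal_le_ofReal_iff (by positivity)] at hmain
  refine le_of_sq_le_sq ?_ (by positivity)
  rw [mul_pow, Real.sq_sqrt (by positivity)]
  exact hmain

end LambertianObject

/-- The image depends on the direction of the light in a Hölder continuous way. -/
lemma norm_pointImage_sub_le_sqrt {m : ℕ} {O : LambertianObject} {c : Camera m}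
    (hdepth : 0 < O.depth) (hreflect : O.reflectivity < 1) {u u' : S2}
    (h : ‖(u : E3) - u'‖ ≤ Real.sqrt 2) :
    ‖pointImage O c u - pointImage O c u'‖ ≤ imagingGain O c * (O.maxAlbedo *
      Real.sqrt (2 * O.area * ‖(u : E3) - u'‖ ^ 2 +
        4 * Metric.diam O.body * O.maxShadowingLength * ‖(u : E3) - u'‖)) :=
  (norm_pointImage_sub_le hdepth hreflect u u').trans
    (mul_le_mul_of_nonneg_left (O.eLpNorm_directPoint_sub_le h)
      (imagingGain_nonneg hdepth hreflect))

/-- The preceding estimate with weaker constants: the area swept by the shadows has been bounded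
directly on each face, which gives `4` in place of `32 √2` and no factor `2 ^ (1 / 4)`. -/
theorem norm_pointImage_sub_le_of_norm_sub_le {m : ℕ} (O : LambertianObject) (c : Camera m)
    (hdepth : 0 < O.depth) (hreflect : O.reflectivity < 1) (u u' : S2)
    (h : ‖(u : E3) - u'‖ ≤ Real.sqrt 2) :
    ‖pointImage O c u - pointImage O c u'‖ ≤
      (2 : ℝ) ^ (1 / 4 : ℝ) * (c.β * O.maxAlbedo * c.focal * c.side /
        (O.depth * (1 - O.reflectivity))) *
        Real.sqrt (2 * O.area * ‖(u : E3) - u'‖ ^ 2 +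
          32 * Real.sqrt 2 * Metric.diam O.body * O.maxShadowingLength * ‖(u : E3) - u'‖) := by
  refine (norm_pointImage_sub_le_sqrt hdepth hreflect h).trans ?_
  have hg := imagingGain_nonneg (c := c) hdepth hreflect
  have hρ := O.maxAlbedo_nonneg
  have hχ := O.maxShadowingLength_nonneg
  have hD : 0 ≤ Metric.diam O.body := Metric.diam_nonneg
  have h2 : (1 : ℝ) ≤ (2 : ℝ) ^ (1 / 4 : ℝ) := Real.one_le_rpow one_le_two (by norm_num)
  have he : c.β * O.maxAlbedo * c.focal * c.side / (O.depth * (1 - O.reflectivity)) =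
      imagingGain O c * O.maxAlbedo := by
    rw [imagingGain, div_div]; ring
  rw [he, ← mul_assoc]
  nth_rw 1 [← one_mul (imagingGain O c * O.maxAlbedo)]
  have h32 : (4 : ℝ) ≤ 32 * Real.sqrt 2 := by
    have : (1 : ℝ) ≤ Real.sqrt 2 := Real.one_le_sqrt.2 one_le_two
    linarith
  gcongr

/-! ### Images as superpositions of point images -/

lemma continuous_of_le_sqrt_dist {X E : Type*} [PseudoMetricSpace X] [SeminormedAddCommGroup E]
    {F : X → E} {H : ℝ} (h : ∀ x y, ‖F x - F y‖ ≤ H * Real.sqrt (dist x y)) : Continuous F := by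
  refine continuous_iff_continuousAt.2 fun y => tendsto_iff_norm_sub_tendsto_zero.2 ?_
  refine squeeze_zero (fun _ => norm_nonneg _) (fun x => h x y) ?_
  have : Tendsto (fun x => H * Real.sqrt (dist x y)) (𝓝 y) (𝓝 (H * Real.sqrt (dist y y))) :=
    Continuous.tendsto (by fun_prop) y
  simpa using this

/-- A continuous function on the sphere is bounded, so it may be weighted by an integrable one. -/
lemma integrable_smul_of_continuous {E : Type*} [NormedAddCommGroup E]
    [NormedSpace ℝ E] {f : S2 → ℝ} (hf : Integrable f sphereMeasure) {F : S2 → E}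
    (hF : Continuous F) : Integrable (fun u => f u • F u) sphereMeasure := by
  obtain ⟨C, hC⟩ := isCompact_univ.exists_bound_of_continuousOn (f := F) hF.continuousOn
  exact hf.smul_bdd C hF.aestronglyMeasurable (ae_of_all _ fun u => hC u (mem_univ u))

namespace LambertianObject

variable (O : LambertianObject)

/-- Hölder continuity at all distances: the estimate for `‖u - u'‖ ≤ √2` is of the order
`‖u - u'‖ ^ (1 / 2)`, and beyond that distance boundedness suffices. -/
lemma toL2_directPoint_holder : ∃ H : ℝ, 0 ≤ H ∧ ∀ u u' : S2,
    ‖O.toL2 (O.directPoint u) - O.toL2 (O.directPoint u')‖ ≤ H * Real.sqrt (dist u u') := by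
  have hρ := O.maxAlbedo_nonneg
  have hχ := O.maxShadowingLength_nonneg
  have hD : 0 ≤ Metric.diam O.body := Metric.diam_nonneg
  have harea : 0 ≤ O.area := ENNReal.toReal_nonneg
  set M := (eLpNorm (fun _ => (1 : ℝ)) 2 O.surfaceMeasure).toReal
  have hM : 0 ≤ M := ENNReal.toReal_nonneg
  set L := 4 * O.area + 4 * Metric.diam O.body * O.maxShadowingLength with hL
  have hL0 : 0 ≤ L := by positivity
  have hbound : ∀ u : S2, ‖O.toL2 (O.directPoint u)‖ ≤ M := by
    intro u
    rw [toL2_directPoint, Lp.norm_toLp]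
    refine ENNReal.toReal_mono (memLp_const (1 : ℝ)).eLpNorm_ne_top (eLpNorm_mono fun x => ?_)
    rw [Real.norm_eq_abs, abs_of_nonneg (O.directPoint_nonneg u x), norm_one]
    exact O.directPoint_le_one u x
  refine ⟨O.maxAlbedo * Real.sqrt L + 2 * M, by positivity, fun u u' => ?_⟩
  have hdist : dist u u' = ‖(u : E3) - u'‖ := by rw [Subtype.dist_eq, dist_eq_norm]
  rw [hdist]
  set d := ‖(u : E3) - u'‖
  have hd : 0 ≤ d := norm_nonneg _
  have hs : 0 ≤ Real.sqrt d := Real.sqrt_nonneg d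
  rw [add_mul]
  by_cases h : d ≤ Real.sqrt 2
  · have h1 := O.eLpNorm_directPoint_sub_le h
    rw [toL2_directPoint, toL2_directPoint, ← MemLp.toLp_sub, Lp.norm_toLp]
    refine (h1.trans ?_).trans (le_add_of_nonneg_right (by positivity))
    rw [mul_assoc O.maxAlbedo, ← Real.sqrt_mul hL0]
    have h2 : d ≤ 2 := h.trans (Real.sqrt_le_iff.2 ⟨zero_le_two, by norm_num⟩)
    gcongr
    rw [hL]
    nlinarith [mul_nonneg harea (mul_nonneg hd (sub_nonneg.2 h2))]
  · have h1 : 1 ≤ Real.sqrt d :=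
      Real.one_le_sqrt.2 ((Real.one_le_sqrt.2 one_le_two).trans (not_le.1 h).le)
    refine le_add_of_nonneg_of_le (by positivity) ?_
    calc _ ≤ M + M := (norm_sub_le _ _).trans (add_le_add (hbound u) (hbound u'))
      _ ≤ 2 * M * Real.sqrt d := by nlinarith

lemma continuous_toL2_directPoint : Continuous fun u : S2 => O.toL2 (O.directPoint u) := by
  obtain ⟨H, -, h⟩ := O.toL2_directPoint_holder
  exact continuous_of_le_sqrt_dist h

/-- Superposition, in `L²`: the direct reflectance is the average of the direct reflectances for
the single directions. -/
lemma toL2_direct_eq_integral {f : S2 → ℝ} (hf : Integrable f sphereMeasure) :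
    O.toL2 (O.direct f) = ∫ u, f u • O.toL2 (O.directPoint u) ∂sphereMeasure := by
  refine ext_inner_left ℝ fun g => ?_
  rw [← integral_inner (integrable_smul_of_continuous hf O.continuous_toL2_directPoint),
    toL2_direct O hf, L2.inner_def]
  have hg : Integrable (g : E3 → ℝ) O.surfaceMeasure := (Lp.memLp g).integrable one_le_two
  have hint : Integrable (fun p : E3 × S2 => O.directPoint p.2 p.1 * (g p.1 * f p.2))
      (O.surfaceMeasure.prod sphereMeasure) := by
    refine Integrable.bdd_mul (c := 1) (hg.mul_prod hf) ?_ (ae_of_all _ fun p => ?_)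
    · have h : (fun p : E3 × S2 => O.directPoint p.2 p.1) =
          fun p => O.albedo p.1 * O.litCos p.1 p.2 :=
        funext fun p => O.directPoint_eq (TriangulatedObject.sphere_ne_zero p.2) p.1
      rw [h]
      have hm : Measurable fun p : E3 × S2 => O.litCos p.1 p.2 :=
        O.measurable_litCos.comp (f := fun p : E3 × S2 => (p.1, (p.2 : E3)))
          (measurable_fst.prodMk (measurable_subtype_coe.comp measurable_snd))
      exact (O.aemeasurable_albedo.comp_fst.mul hm.aemeasurable).aestronglyMeasurable
    · rw [Real.norm_eq_abs, abs_of_nonneg (O.directPoint_nonneg p.2 p.1)]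
      exact O.directPoint_le_one p.2 p.1
  calc ∫ x, ⟪g x, (O.memLp_direct hf).toLp _ x⟫_ℝ ∂O.surfaceMeasure
      = ∫ x, ∫ u : S2, O.directPoint u x * (g x * f u) ∂sphereMeasure ∂O.surfaceMeasure := by
        refine integral_congr_ae ?_
        filter_upwards [(O.memLp_direct hf).coeFn_toLp] with x hx
        rw [hx, direct, RCLike.inner_apply, conj_trivial, ← integral_mul_const]
        refine integral_congr_ae (ae_of_all _ fun u => ?_)
        ring
    _ = ∫ u : S2, ∫ x, O.directPoint u x * (g x * f u) ∂O.surfaceMeasure ∂sphereMeasure :=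
        integral_integral_swap hint
    _ = ∫ u, ⟪g, f u • O.toL2 (O.directPoint u)⟫_ℝ ∂sphereMeasure := by
        refine integral_congr_ae (ae_of_all _ fun u => ?_)
        simp only [inner_smul_right]
        rw [toL2_directPoint, L2.inner_def, ← integral_const_mul]
        refine integral_congr_ae ?_
        filter_upwards [(O.memLp_directPoint u).coeFn_toLp] with x hx
        rw [hx, RCLike.inner_apply, conj_trivial]
        ring

end LambertianObject

section Superposition

variable {m : ℕ} {O : LambertianObject} {c : Camera m}

lemma pointImage_holder (hdepth : 0 < O.depth) (hreflect : O.reflectivity < 1) :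
    ∃ H : ℝ, 0 ≤ H ∧ ∀ u u' : S2,
      ‖pointImage O c u - pointImage O c u'‖ ≤ H * Real.sqrt (dist u u') := by
  obtain ⟨A, h1, -, h3, -⟩ := exists_imaging O c hdepth hreflect
  obtain ⟨H, hH, h⟩ := O.toL2_directPoint_holder
  have hg := imagingGain_nonneg (c := c) hdepth hreflect
  refine ⟨imagingGain O c * H, by positivity, fun u u' => ?_⟩
  rw [h1, h1, ← map_sub, mul_assoc]
  exact (h3 _).trans (by gcongr; exact h u u')

lemma continuous_pointImage (hdepth : 0 < O.depth) (hreflect : O.reflectivity < 1) :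
    Continuous (pointImage O c) := by
  obtain ⟨H, -, h⟩ := pointImage_holder (c := c) hdepth hreflect
  exact continuous_of_le_sqrt_dist h

/-- Superposition for images: the imaging operator commutes with the integral. -/
lemma image_eq_integral (hdepth : 0 < O.depth) (hreflect : O.reflectivity < 1) {f : S2 → ℝ}
    (hf : Integrable f sphereMeasure) :
    image O c f = ∫ u, f u • pointImage O c u ∂sphereMeasure := by
  obtain ⟨A, h1, h2, -, -⟩ := exists_imaging O c hdepth hreflect
  rw [h2, O.toL2_direct_eq_integral hf, ← A.integral_comp_comm
    (integrable_smul_of_continuous hf O.continuous_toL2_directPoint)]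
  simp_rw [map_smul, h1]

/-- An ambient illumination of level `α` adds `α` times the ambient image. -/
lemma image_add_ambient (hdepth : 0 < O.depth) (hreflect : O.reflectivity < 1) {f : S2 → ℝ}
    (hf : Integrable f sphereMeasure) (α : ℝ) :
    image O c (fun u => f u + α * (1 / sphereMeasure.real univ)) =
      (∫ u, f u • pointImage O c u ∂sphereMeasure) + α • ambientImage O c := by
  have hc := continuous_pointImage (c := c) hdepth hreflect
  have h1 : Integrable (fun _ : S2 => α * (1 / sphereMeasure.real univ)) sphereMeasure :=
    integrable_const _
  rw [image_eq_integral (f := fun u => f u + _) hdepth hreflect (hf.add h1), ambientImage,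
    smul_smul,
    ← integral_smul, ← integral_add (integrable_smul_of_continuous hf hc)
    (integrable_smul_of_continuous h1 hc)]
  simp_rw [add_smul]

end Superposition

/-! ### Covering the sphere -/

lemma abs_mul_sub_mul_le {a b a' b' : ℝ} (ha : |a| ≤ 1) (hb : |b'| ≤ 1) :
    |a * b - a' * b'| ≤ |b - b'| + |a - a'| := by
  calc |a * b - a' * b'| = |a * (b - b') + (a - a') * b'| := by congr 1; ring
    _ ≤ |a| * |b - b'| + |a - a'| * |b'| := by
        rw [← abs_mul, ← abs_mul]; exact abs_add_le _ _
    _ ≤ 1 * |b - b'| + |a - a'| * 1 := by gcongr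
    _ = _ := by ring

/-- Spherical coordinates are Lipschitz continuous. -/
lemma dist_sphericalCoord_le (θ φ θ' φ' : ℝ) :
    dist (sphericalCoord θ φ) (sphericalCoord θ' φ') ≤ 3 * (|θ - θ'| + |φ - φ'|) := by
  have h1 := abs_mul_sub_mul_le (b := Real.sin φ) (a' := Real.cos θ') (Real.abs_cos_le_one θ)
    (Real.abs_sin_le_one φ')
  have h2 := abs_mul_sub_mul_le (b := Real.sin φ) (a' := Real.sin θ') (Real.abs_sin_le_one θ)
    (Real.abs_sin_le_one φ')
  have h3 := Real.abs_cos_sub_cos_le θ θ'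
  have h4 := Real.abs_sin_sub_sin_le θ θ'
  have h5 := Real.abs_cos_sub_cos_le φ φ'
  have h6 := Real.abs_sin_sub_sin_le φ φ'
  set s := |θ - θ'| + |φ - φ'| with hs
  have h0 := abs_nonneg (θ - θ')
  have h0' := abs_nonneg (φ - φ')
  have hx := h1.trans (show _ ≤ s by linarith)
  have hy := h2.trans (show _ ≤ s by linarith)
  have hz := h5.trans (show _ ≤ s by linarith)
  rw [Subtype.dist_eq, EuclideanSpace.dist_eq, Fin.sum_univ_three]
  refine Real.sqrt_le_iff.2 ⟨by positivity, ?_⟩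
  simp only [Real.dist_eq, sphericalCoord]
  have := pow_le_pow_left₀ (abs_nonneg _) hx 2
  have := pow_le_pow_left₀ (abs_nonneg _) hy 2
  have := pow_le_pow_left₀ (abs_nonneg _) hz 2
  simp at *
  nlinarith

/-- A grid of `k` equidistant points on `[0, c]`. -/
lemma exists_grid_near {c x : ℝ} (hx : x ∈ Icc 0 c) {k : ℕ} (hk : 0 < k) :
    ∃ a < k, |x - c * a / k| ≤ c / k := by
  have hk' : (0 : ℝ) < k := Nat.cast_pos.2 hk
  rcases hx.2.eq_or_lt with h | h
  · refine ⟨k - 1, by omega, ?_⟩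
    rw [Nat.cast_sub (by omega), h, Nat.cast_one]
    have : c - c * ((k : ℝ) - 1) / k = c / k := by field_simp; ring
    rw [this, abs_of_nonneg (div_nonneg (hx.1.trans hx.2) hk'.le)]
  · have hc : 0 < c := hx.1.trans_lt h
    have hq : 0 ≤ x * k / c := div_nonneg (mul_nonneg hx.1 hk'.le) hc.le
    refine ⟨⌊x * k / c⌋₊, ?_, ?_⟩
    · rw [Nat.floor_lt hq, div_lt_iff₀ hc]
      nlinarith
    · have h1 := Nat.floor_le hq
      have h2 := (Nat.lt_floor_add_one (x * k / c)).le
      set a := (⌊x * k / c⌋₊ : ℝ)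
      rw [le_div_iff₀ hc] at h1
      rw [div_le_iff₀ hc] at h2
      rw [abs_le]
      constructor
      · rw [← sub_nonneg]
        have : x - c * a / k - -(c / k) = (x * k - a * c + c) / k := by field_simp; ring
        rw [this]
        exact div_nonneg (by linarith) hk'.le
      · rw [← sub_nonneg]
        have : c / k - (x - c * a / k) = (c + a * c - x * k) / k := by field_simp; ring
        rw [this]
        exact div_nonneg (by linarith) hk'.le

lemma angles_mem (u : S2) :
    (angles u).1 ∈ Icc 0 (2 * Real.pi) ∧ (angles u).2 ∈ Icc 0 Real.pi := by
  refine ⟨⟨?_, ?_⟩, Real.arccos_nonneg _, Real.arccos_le_pi _⟩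
  · have := Complex.neg_pi_lt_arg (-((u : E3) 0 + (u : E3) 1 * Complex.I))
    simp only [angles]
    linarith
  · have := Complex.arg_le_pi (-((u : E3) 0 + (u : E3) 1 * Complex.I))
    simp only [angles]
    linarith

/-- The sphere is covered by `n` discs of radius of the order of `1 / √n`: take the directions on
a grid of spherical coordinates. -/
lemma exists_covering {n : ℕ} (hn : 0 < n) :
    ∃ u : Fin n → S2, ∀ v : S2, ∃ i, dist v (u i) ≤ 18 * Real.pi / Real.sqrt n := by
  set k := Nat.sqrt n with hk
  have hk0 : 0 < k := Nat.sqrt_pos.2 hn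
  have hkn : k * k ≤ n := Nat.sqrt_le n
  have hk' : (0 : ℝ) < k := Nat.cast_pos.2 hk0
  -- Only `k ^ 2 ≤ n` of the directions are needed; the formula gives some direction for the others.
  refine ⟨fun j => sphericalCoord (2 * Real.pi * ((j / k : ℕ) : ℝ) / k)
    (Real.pi * ((j % k : ℕ) : ℝ) / k), fun v => ?_⟩
  obtain ⟨h1, h2⟩ := angles_mem v
  obtain ⟨a, ha, ha'⟩ := exists_grid_near h1 hk0
  obtain ⟨b, hb, hb'⟩ := exists_grid_near h2 hk0
  have hab : a * k + b < n := by nlinarith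
  refine ⟨⟨a * k + b, hab⟩, ?_⟩
  have e1 : (a * k + b) / k = a := by
    rw [mul_comm, Nat.mul_add_div hk0, Nat.div_eq_of_lt hb, add_zero]
  have e2 : (a * k + b) % k = b := by
    rw [mul_comm, Nat.mul_add_mod, Nat.mod_eq_of_lt hb]
  simp only [e1, e2]
  have h3 := dist_sphericalCoord_le (angles v).1 (angles v).2 (2 * Real.pi * a / k)
    (Real.pi * b / k)
  rw [sphericalCoord_angles] at h3
  refine h3.trans ?_
  have hsn : Real.sqrt n ≤ 2 * k := by
    refine Real.sqrt_le_iff.2 ⟨by positivity, ?_⟩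
    have h4 : n ≤ (k + k) + k * k := by rw [hk]; have := Nat.sqrt_le_add n; linarith
    have h5 : k ≤ k * k := Nat.le_mul_self k
    have : n ≤ (2 * k) ^ 2 := by nlinarith
    exact_mod_cast this
  have hs0 : 0 < Real.sqrt n := Real.sqrt_pos.2 (Nat.cast_pos.2 hn)
  calc _ ≤ 3 * (2 * Real.pi / k + Real.pi / k) := by gcongr
    _ = 18 * Real.pi / (2 * k) := by field_simp; ring
    _ ≤ 18 * Real.pi / Real.sqrt n := by gcongr

/-! ### Cones of images -/

section Weights

variable {E : Type*} [NormedAddCommGroup E] [NormedSpace ℝ E] [CompleteSpace E] {F : S2 → E}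

/-- A weighted integral of a function is approximated by a weighted sum of its values at sampling
points, if the function varies little around these: every other point hands its weight over to a
sampling point nearby. -/
lemma exists_weights_near_integral (hF : Continuous F) {f : S2 → ℝ}
    (hf : Integrable f sphereMeasure) (hf0 : ∀ v, 0 ≤ f v) {n : ℕ} {u : Fin n → S2} {δ e : ℝ}
    (hcover : ∀ v, ∃ i, dist v (u i) ≤ δ) (he : ∀ v i, dist v (u i) ≤ δ → ‖F v - F (u i)‖ ≤ e) :
    ∃ w : Fin n → ℝ, (∀ i, 0 ≤ w i) ∧ ∑ i, w i = ∫ v, f v ∂sphereMeasure ∧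
      ‖(∫ v, f v • F v ∂sphereMeasure) - ∑ i, w i • F (u i)‖ ≤ e * ∫ v, f v ∂sphereMeasure := by
  set S : Fin n → Set S2 := disjointed fun i => Metric.closedBall (u i) δ with hS
  have hm : ∀ i, MeasurableSet (S i) := fun i =>
    disjointedRec (fun _ _ h => h.diff Metric.isClosed_closedBall.measurableSet)
      Metric.isClosed_closedBall.measurableSet
  have hd : Pairwise (Function.onFun Disjoint S) := disjoint_disjointed _
  have hU : ⋃ i, S i = univ := by
    rw [hS, iUnion_disjointed]
    exact eq_univ_of_forall fun v => mem_iUnion.2 (hcover v)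
  have hsub : ∀ i, ∀ v ∈ S i, dist v (u i) ≤ δ := fun i v hv =>
    disjointed_subset (fun i => Metric.closedBall (u i) δ) i hv
  have hfF := integrable_smul_of_continuous hf hF
  have hsum : ∑ i, ∫ v in S i, f v ∂sphereMeasure = ∫ v, f v ∂sphereMeasure := by
    rw [← integral_iUnion_fintype hm hd fun i => hf.integrableOn, hU, setIntegral_univ]
  refine ⟨fun i => ∫ v in S i, f v ∂sphereMeasure,
    fun i => integral_nonneg hf0, hsum, ?_⟩
  have h1 : (∫ v, f v • F v ∂sphereMeasure) - ∑ i, (∫ v in S i, f v ∂sphereMeasure) • F (u i) =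
      ∑ i, ∫ v in S i, f v • (F v - F (u i)) ∂sphereMeasure := by
    rw [← setIntegral_univ, ← hU, integral_iUnion_fintype hm hd fun i => hfF.integrableOn,
      ← Finset.sum_sub_distrib]
    refine Finset.sum_congr rfl fun i _ => ?_
    rw [← integral_smul_const, ← integral_sub hfF.integrableOn (hf.integrableOn.smul_const _)]
    simp_rw [smul_sub]
  rw [h1, ← hsum, Finset.mul_sum]
  refine norm_sum_le_of_le _ fun i _ => ?_
  rw [← integral_const_mul]
  refine norm_integral_le_of_norm_le (hf.integrableOn.const_mul e) ?_
  filter_upwards [ae_restrict_mem (hm i)] with v hv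
  rw [norm_smul, Real.norm_eq_abs, abs_of_nonneg (hf0 v), mul_comm]
  exact mul_le_mul_of_nonneg_right (he v i (hsub i v hv)) (hf0 v)

instance : Measure.IsOpenPosMeasure sphereMeasure := by
  unfold sphereMeasure; infer_instance

/-- The value of a continuous function at a point is approximated by its weighted mean, for a
continuous weight concentrated near this point. -/
lemma exists_bump (hF : Continuous F) (u : S2) {e : ℝ} (he : 0 < e) :
    ∃ f : S2 → ℝ, Continuous f ∧ (∀ v, 0 ≤ f v) ∧ ∫ v, f v ∂sphereMeasure = 1 ∧
      ‖(∫ v, f v • F v ∂sphereMeasure) - F u‖ ≤ e := by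
  obtain ⟨η, hη, h⟩ := Metric.continuousAt_iff.1 (hF.continuousAt (x := u)) e he
  have hc : Continuous fun v => max 0 (η - dist v u) := by fun_prop
  have hi : Integrable (fun v => max 0 (η - dist v u)) sphereMeasure :=
    hc.integrable_of_hasCompactSupport (HasCompactSupport.of_compactSpace _)
  set Z := ∫ v, max 0 (η - dist v u) ∂sphereMeasure with hZ
  have hZ0 : 0 < Z := by
    refine hc.integral_pos_of_hasCompactSupport_nonneg_nonzero
      (HasCompactSupport.of_compactSpace _) (fun v => le_max_left _ _) (x := u) ?_
    simp only [dist_self, sub_zero, max_eq_right hη.le]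
    exact hη.ne'
  set f : S2 → ℝ := fun v => max 0 (η - dist v u) / Z with hf
  have hfc : Continuous f := hc.div_const Z
  have hfi : Integrable f sphereMeasure := hi.div_const Z
  have hf0 : ∀ v, 0 ≤ f v := fun v => div_nonneg (le_max_left _ _) hZ0.le
  have hf1 : ∫ v, f v ∂sphereMeasure = 1 := by
    rw [hf, integral_div, ← hZ, div_self hZ0.ne']
  refine ⟨f, hfc, hf0, hf1, ?_⟩
  have h1 : (∫ v, f v • F v ∂sphereMeasure) - F u =
      ∫ v, f v • (F v - F u) ∂sphereMeasure := by
    simp_rw [smul_sub]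
    rw [integral_sub (integrable_smul_of_continuous hfi hF) (hfi.smul_const _),
      integral_smul_const, hf1, one_smul]
  have h2 : ∫ v, e * f v ∂sphereMeasure = e := by rw [integral_const_mul, hf1, mul_one]
  rw [h1, ← h2]
  refine norm_integral_le_of_norm_le (hfi.const_mul e) (ae_of_all _ fun v => ?_)
  rw [norm_smul, Real.norm_eq_abs, abs_of_nonneg (hf0 v), mul_comm]
  by_cases hv : dist v u < η
  · rw [← dist_eq_norm]
    exact mul_le_mul_of_nonneg_right (h hv).le (hf0 v)
  · have : f v = 0 := by
      rw [hf]
      simp only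
      rw [max_eq_left (by linarith), zero_div]
    rw [this, mul_zero, mul_zero]

/-- A weighted sum of values of a continuous function is approximated by a weighted integral. -/
lemma exists_illumination_near_sum (hF : Continuous F) {n : ℕ} (u : Fin n → S2) {w : Fin n → ℝ}
    (hw : ∀ i, 0 ≤ w i) (hw1 : ∑ i, w i ≤ 1) {e : ℝ} (he : 0 < e) :
    ∃ f : S2 → ℝ, Continuous f ∧ (∀ v, 0 ≤ f v) ∧ ∫ v, f v ∂sphereMeasure ≤ 1 ∧
      ‖(∫ v, f v • F v ∂sphereMeasure) - ∑ i, w i • F (u i)‖ ≤ e := by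
  choose f hfc hf0 hf1 hfe using fun i => exists_bump hF (u i) he
  have hi : ∀ i, Integrable (f i) sphereMeasure := fun i =>
    (hfc i).integrable_of_hasCompactSupport (HasCompactSupport.of_compactSpace _)
  refine ⟨fun v => ∑ i, w i * f i v, by fun_prop,
    fun v => Finset.sum_nonneg fun i _ => mul_nonneg (hw i) (hf0 i v), ?_, ?_⟩
  · rw [integral_finsetSum _ fun i _ => (hi i).const_mul _]
    simpa only [integral_const_mul, hf1, mul_one] using hw1
  · have h1 : ∫ v, (∑ i, w i * f i v) • F v ∂sphereMeasure =
        ∑ i, w i • ∫ v, f i v • F v ∂sphereMeasure := by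
      simp_rw [Finset.sum_smul, mul_smul]
      rw [integral_finsetSum (f := fun i v => w i • f i v • F v) _
        fun i _ => (integrable_smul_of_continuous (hi i) hF).smul (w i)]
      simp_rw [integral_smul]
    rw [h1, ← Finset.sum_sub_distrib]
    calc _ ≤ ∑ i, w i * e := by
          refine norm_sum_le_of_le _ fun i _ => ?_
          rw [← smul_sub, norm_smul, Real.norm_eq_abs, abs_of_nonneg (hw i)]
          exact mul_le_mul_of_nonneg_left (hfe i) (hw i)
      _ = (∑ i, w i) * e := by rw [Finset.sum_mul]
      _ ≤ e := mul_le_of_le_one_left he.le hw1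

end Weights

section Nonneg

variable {m : ℕ}

lemma integral_euclidean_apply {F : S2 → EuclideanSpace ℝ (Fin m)}
    (hF : Integrable F sphereMeasure) (i : Fin m) :
    (∫ v, F v ∂sphereMeasure) i = ∫ v, F v i ∂sphereMeasure :=
  ((EuclideanSpace.proj i : EuclideanSpace ℝ (Fin m) →L[ℝ] ℝ).integral_comp_comm hF).symm

/-- In the nonnegative orthant the norm is monotone. -/
lemma norm_le_norm_add_of_nonneg {x y : EuclideanSpace ℝ (Fin m)} (hx : ∀ i, 0 ≤ x i)
    (hy : ∀ i, 0 ≤ y i) : ‖y‖ ≤ ‖x + y‖ := by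
  rw [EuclideanSpace.norm_eq, EuclideanSpace.norm_eq]
  refine Real.sqrt_le_sqrt (Finset.sum_le_sum fun i _ => ?_)
  rw [PiLp.add_apply, Real.norm_eq_abs, Real.norm_eq_abs, abs_of_nonneg (hy i),
    abs_of_nonneg (add_nonneg (hx i) (hy i))]
  have := hx i
  have := hy i
  gcongr
  linarith

end Nonneg

section Cones

variable {m : ℕ} {O : LambertianObject} {c : Camera m}

lemma ambientImage_nonneg (hdepth : 0 < O.depth) (hreflect : O.reflectivity < 1) (i : Fin m) :
    0 ≤ ambientImage O c i := by
  have hc := continuous_pointImage (c := c) hdepth hreflect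
  rw [ambientImage, PiLp.smul_apply, integral_euclidean_apply
    (hc.integrable_of_hasCompactSupport (HasCompactSupport.of_compactSpace _))]
  exact smul_nonneg (by positivity)
    (integral_nonneg fun v => pointImage_nonneg hdepth hreflect v i)

/-- The average of the nonnegative continuous function `u ↦ ȳ[u]` is `y_a`. -/
lemma pointImage_eq_zero_of_ambientImage_eq_zero (hdepth : 0 < O.depth)
    (hreflect : O.reflectivity < 1) (h : ambientImage O c = 0) (u : S2) :
    pointImage O c u = 0 := by
  have hc := continuous_pointImage (c := c) hdepth hreflect
  have hσ : 0 < sphereMeasure.real univ :=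
    ENNReal.toReal_pos (isOpen_univ.measure_pos _ ⟨u, mem_univ u⟩).ne' (measure_ne_top _ _)
  have h0 : ∫ v, pointImage O c v ∂sphereMeasure = 0 :=
    (smul_eq_zero.1 h).resolve_left (by positivity)
  ext i
  have hci : Continuous fun v => pointImage O c v i :=
    (EuclideanSpace.proj i : EuclideanSpace ℝ (Fin m) →L[ℝ] ℝ).continuous.comp hc
  by_contra hne
  have h1 := hci.integral_pos_of_hasCompactSupport_nonneg_nonzero (μ := sphereMeasure)
    (HasCompactSupport.of_compactSpace _) (fun v => pointImage_nonneg hdepth hreflect v i)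
    (x := u) hne
  rw [← integral_euclidean_apply
    (hc.integrable_of_hasCompactSupport (HasCompactSupport.of_compactSpace _)), h0] at h1
  exact lt_irrefl _ h1

/-- The cone of images is close to the sampled cone: the weight of every direction is handed over
to a sampling direction nearby, which changes the image of a unit of light by at most `e`. A unit
vector of the cone carries at most `1 / (α ‖y_a‖)` units of light. -/
lemma infDist_sampledCone_le (hdepth : 0 < O.depth) (hreflect : O.reflectivity < 1)
    (hya : ambientImage O c ≠ 0) {α δ e : ℝ} (hα : 0 < α) {n : ℕ} {u : Fin n → S2}
    (he0 : 0 ≤ e) (hcover : ∀ v, ∃ i, dist v (u i) ≤ δ)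
    (he : ∀ v i, dist v (u i) ≤ δ → ‖pointImage O c v - pointImage O c (u i)‖ ≤ e)
    {y : EuclideanSpace ℝ (Fin m)} (hy : y ∈ ambientCone O c α) (hy1 : ‖y‖ = 1) :
    Metric.infDist y (sampledCone O c α u) ≤ e / (α * ‖ambientImage O c‖) := by
  have hc := continuous_pointImage (c := c) hdepth hreflect
  obtain ⟨r, hr, _, ⟨f, hf, hf1, rfl⟩, rfl⟩ := hy
  have hfi := integrable_of_mem_illuminations hf
  obtain ⟨w, hw0, hw1, hw⟩ := exists_weights_near_integral hc hfi hf.1 hcover he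
  have hyn : 0 < ‖ambientImage O c‖ := norm_pos_iff.2 hya
  rw [image_add_ambient hdepth hreflect hfi] at hy1 ⊢
  set ya := ambientImage O c with hya'
  set I := ∫ v, f v • pointImage O c v ∂sphereMeasure with hI
  -- The images are nonnegative, hence the ambient part of a unit vector is not longer than `1`.
  have hr1 : r ≤ 1 / (α * ‖ya‖) := by
    rw [le_div_iff₀ (by positivity), ← hy1, norm_smul, Real.norm_eq_abs, abs_of_nonneg hr]
    refine mul_le_mul_of_nonneg_left ?_ hr
    have h1 : α * ‖ya‖ = ‖α • ya‖ := by rw [norm_smul, Real.norm_eq_abs, abs_of_pos hα]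
    rw [h1]
    refine norm_le_norm_add_of_nonneg (fun i => ?_) fun i => ?_
    · rw [hI, integral_euclidean_apply (integrable_smul_of_continuous hfi hc)]
      exact integral_nonneg fun v =>
        mul_nonneg (hf.1 v) (pointImage_nonneg hdepth hreflect v i)
    · exact mul_nonneg hα.le (ambientImage_nonneg hdepth hreflect i)
  -- The surplus of ambient light is a multiple of the generator `y_a`.
  have hmem : r • ((∑ i, w i • pointImage O c (u i)) + α • ya) ∈ sampledCone O c α u := by
    have e1 : (∑ i, w i • pointImage O c (u i)) + α • ya =
        (∑ i, w i • (pointImage O c (u i) + α • ya)) + ((1 - ∑ i, w i) * α) • ya := by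
      simp_rw [smul_add]
      rw [Finset.sum_add_distrib, ← Finset.sum_smul, add_assoc, smul_smul, ← add_smul]
      congr 2; ring
    rw [e1]
    refine PointedCone.smul_mem _ hr (add_mem (sum_mem fun i _ => ?_) ?_)
    · exact PointedCone.smul_mem _ (hw0 i) (PointedCone.subset_hull (Or.inl ⟨i, rfl⟩))
    · refine PointedCone.smul_mem _ (mul_nonneg ?_ hα.le) (PointedCone.subset_hull (Or.inr rfl))
      rw [hw1]
      linarith
  refine (Metric.infDist_le_dist_of_mem hmem).trans ?_
  rw [dist_eq_norm, ← smul_sub, add_sub_add_right_eq_sub, norm_smul, Real.norm_eq_abs,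
    abs_of_nonneg hr]
  calc _ ≤ 1 / (α * ‖ya‖) * (e * 1) := by
        gcongr
        exact hw.trans (by gcongr)
    _ = _ := by ring

lemma exists_weights_of_mem_sampledCone {α : ℝ} {n : ℕ} {u : Fin n → S2}
    {y : EuclideanSpace ℝ (Fin m)} (hy : y ∈ sampledCone O c α u) :
    ∃ (w : Fin n → ℝ) (w₀ : ℝ), (∀ i, 0 ≤ w i) ∧ 0 ≤ w₀ ∧
      y = (∑ i, w i • (pointImage O c (u i) + α • ambientImage O c)) + w₀ • ambientImage O c := by
  refine Submodule.span_induction (p := fun y _ => ∃ (w : Fin n → ℝ) (w₀ : ℝ),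
    (∀ i, 0 ≤ w i) ∧ 0 ≤ w₀ ∧ y = (∑ i, w i • (pointImage O c (u i) + α • ambientImage O c)) +
      w₀ • ambientImage O c) ?_ ?_ ?_ ?_ hy
  · rintro _ (⟨i, rfl⟩ | rfl)
    · refine ⟨Pi.single i 1, 0, fun j => ?_, le_rfl, ?_⟩
      · by_cases h : j = i
        · subst h; simp
        · simp [h]
      · simp only [Pi.single_apply, ite_smul, one_smul, zero_smul, add_zero]
        rw [Finset.sum_ite_eq' Finset.univ i, if_pos (Finset.mem_univ i)]
    · exact ⟨0, 1, fun _ => le_rfl, zero_le_one, by simp⟩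
  · exact ⟨0, 0, fun _ => le_rfl, le_rfl, by simp⟩
  · rintro _ _ - - ⟨w, w₀, h1, h2, rfl⟩ ⟨w', w₀', h1', h2', rfl⟩
    refine ⟨w + w', w₀ + w₀', fun i => add_nonneg (h1 i) (h1' i), add_nonneg h2 h2', ?_⟩
    simp_rw [Pi.add_apply, add_smul, Finset.sum_add_distrib]
    abel
  · rintro a _ - ⟨w, w₀, h1, h2, rfl⟩
    refine ⟨fun i => (a : ℝ) * w i, a * w₀, fun i => mul_nonneg a.2 (h1 i), mul_nonneg a.2 h2, ?_⟩
    have h3 : ∀ z : EuclideanSpace ℝ (Fin m), a • z = (a : ℝ) • z := fun _ => rfl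
    rw [h3, smul_add, Finset.smul_sum]
    simp_rw [mul_smul]

/-- The sampled cone lies in the closure of the cone of images: a point light source is the limit
of continuous illuminations which concentrate at its direction. -/
lemma infDist_ambientCone_le (hdepth : 0 < O.depth) (hreflect : O.reflectivity < 1)
    {α ε : ℝ} (hα : 0 < α) (hε : 0 < ε) {n : ℕ} {u : Fin n → S2}
    {y : EuclideanSpace ℝ (Fin m)} (hy : y ∈ sampledCone O c α u) (hy1 : ‖y‖ = 1) :
    Metric.infDist y (ambientCone O c α) ≤ ε := by
  have hc := continuous_pointImage (c := c) hdepth hreflect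
  obtain ⟨w, w₀, hw, hw₀, rfl⟩ := exists_weights_of_mem_sampledCone hy
  set ya := ambientImage O c with hya'
  -- The total `s` of the weights is the scale at which the illumination has ambient level `α`.
  set s := (∑ i, w i) + w₀ / α with hs
  have hsum : 0 ≤ ∑ i, w i := Finset.sum_nonneg fun i _ => hw i
  have hw₀' : 0 ≤ w₀ / α := div_nonneg hw₀ hα.le
  have hs0 : 0 < s := by
    refine lt_of_le_of_ne (add_nonneg hsum hw₀') fun h => ?_
    have h1 : ∑ i, w i = 0 := by linarith
    have h2 : w₀ = 0 := by
      have : w₀ / α = 0 := by linarith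
      exact (div_eq_zero_iff.1 this).resolve_right hα.ne'
    have h3 : ∀ i, w i = 0 := fun i =>
      (Finset.sum_eq_zero_iff_of_nonneg fun i _ => hw i).1 h1 i (Finset.mem_univ i)
    rw [h2] at hy1
    simp [h3] at hy1
  obtain ⟨f, hfc, hf0, hf1, hf⟩ := exists_illumination_near_sum hc u (w := fun i => w i / s)
    (fun i => div_nonneg (hw i) hs0.le)
    (by rw [← Finset.sum_div, div_le_one hs0]; linarith) (div_pos hε hs0)
  have hfm := mem_illuminations_of_continuous hfc hf0
  have hmem : s • image O c (fun v => f v + α * (1 / sphereMeasure.real univ)) ∈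
      ambientCone O c α := ⟨s, hs0.le, _, ⟨f, hfm, hf1, rfl⟩, rfl⟩
  refine (Metric.infDist_le_dist_of_mem hmem).trans ?_
  rw [image_add_ambient hdepth hreflect (integrable_of_mem_illuminations hfm)]
  have e1 : (∑ i, w i • (pointImage O c (u i) + α • ya)) + w₀ • ya =
      s • ((∑ i, (w i / s) • pointImage O c (u i)) + α • ya) := by
    have e2 : s * α = (∑ i, w i) * α + w₀ := by rw [hs]; field_simp
    simp_rw [smul_add, Finset.smul_sum, smul_smul, mul_div_cancel₀ _ hs0.ne']
    rw [Finset.sum_add_distrib, ← Finset.sum_smul, ← Finset.sum_mul, e2, add_smul, add_assoc]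
  rw [e1, dist_comm, dist_eq_norm, ← smul_sub, add_sub_add_right_eq_sub, norm_smul,
    Real.norm_eq_abs, abs_of_pos hs0]
  calc _ ≤ s * (ε / s) := by gcongr
    _ = ε := mul_div_cancel₀ _ hs0.ne'

/-- The cone sampled at directions whose discs of radius `18 π / √n` cover the sphere approximates
the cone of images up to the order `n ^ (-1 / 4) / α`, by the Hölder continuity of exponent `1 / 2`
of the images. -/
theorem exists_coneDiscrepancy_le (O : LambertianObject) (c : Camera m) (hdepth : 0 < O.depth)
    (hreflect : O.reflectivity < 1) : ∃ K : ℝ, 0 < K ∧ ∀ α ε : ℝ, 0 < α → 0 < ε →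
      ∃ u : Fin ⌈K / (α * ε) ^ 4⌉₊ → S2,
        coneDiscrepancy (ambientCone O c α) (sampledCone O c α u) ≤ ε := by
  obtain ⟨H, hH, hY⟩ := pointImage_holder (c := c) hdepth hreflect
  set A := ‖ambientImage O c‖ with hA
  have hπ := Real.pi_pos
  refine ⟨H ^ 4 * (18 * Real.pi) ^ 2 / A ^ 4 + 1, by positivity, fun α ε hα hε => ?_⟩
  set K := H ^ 4 * (18 * Real.pi) ^ 2 / A ^ 4 + 1 with hK
  have hK0 : 0 < K := by positivity
  set n := ⌈K / (α * ε) ^ 4⌉₊ with hn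
  have hn0 : 0 < n := Nat.ceil_pos.2 (by positivity)
  obtain ⟨u, hu⟩ := exists_covering hn0
  refine ⟨u, max_le (Real.iSup_le (fun ⟨y, hy, hy1⟩ => ?_) hε.le)
    (Real.iSup_le (fun ⟨y, hy, hy1⟩ => infDist_ambientCone_le hdepth hreflect hα hε hy hy1) hε.le)⟩
  -- If the ambient image vanishes, so does the cone of images.
  by_cases hya : ambientImage O c = 0
  · exfalso
    obtain ⟨r, hr, _, ⟨f, hf, hf1, rfl⟩, rfl⟩ := hy
    rw [image_add_ambient hdepth hreflect (integrable_of_mem_illuminations hf), hya] at hy1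
    simp [pointImage_eq_zero_of_ambientImage_eq_zero hdepth hreflect hya] at hy1
  have hA0 : 0 < A := norm_pos_iff.2 hya
  have hn' : (0 : ℝ) < n := Nat.cast_pos.2 hn0
  refine (infDist_sampledCone_le hdepth hreflect hya hα
    (e := H * Real.sqrt (18 * Real.pi / Real.sqrt n)) (by positivity) hu
    (fun v i hv => (hY v (u i)).trans (by gcongr)) hy hy1).trans ?_
  have hKn : H ^ 4 * (18 * Real.pi) ^ 2 ≤ (α * A * ε) ^ 4 * n := by
    have h1 : K / (α * ε) ^ 4 ≤ n := Nat.le_ceil _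
    rw [div_le_iff₀ (by positivity)] at h1
    have h2 : H ^ 4 * (18 * Real.pi) ^ 2 / A ^ 4 ≤ n * (α * ε) ^ 4 := by linarith
    rw [div_le_iff₀ (by positivity)] at h2
    exact h2.trans_eq (by ring)
  rw [div_le_iff₀ (by positivity)]
  refine le_of_pow_le_pow_left₀ (n := 4) four_ne_zero (by positivity) ?_
  have h3 : (H * Real.sqrt (18 * Real.pi / Real.sqrt n)) ^ 4 =
      H ^ 4 * (18 * Real.pi) ^ 2 / n := by
    rw [mul_pow, show (4 : ℕ) = 2 * 2 from rfl, pow_mul (Real.sqrt _), Real.sq_sqrt (by positivity),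
      div_pow, Real.sq_sqrt hn'.le, mul_div_assoc]
  rw [h3, div_le_iff₀ hn']
  exact hKn.trans_eq (by ring)

end Cones

end Lambertian

end

theorem theorem5p2 {m : ℕ} (O : Lambertian.LambertianObject) (c : Lambertian.Camera m)
    (hdepth : 0 < O.depth)
    (hreflect : O.maxAlbedo * (1 - O.minVisibility) < 1) :
    Lambertian.WellPosed O c ∧
    (∀ u u' : Lambertian.S2, ‖(u : Lambertian.E3) - u'‖ ≤ Real.sqrt 2 →
      ‖Lambertian.pointImage O c u - Lambertian.pointImage O c u'‖ ≤
        (2 : ℝ) ^ (1 / 4 : ℝ) *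
          (c.β * O.maxAlbedo * c.focal * c.side /
            (O.depth * (1 - O.maxAlbedo * (1 - O.minVisibility)))) *
          Real.sqrt (2 * O.area * ‖(u : Lambertian.E3) - u'‖ ^ 2 +
            32 * Real.sqrt 2 * Metric.diam O.body * O.maxShadowingLength *
              ‖(u : Lambertian.E3) - u'‖)) ∧
    (∃ K : ℝ, 0 < K ∧ ∀ α ε : ℝ, 0 < α → 0 < ε →
      ∃ u : Fin ⌈K / (α * ε) ^ 4⌉₊ → Lambertian.S2,
        Lambertian.coneDiscrepancy (Lambertian.ambientCone O c α)
          (Lambertian.sampledCone O c α u) ≤ ε) :=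
  ⟨Lambertian.wellPosed O c hdepth hreflect,
    Lambertian.norm_pointImage_sub_le_of_norm_sub_le O c hdepth hreflect,
    Lambertian.exists_coneDiscrepancy_le O c hdepth hreflect⟩
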